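/- Let $\Omega\subset\mathbb R^2$ be a smooth, bounded, simply connected domain, let $g:\partial\Omega\to S^1$ be smooth, and fix $\varepsilon>0$. Let $$E_\varepsilon(u)=\int_\Omega\Big(|\nabla u|^2+\big(\tfrac1{\varepsilon^2}-1\big)\big|\nabla|u|\big|^2\Big),\qquad u\in H^1_g(\Omega):=\{u\in H^1(\Omega;\mathbb R^2):u=g\text{ on }\partial\Omega\}.$$ For $h>0$ put $\Omega_h=\Omega\times(0,h)\subset\mathbb R^3$ and let $$F_h(u)=\int_{\Omega_h}\Big(|\nabla u|^2+\big(\tfrac1{\varepsilon^2}-1\big)\big|\nabla|u|\big|^2\Big),$$ $$\mathcal V_h=\big\{u\in H^1(\Omega_h;\mathbb R^3): u(x,y,z)=g(x,y)\text{ for }(x,y,z)\in\partial\Omega\times(0,h),\ u\perp e_3\text{ on }\Omega\times\{0,h\}\big\},$$ where $e_3$ is the unit vector in the $z$-direction, $\mathbb R^2$ is identified with $\mathbb R^2\times\{0\}\subset\mathbb R^3$, and boundary values are understood in the sense of traces. Let $h_n>0$ with $h_n\to0$, for each $n$ let $w_{h_n}$ be a minimizer of $F_{h_n}$ over $\mathcal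 V_{h_n}$, and set $\widetilde w_{h_n}(x,y,z)=w_{h_n}(x,y,h_nz)$ for $(x,y,z)\in\Omega\times(0,1)$. Then there are a subsequence (not relabelled) and a minimizer $u_\varepsilon$ of $E_\varepsilon$ over $H^1_g(\Omega)$ such that $$\widetilde w_{h_n}\to U_\varepsilon\quad\text{strongly in }H^1(\Omega\times(0,1);\mathbb R^3),\qquad U_\varepsilon(x,y,z)=u_\varepsilon(x,y).$$ -/

import Mathlib

open MeasureTheory Filter Topology
open scoped ContDiff

noncomputable section

namespace ThinFilm

/-- `ℝᵈ` with its Euclidean norm. -/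
abbrev R (d : ℕ) : Type := EuclideanSpace ℝ (Fin d)

/-- The function `v` is a weak partial derivative `∂u/∂xᵢ` on the open set `U ⊆ ℝᵈ`, where `u` and
`v` are functions in `L²(U)`: one may integrate by parts against all test functions in
`C_c^∞(U)`. -/
def HasWeakPartial {d : ℕ} (U : Set (R d)) (i : Fin d) (u v : R d → ℝ) : Prop :=
  ∀ φ : R d → ℝ, ContDiff ℝ ∞ φ → HasCompactSupport φ → tsupport φ ⊆ U →
    ∫ x in U, u x * fderiv ℝ φ x (EuclideanSpace.single i 1) = - ∫ x in U, v x * φ x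

/-- Scalar functions (representatives) in the Sobolev space `H¹(U)`. -/
def MemH1 {d : ℕ} (U : Set (R d)) (u : R d → ℝ) : Prop :=
  MemLp u 2 (volume.restrict U) ∧
    ∀ i, ∃ v, MemLp v 2 (volume.restrict U) ∧ HasWeakPartial U i u v

open Classical in
/-- The weak partial derivative `∂u/∂xᵢ ∈ L²(U)`, which is unique almost everywhere in `U`
(with the value `0` if there is none). -/
def weakPartial {d : ℕ} (U : Set (R d)) (i : Fin d) (u : R d → ℝ) : R d → ℝ :=
  if h : ∃ v, MemLp v 2 (volume.restrict U) ∧ HasWeakPartial U i u v then h.choose else 0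

/-- Strong convergence `u n → v` in `H¹(U)`, for scalar functions. -/
def TendstoH1 {d : ℕ} (U : Set (R d)) (u : ℕ → R d → ℝ) (v : R d → ℝ) : Prop :=
  (∀ n, MemH1 U (u n)) ∧ MemH1 U v ∧
    Tendsto (fun n => eLpNorm (fun x => u n x - v x) 2 (volume.restrict U)) atTop (𝓝 0) ∧
    ∀ i, Tendsto (fun n => eLpNorm (fun x => weakPartial U i (u n) x - weakPartial U i v x) 2
      (volume.restrict U)) atTop (𝓝 0)

/-- Let `σ` be the surface measure on a part `Γ` of the boundary of the bounded Lipschitz domain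
`U`.  The function `u ∈ H¹(U)` has the trace `g` on `Γ`: the trace operator `H¹(U) → L²(Γ)` is the
continuous extension of the restriction `φ ↦ φ|Γ` of functions that are smooth up to the boundary,
so `u` is the limit in `H¹(U)` of such functions whose restrictions converge to `g` in `L²(Γ)`. -/
def HasTrace {d : ℕ} (U : Set (R d)) (σ : Measure (R d)) (u g : R d → ℝ) : Prop :=
  ∃ φ : ℕ → R d → ℝ, (∀ n, ContDiff ℝ ∞ (φ n)) ∧ TendstoH1 U φ u ∧
    Tendsto (fun n => eLpNorm (fun x => φ n x - g x) 2 σ) atTop (𝓝 0)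

/-- The energy `∫_U ( |∇u|² + (1/ε² - 1) |∇|u||² )` of a map `u ∈ H¹(U; ℝᵐ)`, `U ⊆ ℝᵈ`.
(It is `E_ε` for `d = m = 2` and `F_h` for `d = m = 3`, `U = Ω × (0,h)`.) -/
def energy {d m : ℕ} (ε : ℝ) (U : Set (R d)) (u : R d → R m) : ℝ :=
  ∫ x in U, ((∑ i, ∑ j, (weakPartial U i (fun y => u y j) x) ^ 2) +
    (1 / ε ^ 2 - 1) * ∑ i, (weakPartial U i (fun y => ‖u y‖) x) ^ 2)

/-- Open subsets of the plane with smooth boundary: near each of its boundary points, `Ω` is the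
set where a smooth function with nonvanishing derivative is negative. -/
structure IsSmoothOpen (Ω : Set (R 2)) : Prop where
  isOpen : IsOpen Ω
  boundary : ∀ p ∈ frontier Ω, ∃ W ∈ 𝓝 p, ∃ ρ : R 2 → ℝ,
    ContDiff ℝ ∞ ρ ∧ fderiv ℝ ρ p ≠ 0 ∧ ∀ x ∈ W, x ∈ Ω ↔ ρ x < 0

/-- `g : ∂Ω → S¹` is smooth (only the values of `g` on `∂Ω` matter): it takes values in the unit
circle and is the restriction to `∂Ω` of a smooth map of the plane. -/
structure IsSmoothBoundaryMap (Ω : Set (R 2)) (g : R 2 → R 2) : Prop where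
  mapsTo : Set.MapsTo g (frontier Ω) (Metric.sphere 0 1)
  smooth : ∃ G : R 2 → R 2, ContDiff ℝ ∞ G ∧ Set.EqOn g G (frontier Ω)

/-- The point `(x₁, x₂, z)` of `ℝ³`, for `x ∈ ℝ²` and `z ∈ ℝ`. -/
def point (x : R 2) (z : ℝ) : R 3 := !₂[x 0, x 1, z]

/-- The projection `(x, y, z) ↦ (x, y)`. -/
def proj (p : R 3) : R 2 := !₂[p 0, p 1]

/-- The film `Ω × (0,h)` in `ℝ³`. -/
def film (Ω : Set (R 2)) (h : ℝ) : Set (R 3) := {p | proj p ∈ Ω ∧ p 2 ∈ Set.Ioo 0 h}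

/-- Arc length on the curve `∂Ω`. -/
def arcLength (Ω : Set (R 2)) : Measure (R 2) := (μH[1]).restrict (frontier Ω)

/-- Surface measure on the lateral boundary `∂Ω × (0,h)` of the film. -/
def lateralMeasure (Ω : Set (R 2)) (h : ℝ) : Measure (R 3) :=
  ((arcLength Ω).prod (volume.restrict (Set.Ioo 0 h))).map (fun q => point q.1 q.2)

/-- Surface measure on the bottom and top faces `Ω × {0,h}` of the film. -/
def faceMeasure (Ω : Set (R 2)) (h : ℝ) : Measure (R 3) :=
  (volume.restrict Ω).map (fun x => point x 0) + (volume.restrict Ω).map (fun x => point x h)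

/-- The class `H¹_g(Ω; ℝ²)` of maps in `H¹(Ω; ℝ²)` with `u = g` on `∂Ω`. -/
def H1g (Ω : Set (R 2)) (g : R 2 → R 2) : Set (R 2 → R 2) :=
  {u | (∀ j, MemH1 Ω (fun x => u x j)) ∧
    ∀ j, HasTrace Ω (arcLength Ω) (fun x => u x j) (fun x => g x j)}

/-- The class `V_h` of maps `u ∈ H¹(Ω × (0,h); ℝ³)` with `u(x,y,z) = g(x,y)` on `∂Ω × (0,h)` and
`u ⊥ e₃` on `Ω × {0,h}`, where `ℝ²` is identified with `ℝ² × {0}` in `ℝ³`. -/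
def filmClass (Ω : Set (R 2)) (g : R 2 → R 2) (h : ℝ) : Set (R 3 → R 3) :=
  {u | (∀ j, MemH1 (film Ω h) (fun p => u p j)) ∧
    (∀ j, HasTrace (film Ω h) (lateralMeasure Ω h) (fun p => u p j)
      (fun p => point (g (proj p)) 0 j)) ∧
    HasTrace (film Ω h) (faceMeasure Ω h)
      (fun p => inner ℝ (u p) (EuclideanSpace.single 2 (1 : ℝ))) (fun _ => 0)}

/-- `u` minimizes the functional `J` over the class `V`. -/
def IsMinimizer {X : Type*} (J : X → ℝ) (V : Set X) (u : X) : Prop :=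
  u ∈ V ∧ ∀ v ∈ V, J u ≤ J v

/-- The rescaling `(x,y,z) ↦ u(x,y,hz)` to unit thickness. -/
def rescale (h : ℝ) (u : R 3 → R 3) : R 3 → R 3 := fun p => u (point (proj p) (h * p 2))

end ThinFilm

end

open ThinFilm

noncomputable section

open scoped ENNReal NNReal

namespace ThinFilm

/-! Write c = 1/ε² - 1. The weak gradient of |u| is (u/|u|)·∂ᵢu, read as 0 where u = 0
(`VecH1.hasWeakPartial_norm`), so the energy density is ∑ᵢ |∂ᵢu|² + c((u/|u|)·∂ᵢu)². For fixed u
this is a quadratic form in the gradient, bounded below by m|∇u|² with m = min(1, 1+c) > 0, since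
1+c = ε⁻².

Extending a planar competitor v constantly in z costs h·E(v). After rescaling to unit thickness the
factor h cancels: with Q = (∂₁W, ∂₂W, h⁻¹∂₃W) the rescaled minimizer W satisfies ∫ dens(W, Q) ≤ E(v)
for every v in H¹_g (`exists_rescaled`). Coercivity bounds Q in L², hence ∂₃W = hQ₃ tends to 0.

Compactness is reduced to the plane. By averaging, a smooth approximant of W has a horizontal slice
with bounded gradient and nearly correct boundary values, and this slice is L²-close to W because
∂₃W is small (`H1Trace.exists_slice`). The slices are compact in L²(Ω) (`exists_subseq_tendsto_L2`).
This is proved without extending functions across ∂Ω: only the finite length of ∂Ω is used, through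
an L¹ translation estimate for ψ|ψ| cut off outside Ω. The limit keeps the trace because closures of
convex sets of gradients are weakly closed (`exists_h1Trace_of_tendsto`). The third component tends
to 0 because it vanishes on the faces (`H1Trace.eLpNorm_le_of_face`).

Let U be the constant extension of the limit u, with gradient P, and let A(w) be the symmetric
matrix of the form at w. Positivity of the form at w = Wₙ gives m‖Qₙ - P‖² ≤ E(v) - 2∫Qₙ·A(Wₙ)P +
∫P·A(Wₙ)P. Here A(Wₙ)P → A(U)P strongly along an a.e. convergent subsequence. The discontinuity of
w/|w| at 0 is harmless because P = 0 a.e. on {U = 0} (`VecH1.grad_eq_zero`). The right side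
therefore tends to E(v) - E(u). Its nonnegativity is the minimality of u, and v = u yields strong
convergence of the gradients (`minimizes_and_tendsto`). -/

section

/-- The classical partial derivative. -/
def pd {d : ℕ} (i : Fin d) (φ : R d → ℝ) (x : R d) : ℝ :=
  fderiv ℝ φ x (EuclideanSpace.single i 1)

/-! ### Pairings and norms in L². -/

section Integration

variable {α : Type*} [MeasurableSpace α] {μ : Measure α}

theorem enorm_integral_mul_le {f g : α → ℝ} (hf : AEStronglyMeasurable f μ)
    (hg : AEStronglyMeasurable g μ) :
    ‖∫ x, f x * g x ∂μ‖ₑ ≤ eLpNorm f 2 μ * eLpNorm g 2 μ := by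
  have h1 : ‖∫ x, f x * g x ∂μ‖ₑ ≤ eLpNorm (f • g) 1 μ := by
    rw [eLpNorm_one_eq_lintegral_enorm]
    exact enorm_integral_le_lintegral_enorm _
  exact h1.trans (eLpNorm_smul_le_mul_eLpNorm hg hf)

theorem tendsto_integral_mul {f : ℕ → α → ℝ} {f' g : α → ℝ} (hf : ∀ n, MemLp (f n) 2 μ)
    (hf' : MemLp f' 2 μ) (hg : MemLp g 2 μ)
    (h : Tendsto (fun n => eLpNorm (fun x => f n x - f' x) 2 μ) atTop (𝓝 0)) :
    Tendsto (fun n => ∫ x, f n x * g x ∂μ) atTop (𝓝 (∫ x, f' x * g x ∂μ)) := by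
  rw [tendsto_iff_edist_tendsto_0]
  have h0 : Tendsto (fun n => eLpNorm (fun x => f n x - f' x) 2 μ * eLpNorm g 2 μ) atTop
      (𝓝 0) := by
    simpa using ENNReal.Tendsto.mul_const (b := eLpNorm g 2 μ) h (Or.inr hg.2.ne)
  refine tendsto_of_tendsto_of_tendsto_of_le_of_le tendsto_const_nhds h0 (fun _ => zero_le) ?_
  intro n
  have : ∫ x, f n x * g x ∂μ - ∫ x, f' x * g x ∂μ = ∫ x, (f n x - f' x) * g x ∂μ := by
    rw [← integral_sub (f := fun x => f n x * g x) (g := fun x => f' x * g x)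
      ((hf n).integrable_mul hg) (hf'.integrable_mul hg)]
    congr 1; ext x; ring
  simp only [edist_eq_enorm_sub, this]
  exact enorm_integral_mul_le ((hf n).1.sub hf'.1) hg.1

theorem memLp_of_eLpNorm_sub_lt_top {E : Type*} [NormedAddCommGroup E] {f g : α → E}
    (hf : AEStronglyMeasurable f μ) (hg : MemLp g 2 μ)
    (h : eLpNorm (fun x => f x - g x) 2 μ < ⊤) : MemLp f 2 μ := by
  have : MemLp (fun x => f x - g x) 2 μ := ⟨hf.sub hg.1, h⟩
  have h2 := this.add hg
  have e : (fun x => f x - g x) + g = f := by ext x; simp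
  rwa [e] at h2

theorem tendsto_eLpNorm_of_le {E : Type*} [NormedAddCommGroup E] {f : ℕ → α → E}
    (h : ∀ n : ℕ, eLpNorm (f n) 2 μ ≤ ((n : ℝ≥0∞) + 1)⁻¹) :
    Tendsto (fun n => eLpNorm (f n) 2 μ) atTop (𝓝 0) := by
  refine tendsto_of_tendsto_of_tendsto_of_le_of_le tendsto_const_nhds ?_ (fun _ => zero_le) h
  exact_mod_cast (tendsto_add_atTop_iff_nat 1).2 ENNReal.tendsto_inv_nat_nhds_zero

end Integration

/-! ### Weak partial derivatives and traces through smooth approximation. -/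

variable {d : ℕ} {U : Set (R d)}

theorem continuous_pd {i : Fin d} {φ : R d → ℝ} (h : ContDiff ℝ 1 φ) : Continuous (pd i φ) :=
  (h.continuous_fderiv one_ne_zero).clm_apply continuous_const

theorem contDiff_one {φ : R d → ℝ} (h : ContDiff ℝ ∞ φ) : ContDiff ℝ 1 φ :=
  h.of_le (by exact_mod_cast le_top)

theorem memLp_test {φ : R d → ℝ} (h : ContDiff ℝ ∞ φ) (hc : HasCompactSupport φ) :
    MemLp φ 2 (volume.restrict U) :=
  (h.continuous.memLp_of_hasCompactSupport hc).restrict U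

theorem hasCompactSupport_pd {φ : R d → ℝ} (hc : HasCompactSupport φ) (i : Fin d) :
    HasCompactSupport (pd i φ) :=
  hc.fderiv_apply ℝ _

theorem memLp_pd_test {φ : R d → ℝ} (h : ContDiff ℝ ∞ φ) (hc : HasCompactSupport φ) (i : Fin d) :
    MemLp (pd i φ) 2 (volume.restrict U) :=
  ((continuous_pd (contDiff_one h)).memLp_of_hasCompactSupport
    (hasCompactSupport_pd hc i)).restrict U

theorem HasWeakPartial.of_contDiff {i : Fin d} {φ : R d → ℝ} (h : ContDiff ℝ 1 φ) :
    HasWeakPartial U i φ (pd i φ) := by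
  intro η hη hc hs
  have e1 : ∫ x in U, φ x * fderiv ℝ η x (EuclideanSpace.single i 1)
      = ∫ x, φ x * fderiv ℝ η x (EuclideanSpace.single i 1) := by
    refine setIntegral_eq_integral_of_forall_compl_eq_zero fun x hx => ?_
    have : fderiv ℝ η x = 0 := image_eq_zero_of_notMem_tsupport
      fun hx' => hx (hs ((tsupport_fderiv_subset ℝ) hx'))
    simp [this]
  have e2 : ∫ x in U, pd i φ x * η x = ∫ x, pd i φ x * η x := by
    refine setIntegral_eq_integral_of_forall_compl_eq_zero fun x hx => ?_
    simp [image_eq_zero_of_notMem_tsupport fun hx' => hx (hs hx')]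
  rw [e1, e2]
  refine integral_mul_fderiv_eq_neg_fderiv_mul_of_integrable ?_ ?_ ?_ ?_ ?_
  · exact ((continuous_pd h).mul hη.continuous).integrable_of_hasCompactSupport hc.mul_left
  · exact (h.continuous.mul (continuous_pd (contDiff_one hη))).integrable_of_hasCompactSupport
      (hasCompactSupport_pd hc i).mul_left
  · exact (h.continuous.mul hη.continuous).integrable_of_hasCompactSupport hc.mul_left
  · exact fun x _ => (h.differentiable one_ne_zero) x
  · exact fun x _ => ((contDiff_one hη).differentiable one_ne_zero) x

/-- The difference integrates to 0 against every test function, so it vanishes by the fundamental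
lemma of the calculus of variations. This is what allows the arbitrarily chosen `weakPartial` to be
replaced by an explicit gradient. -/
theorem HasWeakPartial.ae_eq (hU : IsOpen U) {i : Fin d} {u v v' : R d → ℝ}
    (hv : LocallyIntegrableOn v U) (hv' : LocallyIntegrableOn v' U)
    (h : HasWeakPartial U i u v) (h' : HasWeakPartial U i u v') :
    v =ᵐ[volume.restrict U] v' := by
  have key : ∀ᵐ x, x ∈ U → v x - v' x = 0 := by
    refine hU.ae_eq_zero_of_integral_contDiff_smul_eq_zero (f := fun x => v x - v' x)
      (hv.sub hv') fun η hη hc hs => ?_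
    have hint : ∀ w : R d → ℝ, LocallyIntegrableOn w U → Integrable (fun x => w x * η x) := by
      intro w hw
      have h1 : IntegrableOn (fun x => w x * η x) (tsupport η) :=
        (hw.integrableOn_compact_subset hs hc).mul_continuousOn hη.continuous.continuousOn hc
      refine (integrableOn_iff_integrable_of_support_subset fun x hx => ?_).1 h1
      exact subset_tsupport η fun h0 => hx (by simp [h0])
    have e : ∀ w : R d → ℝ, ∫ x in U, w x * η x = ∫ x, w x * η x := fun w =>
      setIntegral_eq_integral_of_forall_compl_eq_zero fun x hx => by
        simp [image_eq_zero_of_notMem_tsupport fun hx' => hx (hs hx')]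
    have h1 := h η hη hc hs
    have h2 := h' η hη hc hs
    rw [e] at h1 h2
    have h3 : ∫ x, (v x * η x - v' x * η x) = 0 := by
      rw [integral_sub (hint v hv) (hint v' hv')]; linarith
    rw [← h3]
    congr 1; ext x; simp only [smul_eq_mul]; ring
  rw [Filter.EventuallyEq, ae_restrict_iff' hU.measurableSet]
  filter_upwards [key] with x hx hxU
  linarith [hx hxU]

/-- Integration by parts against a fixed test function is a pair of L² pairings, so weak convergence
of both functions and derivatives preserves it. -/
theorem HasWeakPartial.of_tendsto {i : Fin d} {u : ℕ → R d → ℝ} {p : ℕ → R d → ℝ}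
    {u' p' : R d → ℝ} (h : ∀ n, HasWeakPartial U i (u n) (p n))
    (hu : ∀ η : R d → ℝ, MemLp η 2 (volume.restrict U) →
      Tendsto (fun n => ∫ x in U, u n x * η x) atTop (𝓝 (∫ x in U, u' x * η x)))
    (hp : ∀ η : R d → ℝ, MemLp η 2 (volume.restrict U) →
      Tendsto (fun n => ∫ x in U, p n x * η x) atTop (𝓝 (∫ x in U, p' x * η x))) :
    HasWeakPartial U i u' p' := by
  intro η hη hc hs
  refine tendsto_nhds_unique (hu _ (memLp_pd_test hη hc i)) ?_
  refine ((hp η (memLp_test hη hc)).neg).congr fun n => (h n η hη hc hs).symm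

theorem locallyIntegrableOn_of_memLp {u : R d → ℝ} (hu : MemLp u 2 (volume.restrict U)) :
    LocallyIntegrableOn u U := by
  intro x _
  refine ⟨U ∩ Metric.ball x 1, inter_mem_nhdsWithin _ (Metric.ball_mem_nhds x one_pos), ?_⟩
  have h1 : MemLp u 2 (volume.restrict (U ∩ Metric.ball x 1)) :=
    hu.mono_measure (Measure.restrict_mono Set.inter_subset_left le_rfl)
  have : Fact (volume (U ∩ Metric.ball x 1) < ⊤) :=
    ⟨(measure_mono Set.inter_subset_right).trans_lt measure_ball_lt_top⟩
  exact h1.integrable one_le_two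

theorem weakPartial_spec {i : Fin d} {u : R d → ℝ} (h : MemH1 U u) :
    MemLp (weakPartial U i u) 2 (volume.restrict U) ∧ HasWeakPartial U i u (weakPartial U i u) := by
  rw [weakPartial, dif_pos (h.2 i)]
  exact (h.2 i).choose_spec

theorem weakPartial_ae_eq (hU : IsOpen U) {i : Fin d} {u v : R d → ℝ} 
    (hv : MemLp v 2 (volume.restrict U)) (h : HasWeakPartial U i u v) :
    weakPartial U i u =ᵐ[volume.restrict U] v := by
  have hex : ∃ v, MemLp v 2 (volume.restrict U) ∧ HasWeakPartial U i u v := ⟨v, hv, h⟩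
  rw [weakPartial, dif_pos hex]
  exact hex.choose_spec.2.ae_eq hU (locallyIntegrableOn_of_memLp hex.choose_spec.1)
    (locallyIntegrableOn_of_memLp hv) h

/-- `u` has the weak gradient `p` in `U` and the trace `g` for the measure `σ`: it is approximated
by smooth functions together with its gradient and its trace. -/
structure H1Trace (U : Set (R d)) (σ : Measure (R d)) (u : R d → ℝ) (p : Fin d → R d → ℝ)
    (g : R d → ℝ) : Prop where
  memLp : MemLp u 2 (volume.restrict U)
  memLp_grad : ∀ i, MemLp (p i) 2 (volume.restrict U)
  approx : ∀ e : ℝ≥0∞, e ≠ 0 → ∃ φ : R d → ℝ, ContDiff ℝ ∞ φ ∧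
    eLpNorm (fun x => φ x - u x) 2 (volume.restrict U) ≤ e ∧
    (∀ i, eLpNorm (fun x => pd i φ x - p i x) 2 (volume.restrict U) ≤ e) ∧
    eLpNorm (fun x => φ x - g x) 2 σ ≤ e

variable {σ : Measure (R d)} {u g : R d → ℝ} {p : Fin d → R d → ℝ}

/-- For smooth φ the chosen weak derivative agrees a.e. with the classical one, so approximation in
`TendstoH1` becomes approximation of explicit gradients. -/
theorem HasTrace.h1Trace (hU : IsOpen U) (h : HasTrace U σ u g) :
    H1Trace U σ u (fun i => weakPartial U i u) g := by
  obtain ⟨φ, hφ, ⟨hφ1, hu, hL, hG⟩, hT⟩ := h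
  refine ⟨hu.1, fun i => (weakPartial_spec hu).1, fun e he => ?_⟩
  have he' : 0 < e := pos_iff_ne_zero.2 he
  have h1 := (hL.eventually (ge_mem_nhds he')).and (hT.eventually (ge_mem_nhds he'))
  have h2 : ∀ᶠ n in atTop, ∀ i, eLpNorm (fun x => weakPartial U i (φ n) x - weakPartial U i u x) 2
      (volume.restrict U) ≤ e := eventually_all.2 fun i => (hG i).eventually (ge_mem_nhds he')
  obtain ⟨n, ⟨hn1, hn2⟩, hn3⟩ := (h1.and h2).exists
  refine ⟨φ n, hφ n, hn1, fun i => ?_, hn2⟩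
  rw [eLpNorm_congr_ae (g := fun x => weakPartial U i (φ n) x - weakPartial U i u x)]
  · exact hn3 i
  have : pd i (φ n) =ᵐ[volume.restrict U] weakPartial U i (φ n) :=
    (HasWeakPartial.of_contDiff (contDiff_one (hφ n))).ae_eq hU
      ((continuous_pd (contDiff_one (hφ n))).locallyIntegrable.locallyIntegrableOn U)
      (locallyIntegrableOn_of_memLp (weakPartial_spec (hφ1 n)).1)
      (weakPartial_spec (hφ1 n)).2
  filter_upwards [this] with x hx
  rw [hx]

namespace H1Trace

theorem exists_seq (h : H1Trace U σ u p g) : ∃ φ : ℕ → R d → ℝ, (∀ n, ContDiff ℝ ∞ (φ n)) ∧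
    (∀ n, MemLp (φ n) 2 (volume.restrict U)) ∧
    (∀ n i, MemLp (pd i (φ n)) 2 (volume.restrict U)) ∧
    Tendsto (fun n => eLpNorm (fun x => φ n x - u x) 2 (volume.restrict U)) atTop (𝓝 0) ∧
    (∀ i, Tendsto (fun n => eLpNorm (fun x => pd i (φ n) x - p i x) 2 (volume.restrict U))
      atTop (𝓝 0)) ∧
    Tendsto (fun n => eLpNorm (fun x => φ n x - g x) 2 σ) atTop (𝓝 0) := by
  have hne : ∀ n : ℕ, ((n : ℝ≥0∞) + 1)⁻¹ ≠ 0 := fun n =>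
    ENNReal.inv_ne_zero.2 (by finiteness)
  have hlt : ∀ n : ℕ, ((n : ℝ≥0∞) + 1)⁻¹ < ⊤ := fun n => ENNReal.inv_lt_top.2 (by positivity)
  choose φ hφ h1 h2 h3 using fun n : ℕ => h.approx _ (hne n)
  refine ⟨φ, hφ, fun n => ?_, fun n i => ?_, tendsto_eLpNorm_of_le h1,
    fun i => tendsto_eLpNorm_of_le fun n => h2 n i, tendsto_eLpNorm_of_le h3⟩
  · exact memLp_of_eLpNorm_sub_lt_top (hφ n).continuous.aestronglyMeasurable h.memLp
      ((h1 n).trans_lt (hlt n))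
  · exact memLp_of_eLpNorm_sub_lt_top (continuous_pd (contDiff_one (hφ n))).aestronglyMeasurable
      (h.memLp_grad i) ((h2 n i).trans_lt (hlt n))

theorem hasWeakPartial (h : H1Trace U σ u p g) (i : Fin d) : HasWeakPartial U i u (p i) := by
  obtain ⟨φ, hφ, h1, h2, h3, h4, -⟩ := h.exists_seq
  refine HasWeakPartial.of_tendsto (fun n => HasWeakPartial.of_contDiff (contDiff_one (hφ n)))
    (fun η hη => tendsto_integral_mul h1 h.memLp hη h3)
    (fun η hη => tendsto_integral_mul (fun n => h2 n i) (h.memLp_grad i) hη (h4 i))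

theorem memH1 (h : H1Trace U σ u p g) : MemH1 U u :=
  ⟨h.memLp, fun i => ⟨p i, h.memLp_grad i, h.hasWeakPartial i⟩⟩

theorem weakPartial_ae_eq (hU : IsOpen U) (h : H1Trace U σ u p g) (i : Fin d) :
    weakPartial U i u =ᵐ[volume.restrict U] p i :=
  ThinFilm.weakPartial_ae_eq hU (h.memLp_grad i) (h.hasWeakPartial i)

theorem hasTrace (hU : IsOpen U) (h : H1Trace U σ u p g) : HasTrace U σ u g := by
  obtain ⟨φ, hφ, h1, h2, h3, h4, h5⟩ := h.exists_seq
  refine ⟨φ, hφ, ⟨fun n => ⟨h1 n, fun i => ⟨_, h2 n i,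
    HasWeakPartial.of_contDiff (contDiff_one (hφ n))⟩⟩, h.memH1, h3, fun i => ?_⟩, h5⟩
  refine (h4 i).congr fun n => eLpNorm_congr_ae ?_
  filter_upwards [h.weakPartial_ae_eq hU i, ThinFilm.weakPartial_ae_eq hU (h2 n i)
    (HasWeakPartial.of_contDiff (contDiff_one (hφ n)))] with x hx hx'
  rw [hx, hx']

theorem congr_trace (h : H1Trace U σ u p g) {g' : R d → ℝ} (hg : g =ᵐ[σ] g') :
    H1Trace U σ u p g' := by
  refine ⟨h.memLp, h.memLp_grad, fun e he => ?_⟩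
  obtain ⟨φ, h1, h2, h3, h4⟩ := h.approx e he
  refine ⟨φ, h1, h2, h3, ?_⟩
  rw [eLpNorm_congr_ae (g := fun x => φ x - g x)]
  · exact h4
  filter_upwards [hg] with x hx
  rw [hx]

end H1Trace

end

/-! ### L² convergence, vector-valued maps and the chain rule. -/

section

section LTwo

variable {α : Type*} [MeasurableSpace α] {μ : Measure α} {E : Type*} [NormedAddCommGroup E]

theorem eLpNorm_two_sq (f : α → E) : eLpNorm f 2 μ ^ 2 = ∫⁻ x, ‖f x‖ₑ ^ 2 ∂μ := by
  have := eLpNorm_nnreal_pow_eq_lintegral (μ := μ) (f := f) (p := 2) (by norm_num)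
  simpa using this

theorem tendsto_zero_of_sq {a : ℕ → ℝ≥0∞} (h : Tendsto (fun n => a n ^ 2) atTop (𝓝 0)) :
    Tendsto a atTop (𝓝 0) := by
  have h2 := h.ennrpow_const (1 / 2 : ℝ)
  rw [ENNReal.zero_rpow_of_pos (by norm_num)] at h2
  refine h2.congr fun n => ?_
  rw [← ENNReal.rpow_natCast, ← ENNReal.rpow_mul]
  norm_num

theorem tendsto_sq_zero {a : ℕ → ℝ≥0∞} (h : Tendsto a atTop (𝓝 0)) :
    Tendsto (fun n => a n ^ 2) atTop (𝓝 0) := by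
  simpa using ENNReal.Tendsto.pow (n := 2) h

theorem tendsto_eLpNorm_of_dominated {f : ℕ → α → E} {f' : α → E} {b : α → ℝ}
    (hf : ∀ n, AEStronglyMeasurable (f n) μ) (hf' : AEStronglyMeasurable f' μ)
    (hb : MemLp b 2 μ) (hbd : ∀ n, ∀ᵐ x ∂μ, ‖f n x - f' x‖ ≤ b x)
    (h : ∀ᵐ x ∂μ, Tendsto (fun n => f n x) atTop (𝓝 (f' x))) :
    Tendsto (fun n => eLpNorm (fun x => f n x - f' x) 2 μ) atTop (𝓝 0) := by
  refine tendsto_zero_of_sq ?_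
  simp only [eLpNorm_two_sq]
  have h0 : (0 : ℝ≥0∞) = ∫⁻ _, 0 ∂μ := by simp
  rw [h0]
  refine tendsto_lintegral_of_dominated_convergence' (fun x => ‖b x‖ₑ ^ 2)
    (fun n => ((hf n).sub hf').enorm.pow_const 2) ?_ ?_ ?_
  · intro n
    filter_upwards [hbd n] with x hx
    gcongr
    rw [enorm_le_iff_norm_le]
    exact hx.trans (le_abs_self _)
  · rw [← eLpNorm_two_sq]
    exact ENNReal.pow_ne_top hb.2.ne
  · filter_upwards [h] with x hx
    refine tendsto_sq_zero ?_
    have := (hx.sub_const (f' x)).enorm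
    simpa using this

theorem exists_subseq_ae {f : ℕ → α → E} {f' : α → E}
    (hf : ∀ n, AEStronglyMeasurable (f n) μ) (hf' : AEStronglyMeasurable f' μ)
    (h : Tendsto (fun n => eLpNorm (fun x => f n x - f' x) 2 μ) atTop (𝓝 0)) :
    ∃ k : ℕ → ℕ, StrictMono k ∧ ∀ᵐ x ∂μ, Tendsto (fun n => f (k n) x) atTop (𝓝 (f' x)) :=
  (tendstoInMeasure_of_tendsto_eLpNorm two_ne_zero hf hf' h).exists_seq_tendsto_ae

end LTwo

section Components

variable {α : Type*} [MeasurableSpace α] {μ : Measure α} {m : ℕ}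

theorem norm_le_sum_abs (v : R m) : ‖v‖ ≤ ∑ j, |v j| := by
  rw [EuclideanSpace.norm_eq]
  refine Real.sqrt_le_iff.2 ⟨Finset.sum_nonneg fun j _ => abs_nonneg _, ?_⟩
  simpa using Finset.sum_sq_le_sq_sum_of_nonneg (s := Finset.univ) (f := fun j => |v j|)
    (fun j _ => abs_nonneg _)

theorem abs_apply_le (v : R m) (j : Fin m) : |v j| ≤ ‖v‖ := PiLp.norm_apply_le v j

theorem aestronglyMeasurable_of_apply {f : α → R m}
    (hf : ∀ j, AEStronglyMeasurable (fun x => f x j) μ) : AEStronglyMeasurable f μ := by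
  have h1 : AEStronglyMeasurable (fun x => (fun j => f x j : Fin m → ℝ)) μ :=
    (aemeasurable_pi_lambda _ fun j => (hf j).aemeasurable).aestronglyMeasurable
  exact (PiLp.continuous_toLp 2 _).comp_aestronglyMeasurable h1

theorem aestronglyMeasurable_apply {f : α → R m} (hf : AEStronglyMeasurable f μ) (j : Fin m) :
    AEStronglyMeasurable (fun x => f x j) μ :=
  (EuclideanSpace.proj (𝕜 := ℝ) j).continuous.comp_aestronglyMeasurable hf

theorem eLpNorm_le_sum {f : α → R m} (hf : ∀ j, AEStronglyMeasurable (fun x => f x j) μ) :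
    eLpNorm f 2 μ ≤ ∑ j, eLpNorm (fun x => f x j) 2 μ := by
  have h1 : eLpNorm f 2 μ ≤ eLpNorm (∑ j, fun x => |f x j|) 2 μ :=
    eLpNorm_mono_real fun x => by simpa using norm_le_sum_abs (f x)
  refine h1.trans ((eLpNorm_sum_le (fun j _ => (hf j).norm) one_le_two).trans ?_)
  exact Finset.sum_le_sum fun j _ => (eLpNorm_norm (fun x => f x j)).le

theorem memLp_of_apply {f : α → R m} (hf : ∀ j, MemLp (fun x => f x j) 2 μ) : MemLp f 2 μ :=
  ⟨aestronglyMeasurable_of_apply fun j => (hf j).1,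
    (eLpNorm_le_sum fun j => (hf j).1).trans_lt (ENNReal.sum_lt_top.2 fun j _ => (hf j).2)⟩

theorem memLp_apply {f : α → R m} (hf : MemLp f 2 μ) (j : Fin m) : MemLp (fun x => f x j) 2 μ :=
  hf.mono (aestronglyMeasurable_apply hf.1 j) (Eventually.of_forall fun x => abs_apply_le (f x) j)

theorem tendsto_eLpNorm_of_apply {f : ℕ → α → R m} {f' : α → R m}
    (hf : ∀ n j, AEStronglyMeasurable (fun x => f n x j) μ)
    (hf' : ∀ j, AEStronglyMeasurable (fun x => f' x j) μ)
    (h : ∀ j, Tendsto (fun n => eLpNorm (fun x => f n x j - f' x j) 2 μ) atTop (𝓝 0)) :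
    Tendsto (fun n => eLpNorm (fun x => f n x - f' x) 2 μ) atTop (𝓝 0) := by
  have h0 : Tendsto (fun n => ∑ j, eLpNorm (fun x => f n x j - f' x j) 2 μ) atTop (𝓝 0) := by
    simpa using tendsto_finsetSum Finset.univ fun j _ => h j
  refine tendsto_of_tendsto_of_tendsto_of_le_of_le tendsto_const_nhds h0 (fun _ => zero_le) ?_
  exact fun n => eLpNorm_le_sum fun j => (hf n j).sub (hf' j)

end Components

variable {d m : ℕ} {U : Set (R d)}

/-- The map `u : ℝᵈ → ℝᵐ` has the weak gradient `P` in `U` and the components of `u` are limits of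
smooth functions. -/
def VecH1 (U : Set (R d)) (u : R d → R m) (P : Fin d → R d → R m) : Prop :=
  ∀ j, H1Trace U 0 (fun x => u x j) (fun i x => P i x j) 0

/-- For the zero measure the trace condition is void; only approximability by smooth functions
remains, and that is all the chain rule uses. -/
theorem H1Trace.zero {σ : Measure (R d)} {u g : R d → ℝ} {p : Fin d → R d → ℝ}
    (h : H1Trace U σ u p g) : H1Trace U 0 u p 0 := by
  refine ⟨h.memLp, h.memLp_grad, fun e he => ?_⟩
  obtain ⟨φ, h1, h2, h3, -⟩ := h.approx e he
  exact ⟨φ, h1, h2, h3, by simp⟩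

theorem memLp_comp [IsFiniteMeasure (volume.restrict U)] {F : R m → ℝ} {K : ℝ≥0}
    (hF : LipschitzWith K F) {u : R d → R m} (hu : MemLp u 2 (volume.restrict U)) :
    MemLp (fun x => F (u x)) 2 (volume.restrict U) := by
  have hb : MemLp (fun x => |F 0| + K * ‖u x‖) 2 (volume.restrict U) :=
    MemLp.add (f := fun _ => |F 0|) (memLp_const _) (hu.norm.const_mul (K : ℝ))
  refine hb.mono' (hF.continuous.comp_aestronglyMeasurable hu.1) (Eventually.of_forall fun x => ?_)
  have h1 := hF.norm_sub_le (u x) 0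
  rw [sub_zero] at h1
  calc ‖F (u x)‖ = ‖F 0 + (F (u x) - F 0)‖ := by simp
    _ ≤ |F 0| + K * ‖u x‖ := (norm_add_le _ _).trans (add_le_add le_rfl h1)

theorem hasFDerivAt_toLp {φ : Fin m → R d → ℝ} (hφ : ∀ j, ContDiff ℝ 1 (φ j)) (x : R d) :
    ∃ D : R d →L[ℝ] R m, HasFDerivAt (fun x => (WithLp.toLp 2 fun j => φ j x : R m)) D x ∧
      ∀ v j, D v j = fderiv ℝ (φ j) x v := by
  have h1 : HasFDerivAt (fun x j => φ j x)
      (ContinuousLinearMap.pi fun j => fderiv ℝ (φ j) x) x :=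
    hasFDerivAt_pi.2 fun j => ((hφ j).differentiable one_ne_zero x).hasFDerivAt
  refine ⟨((PiLp.continuousLinearEquiv 2 ℝ (fun _ : Fin m => ℝ)).symm :
    (Fin m → ℝ) →L[ℝ] R m).comp (ContinuousLinearMap.pi fun j => fderiv ℝ (φ j) x), ?_, ?_⟩
  · exact (((PiLp.continuousLinearEquiv 2 ℝ (fun _ : Fin m => ℝ)).symm :
      (Fin m → ℝ) →L[ℝ] R m).hasFDerivAt).comp x h1
  · intro v j
    rfl

theorem contDiff_toLp {φ : Fin m → R d → ℝ} {n : ℕ∞ω} (hφ : ∀ j, ContDiff ℝ n (φ j)) :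
    ContDiff ℝ n (fun x => (WithLp.toLp 2 fun j => φ j x : R m)) :=
  ((PiLp.continuousLinearEquiv 2 ℝ (fun _ : Fin m => ℝ)).symm :
    (Fin m → ℝ) →L[ℝ] R m).contDiff.comp (contDiff_pi.2 hφ)

/-- The chain rule for a `C¹` function with bounded gradient. -/
theorem VecH1.hasWeakPartial_comp [IsFiniteMeasure (volume.restrict U)] {u : R d → R m}
    {P : Fin d → R d → R m} (h : VecH1 U u P) {F : R m → ℝ} (hF : ContDiff ℝ 1 F) {K : ℝ≥0}
    (hK : ∀ y, ‖fderiv ℝ F y‖₊ ≤ K) (i : Fin d) :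
    HasWeakPartial U i (fun x => F (u x)) (fun x => fderiv ℝ F (u x) (P i x)) := by
  have hLip : LipschitzWith K F :=
    lipschitzWith_of_nnnorm_fderiv_le (hF.differentiable one_ne_zero) hK
  have hu : MemLp u 2 (volume.restrict U) := memLp_of_apply fun j => (h j).memLp
  have hP : MemLp (P i) 2 (volume.restrict U) := memLp_of_apply fun j => (h j).memLp_grad i
  choose φ hφ h1 h2 h3 h4 _ using fun j => (h j).exists_seq
  have hc : ∀ n, ContDiff ℝ 1 (fun x => (WithLp.toLp 2 fun j => φ j n x : R m)) := fun n =>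
    contDiff_toLp fun j => contDiff_one (hφ j n)
  have hD : Tendsto (fun n => eLpNorm (fun x => (WithLp.toLp 2 fun j => φ j n x : R m) - u x) 2
      (volume.restrict U)) atTop (𝓝 0) :=
    tendsto_eLpNorm_of_apply (fun n j => (h1 j n).1) (fun j => (h j).memLp.1) h3
  -- F is only C¹, so its derivative is controlled along the approximation by a.e. convergence and
  -- not by a Lipschitz bound.
  obtain ⟨k, hk, hae⟩ := exists_subseq_ae (fun n => (hc n).continuous.aestronglyMeasurable) hu.1 hD
  set Φ : ℕ → R d → R m := fun n x => WithLp.toLp 2 fun j => φ j (k n) x with hΦ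
  set DΦ : ℕ → R d → R m := fun n x => WithLp.toLp 2 fun j => pd i (φ j (k n)) x with hDΦ
  have hΦc : ∀ n, ContDiff ℝ 1 (Φ n) := fun n => hc (k n)
  have hΦL : ∀ n, MemLp (Φ n) 2 (volume.restrict U) := fun n => memLp_of_apply fun j => h1 j (k n)
  have hDL : ∀ n, MemLp (DΦ n) 2 (volume.restrict U) := fun n =>
    memLp_of_apply fun j => h2 j (k n) i
  have hDt : Tendsto (fun n => eLpNorm (fun x => DΦ n x - P i x) 2 (volume.restrict U)) atTop
      (𝓝 0) :=
    tendsto_eLpNorm_of_apply (fun n j => (h2 j (k n) i).1) (fun j => ((h j).memLp_grad i).1)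
      fun j => (h4 j i).comp hk.tendsto_atTop
  have hop : ∀ y v, ‖fderiv ℝ F y v‖ ≤ K * ‖v‖ := fun y v =>
    (fderiv ℝ F y).le_of_opNorm_le (hK y) v
  have hFc : Continuous fun q : R m × R m => fderiv ℝ F q.1 q.2 :=
    ((hF.continuous_fderiv one_ne_zero).comp continuous_fst).clm_apply continuous_snd
  have hmeas : ∀ {a b : R d → R m}, AEStronglyMeasurable a (volume.restrict U) →
      AEStronglyMeasurable b (volume.restrict U) →
      AEStronglyMeasurable (fun x => fderiv ℝ F (a x) (b x)) (volume.restrict U) :=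
    fun ha hb => hFc.comp_aestronglyMeasurable (ha.prodMk hb)
  have hLp : ∀ {a b : R d → R m}, AEStronglyMeasurable a (volume.restrict U) →
      MemLp b 2 (volume.restrict U) →
      MemLp (fun x => fderiv ℝ F (a x) (b x)) 2 (volume.restrict U) := fun ha hb =>
    (hb.norm.const_mul (K : ℝ)).mono' (hmeas ha hb.1) (Eventually.of_forall fun x => hop _ _)
  have hchain : ∀ n x, pd i (fun x => F (Φ n x)) x = fderiv ℝ F (Φ n x) (DΦ n x) := by
    intro n x
    obtain ⟨D, hD1, hD2⟩ := hasFDerivAt_toLp (fun j => contDiff_one (hφ j (k n))) x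
    have := ((hF.differentiable one_ne_zero (Φ n x)).hasFDerivAt.comp x hD1).fderiv
    change fderiv ℝ (F ∘ Φ n) x _ = _
    rw [this]
    change fderiv ℝ F (Φ n x) (D _) = _
    congr 1
    ext j
    exact hD2 _ j
  refine HasWeakPartial.of_tendsto (u := fun n x => F (Φ n x))
    (p := fun n x => fderiv ℝ F (Φ n x) (DΦ n x)) (fun n => ?_) (fun η hη => ?_) (fun η hη => ?_)
  · have := HasWeakPartial.of_contDiff (U := U) (i := i) (hF.comp (hΦc n))
    have e : pd i (F ∘ Φ n) = fun x => fderiv ℝ F (Φ n x) (DΦ n x) := funext fun x => hchain n x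
    rwa [e] at this
  · refine tendsto_integral_mul (fun n => memLp_comp hLip (hΦL n)) (memLp_comp hLip hu) hη ?_
    have h0 : Tendsto (fun n => K * eLpNorm (fun x => Φ n x - u x) 2 (volume.restrict U)) atTop
        (𝓝 0) := by
      simpa using ENNReal.Tendsto.const_mul (a := (K : ℝ≥0∞)) (hD.comp hk.tendsto_atTop)
        (Or.inr ENNReal.coe_ne_top)
    refine tendsto_of_tendsto_of_tendsto_of_le_of_le tendsto_const_nhds h0 (fun _ => zero_le) ?_
    intro n
    have := eLpNorm_le_nnreal_smul_eLpNorm_of_ae_le_mul (μ := volume.restrict U)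
      (f := fun x => F (Φ n x) - F (u x)) (g := fun x => Φ n x - u x) (c := K)
      (Eventually.of_forall fun x => hLip.norm_sub_le _ _) 2
    simpa [ENNReal.smul_def] using this
  -- Split DF(Φₙ)DΦₙ - DF(u)P as DF(Φₙ)(DΦₙ - P) + (DF(Φₙ) - DF(u))P. The first term is at most
  -- K|DΦₙ - P|; the second tends to 0 by domination with 2K|P|.
  · have hA : Tendsto (fun n => eLpNorm (fun x => fderiv ℝ F (Φ n x) (P i x)
        - fderiv ℝ F (u x) (P i x)) 2 (volume.restrict U)) atTop (𝓝 0) := by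
      refine tendsto_eLpNorm_of_dominated (b := fun x => (2 * K : ℝ) * ‖P i x‖)
        (fun n => hmeas (hΦL n).1 hP.1) (hmeas hu.1 hP.1) (hP.norm.const_mul _)
        (fun n => Eventually.of_forall fun x => ?_) ?_
      · refine (norm_sub_le _ _).trans ?_
        linarith [hop (Φ n x) (P i x), hop (u x) (P i x)]
      · filter_upwards [hae] with x hx
        exact (hFc.tendsto (u x, P i x)).comp (hx.prodMk_nhds tendsto_const_nhds)
    have hB : Tendsto (fun n => K * eLpNorm (fun x => DΦ n x - P i x) 2 (volume.restrict U)) atTop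
        (𝓝 0) := by
      simpa using ENNReal.Tendsto.const_mul (a := (K : ℝ≥0∞)) hDt (Or.inr ENNReal.coe_ne_top)
    refine tendsto_integral_mul (fun n => hLp (hΦL n).1 (hDL n)) (hLp hu.1 hP) hη ?_
    refine tendsto_of_tendsto_of_tendsto_of_le_of_le tendsto_const_nhds
      (by simpa using hB.add hA) (fun _ => zero_le) ?_
    intro n
    have e : (fun x => fderiv ℝ F (Φ n x) (DΦ n x) - fderiv ℝ F (u x) (P i x))
        = (fun x => fderiv ℝ F (Φ n x) (DΦ n x - P i x))
          + fun x => fderiv ℝ F (Φ n x) (P i x) - fderiv ℝ F (u x) (P i x) := by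
      ext x; simp
    beta_reduce
    rw [e]
    refine (eLpNorm_add_le (hmeas (hΦL n).1 ((hDL n).1.sub hP.1))
      ((hmeas (hΦL n).1 hP.1).sub (hmeas hu.1 hP.1)) one_le_two).trans (add_le_add ?_ le_rfl)
    have := eLpNorm_le_nnreal_smul_eLpNorm_of_ae_le_mul (μ := volume.restrict U)
      (f := fun x => fderiv ℝ F (Φ n x) (DΦ n x - P i x)) (g := fun x => DΦ n x - P i x) (c := K)
      (Eventually.of_forall fun x => hop _ _) 2
    simpa [ENNReal.smul_def] using this

end

/-! ### The gradient of the modulus and the energy density. -/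

section

variable {d m : ℕ} {U : Set (R d)}

theorem HasWeakPartial.of_dominated {i : Fin d} {u p : ℕ → R d → ℝ} {u' p' b b' : R d → ℝ}
    (h : ∀ n, HasWeakPartial U i (u n) (p n)) (hu : ∀ n, MemLp (u n) 2 (volume.restrict U))
    (hu' : MemLp u' 2 (volume.restrict U)) (hp : ∀ n, MemLp (p n) 2 (volume.restrict U))
    (hp' : MemLp p' 2 (volume.restrict U)) (hb : MemLp b 2 (volume.restrict U))
    (hb' : MemLp b' 2 (volume.restrict U)) (h1 : ∀ n x, ‖u n x - u' x‖ ≤ b x)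
    (h2 : ∀ n x, ‖p n x - p' x‖ ≤ b' x)
    (h3 : ∀ x, Tendsto (fun n => u n x) atTop (𝓝 (u' x)))
    (h4 : ∀ x, Tendsto (fun n => p n x) atTop (𝓝 (p' x))) :
    HasWeakPartial U i u' p' := by
  refine HasWeakPartial.of_tendsto h (fun η hη => ?_) (fun η hη => ?_)
  · exact tendsto_integral_mul hu hu' hη (tendsto_eLpNorm_of_dominated (fun n => (hu n).1) hu'.1 hb
      (fun n => Eventually.of_forall (h1 n)) (Eventually.of_forall h3))
  · exact tendsto_integral_mul hp hp' hη (tendsto_eLpNorm_of_dominated (fun n => (hp n).1) hp'.1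
      hb' (fun n => Eventually.of_forall (h2 n)) (Eventually.of_forall h4))

theorem VecH1.memLp {u : R d → R m} {P : Fin d → R d → R m} (h : VecH1 U u P) :
    MemLp u 2 (volume.restrict U) := memLp_of_apply fun j => (h j).memLp

theorem VecH1.memLp_grad {u : R d → R m} {P : Fin d → R d → R m} (h : VecH1 U u P) (i : Fin d) :
    MemLp (P i) 2 (volume.restrict U) := memLp_of_apply fun j => (h j).memLp_grad i

/-- The direction `u / |u|`, with the value `0` at `u = 0`. -/
def dir (u : R m) : R m := ‖u‖⁻¹ • u

theorem norm_dir_le (u : R m) : ‖dir u‖ ≤ 1 := by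
  rw [dir, norm_smul, norm_inv, norm_norm]
  exact inv_mul_le_one

theorem measurable_dir : Measurable (dir : R m → R m) :=
  (measurable_norm.inv).smul measurable_id

theorem abs_inner_dir_le (u p : R m) : |inner ℝ (dir u) p| ≤ ‖p‖ := by
  refine (abs_real_inner_le_norm _ _).trans ?_
  exact mul_le_of_le_one_left (norm_nonneg _) (norm_dir_le u)

section Regularization

variable {δ : ℝ}

theorem reg_pos (hδ : 0 < δ) (y : R m) : 0 < δ ^ 2 + ‖y‖ ^ 2 := by positivity

/-- √(δ² + |y|²) smooths the norm at the origin: its gradient has norm at most 1, it stays within δ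
of |y|, and its gradient tends to `dir y` at every y, including 0 at y = 0. -/
theorem contDiff_regNorm (hδ : 0 < δ) : ContDiff ℝ 1 fun y : R m => √(δ ^ 2 + ‖y‖ ^ 2) :=
  (contDiff_const.add (contDiff_norm_sq ℝ)).sqrt fun y => (reg_pos hδ y).ne'

theorem fderiv_regNorm (hδ : 0 < δ) (y p : R m) :
    fderiv ℝ (fun y : R m => √(δ ^ 2 + ‖y‖ ^ 2)) y p = inner ℝ y p / √(δ ^ 2 + ‖y‖ ^ 2) := by
  have h1 : HasFDerivAt (fun y : R m => δ ^ 2 + ‖y‖ ^ 2) (2 • innerSL ℝ y) y :=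
    ((hasStrictFDerivAt_norm_sq y).hasFDerivAt).const_add _
  rw [(h1.sqrt (reg_pos hδ y).ne').fderiv]
  simp only [one_div, mul_inv_rev, smul_apply, innerSL_apply_apply, smul_eq_mul,
    nsmul_eq_mul]
  field_simp
  push_cast
  ring

theorem norm_le_regNorm (y : R m) : ‖y‖ ≤ √(δ ^ 2 + ‖y‖ ^ 2) :=
  Real.le_sqrt_of_sq_le (by nlinarith [sq_nonneg δ])

theorem regNorm_le (hδ : 0 < δ) (y : R m) : √(δ ^ 2 + ‖y‖ ^ 2) ≤ ‖y‖ + δ :=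
  Real.sqrt_le_iff.2 ⟨by positivity, by nlinarith [mul_nonneg (norm_nonneg y) hδ.le]⟩

theorem nnnorm_fderiv_regNorm_le (hδ : 0 < δ) (y : R m) :
    ‖fderiv ℝ (fun y : R m => √(δ ^ 2 + ‖y‖ ^ 2)) y‖₊ ≤ 1 := by
  rw [← NNReal.coe_le_coe, coe_nnnorm, NNReal.coe_one]
  refine ContinuousLinearMap.opNorm_le_bound _ zero_le_one fun p => ?_
  rw [fderiv_regNorm hδ, norm_div, one_mul, Real.norm_of_nonneg (Real.sqrt_nonneg _),
    div_le_iff₀ (Real.sqrt_pos.2 (reg_pos hδ y)), mul_comm]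
  exact (norm_inner_le_norm _ _).trans
    (mul_le_mul_of_nonneg_right (norm_le_regNorm y) (norm_nonneg _))

/-- δ·arctan(yⱼ/δ) tends uniformly to 0 with δ, while its derivative along p tends to pⱼ where yⱼ =
0 and to 0 elsewhere. The clash between these two limits forces gradients to vanish on zero sets. -/
theorem contDiff_regArctan (j : Fin m) : ContDiff ℝ 1 fun y : R m => δ * Real.arctan (y j / δ) :=
  contDiff_const.mul (((EuclideanSpace.proj (𝕜 := ℝ) j).contDiff.div_const δ).arctan)

theorem fderiv_regArctan (hδ : 0 < δ) (j : Fin m) (y p : R m) :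
    fderiv ℝ (fun y : R m => δ * Real.arctan (y j / δ)) y p = p j / (1 + (y j / δ) ^ 2) := by
  have h1 : HasFDerivAt (fun y : R m => y j / δ)
      (δ⁻¹ • (EuclideanSpace.proj j : R m →L[ℝ] ℝ)) y := by
    simpa [div_eq_inv_mul] using
      ((EuclideanSpace.proj j : R m →L[ℝ] ℝ).hasFDerivAt (x := y)).const_mul δ⁻¹
  rw [((h1.arctan).const_mul δ).fderiv]
  simp only [one_div, smul_apply, smul_eq_mul]
  field_simp
  rfl

theorem nnnorm_fderiv_regArctan_le (hδ : 0 < δ) (j : Fin m) (y : R m) :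
    ‖fderiv ℝ (fun y : R m => δ * Real.arctan (y j / δ)) y‖₊ ≤ 1 := by
  rw [← NNReal.coe_le_coe, coe_nnnorm, NNReal.coe_one]
  refine ContinuousLinearMap.opNorm_le_bound _ zero_le_one fun p => ?_
  rw [fderiv_regArctan hδ, norm_div, one_mul, Real.norm_of_nonneg (by positivity : (0:ℝ) ≤ 1 + _)]
  exact (div_le_self (norm_nonneg _) (by nlinarith [sq_nonneg (y j / δ)])).trans (abs_apply_le p j)

end Regularization

theorem tendsto_one_div : Tendsto (fun n : ℕ => 1 / ((n : ℝ) + 1)) atTop (𝓝 0) :=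
  tendsto_one_div_add_atTop_nhds_zero_nat

theorem one_div_pos' (n : ℕ) : 0 < 1 / ((n : ℝ) + 1) := by positivity

theorem one_div_le (n : ℕ) : 1 / ((n : ℝ) + 1) ≤ 1 := by
  rw [div_le_one (by positivity)]
  linarith [n.cast_nonneg (α := ℝ)]

/-- The weak gradient of the modulus. -/
theorem VecH1.hasWeakPartial_norm [IsFiniteMeasure (volume.restrict U)] {u : R d → R m}
    {P : Fin d → R d → R m} (h : VecH1 U u P) (i : Fin d) :
    HasWeakPartial U i (fun x => ‖u x‖) (fun x => inner ℝ (dir (u x)) (P i x)) ∧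
      MemLp (fun x => inner ℝ (dir (u x)) (P i x)) 2 (volume.restrict U) := by
  have hu := h.memLp
  have hP := h.memLp_grad i
  have hV : MemLp (fun x => inner ℝ (dir (u x)) (P i x)) 2 (volume.restrict U) :=
    hP.norm.mono' ((measurable_dir.comp_aemeasurable hu.1.aemeasurable).aestronglyMeasurable.inner
      hP.1) (Eventually.of_forall fun x => abs_inner_dir_le _ _)
  refine ⟨?_, hV⟩
  set F : ℕ → R m → ℝ := fun n y => √((1 / ((n : ℝ) + 1)) ^ 2 + ‖y‖ ^ 2) with hF
  have hbound : ∀ n y p, ‖fderiv ℝ (F n) y p‖ ≤ ‖p‖ := fun n y p => by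
    simpa using (fderiv ℝ (F n) y).le_of_opNorm_le (nnnorm_fderiv_regNorm_le (one_div_pos' n) y) p
  have hFu : ∀ n, MemLp (fun x => F n (u x)) 2 (volume.restrict U) := fun n =>
    memLp_comp (lipschitzWith_of_nnnorm_fderiv_le
      ((contDiff_regNorm (one_div_pos' n)).differentiable one_ne_zero)
      (nnnorm_fderiv_regNorm_le (one_div_pos' n))) hu
  have hFp : ∀ n, MemLp (fun x => fderiv ℝ (F n) (u x) (P i x)) 2 (volume.restrict U) := by
    intro n
    refine hP.norm.mono' ?_ (Eventually.of_forall fun x => hbound n _ _)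
    have hc : Continuous fun q : R m × R m => fderiv ℝ (F n) q.1 q.2 :=
      (((contDiff_regNorm (one_div_pos' n)).continuous_fderiv one_ne_zero).comp
        continuous_fst).clm_apply continuous_snd
    exact hc.comp_aestronglyMeasurable (hu.1.prodMk hP.1)
  have hlim : ∀ y : R m, Tendsto (fun n => F n y) atTop (𝓝 ‖y‖) := by
    intro y
    have hc : Continuous fun δ : ℝ => √(δ ^ 2 + ‖y‖ ^ 2) := by fun_prop
    have := (hc.tendsto 0).comp tendsto_one_div
    simpa [Function.comp_def, hF] using this
  refine HasWeakPartial.of_dominated (u := fun n x => F n (u x))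
    (p := fun n x => fderiv ℝ (F n) (u x) (P i x)) (b := fun _ => 1)
    (b' := fun x => 2 * ‖P i x‖)
    (fun n => h.hasWeakPartial_comp (contDiff_regNorm (one_div_pos' n))
      (nnnorm_fderiv_regNorm_le (one_div_pos' n)) i) hFu hu.norm hFp hV (memLp_const _)
    (hP.norm.const_mul 2) (fun n x => ?_) (fun n x => ?_) (fun x => hlim _) (fun x => ?_)
  · rw [Real.norm_eq_abs, abs_le]
    have h1 := norm_le_regNorm (δ := 1 / ((n : ℝ) + 1)) (u x)
    have h2 := regNorm_le (one_div_pos' n) (u x)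
    have h3 := one_div_le n
    constructor <;> simp only [hF] <;> linarith
  · refine (norm_sub_le _ _).trans ?_
    have := abs_inner_dir_le (u x) (P i x)
    rw [← Real.norm_eq_abs] at this
    linarith [hbound n (u x) (P i x)]
  · simp only [hF, fderiv_regNorm (one_div_pos' _)]
    -- At a zero of u the regularized derivative is exactly 0, which matches `dir 0 = 0`.
    by_cases h0 : u x = 0
    · simp [h0, dir]
    · have h1 := (tendsto_const_nhds (x := inner ℝ (u x) (P i x))).div (hlim (u x))
        (norm_ne_zero_iff.2 h0)
      rw [dir, real_inner_smul_left, inv_mul_eq_div]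
      exact h1

/-- The gradient vanishes almost everywhere where the function vanishes. -/
theorem VecH1.grad_eq_zero [IsFiniteMeasure (volume.restrict U)] (hU : IsOpen U) {u : R d → R m}
    {P : Fin d → R d → R m} (h : VecH1 U u P) (i : Fin d) :
    ∀ᵐ x ∂volume.restrict U, u x = 0 → P i x = 0 := by
  have hu := h.memLp
  have hP := h.memLp_grad i
  suffices key : ∀ j, ∀ᵐ x ∂volume.restrict U, u x j = 0 → P i x j = 0 by
    filter_upwards [ae_all_iff.2 key] with x hx h0
    ext j
    exact hx j (by simp [h0])
  intro j
  have huj : AEMeasurable (fun x => u x j) (volume.restrict U) := (memLp_apply hu j).1.aemeasurable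
  set V : R d → ℝ := fun x => (({0} : Set ℝ).indicator (fun _ => (1 : ℝ)) (u x j)) * P i x j with hVd
  have hVm : MemLp V 2 (volume.restrict U) := by
    refine (memLp_apply hP j).mono ?_ (Eventually.of_forall fun x => ?_)
    · exact (((measurable_const.indicator (measurableSet_singleton 0)).comp_aemeasurable
        huj).aestronglyMeasurable).mul (memLp_apply hP j).1
    · simp only [hVd, norm_mul]
      refine mul_le_of_le_one_left (norm_nonneg _) ?_
      refine (norm_indicator_le_norm_self _ _).trans (by simp)
  set F : ℕ → R m → ℝ := fun n y => (1 / ((n : ℝ) + 1)) * Real.arctan (y j / (1 / ((n : ℝ) + 1)))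
    with hF
  have hFu : ∀ n, MemLp (fun x => F n (u x)) 2 (volume.restrict U) := fun n =>
    memLp_comp (lipschitzWith_of_nnnorm_fderiv_le
      ((contDiff_regArctan j).differentiable one_ne_zero)
      (nnnorm_fderiv_regArctan_le (one_div_pos' n) j)) hu
  have hbound : ∀ n y p, ‖fderiv ℝ (F n) y p‖ ≤ |p j| := fun n y p => by
    simp only [hF]
    rw [fderiv_regArctan (one_div_pos' n), norm_div,
      Real.norm_of_nonneg (by positivity : (0:ℝ) ≤ 1 + _)]
    exact div_le_self (norm_nonneg _) (by nlinarith [sq_nonneg (y j / (1 / ((n : ℝ) + 1)))])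
  have hFp : ∀ n, MemLp (fun x => fderiv ℝ (F n) (u x) (P i x)) 2 (volume.restrict U) := by
    intro n
    refine (memLp_apply hP j).norm.mono' ?_ (Eventually.of_forall fun x => hbound n _ _)
    have hc : Continuous fun q : R m × R m => fderiv ℝ (F n) q.1 q.2 :=
      (((contDiff_regArctan j).continuous_fderiv one_ne_zero).comp
        continuous_fst).clm_apply continuous_snd
    exact hc.comp_aestronglyMeasurable (hu.1.prodMk hP.1)
  -- The constant 2 comes from |arctan| < π/2 < 2.
  have hsmall : ∀ n y, |F n y| ≤ (1 / ((n : ℝ) + 1)) * 2 := by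
    intro n y
    simp only [hF]
    rw [abs_mul, abs_of_pos (one_div_pos' n)]
    refine mul_le_mul_of_nonneg_left ?_ (one_div_pos' n).le
    rw [abs_le]
    constructor <;> linarith [Real.pi_lt_four, Real.arctan_lt_pi_div_two (y j / (1 / ((n : ℝ) + 1))),
      Real.neg_pi_div_two_lt_arctan (y j / (1 / ((n : ℝ) + 1)))]
  -- The gradient restricted to {uⱼ = 0} is the limit of derivatives of functions tending to 0,
  -- hence a weak derivative of 0; uniqueness makes it vanish.
  have hweak : HasWeakPartial U i (fun _ => 0) V := by
    refine HasWeakPartial.of_dominated (u := fun n x => F n (u x))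
      (p := fun n x => fderiv ℝ (F n) (u x) (P i x)) (b := fun _ => 2)
      (b' := fun x => 2 * |P i x j|)
      (fun n => h.hasWeakPartial_comp (contDiff_regArctan j)
        (nnnorm_fderiv_regArctan_le (one_div_pos' n) j) i) hFu (memLp_const _) hFp hVm
      (memLp_const _) ((memLp_apply hP j).norm.const_mul 2) (fun n x => ?_) (fun n x => ?_)
      (fun x => ?_) (fun x => ?_)
    · simp only [sub_zero, Real.norm_eq_abs]
      exact (hsmall n _).trans (by linarith [one_div_le n])
    · refine (norm_sub_le _ _).trans ?_
      have h1 : ‖V x‖ ≤ |P i x j| := by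
        simp only [hVd, norm_mul]
        refine mul_le_of_le_one_left (norm_nonneg _) ?_
        refine (norm_indicator_le_norm_self _ _).trans (by simp)
      linarith [hbound n (u x) (P i x)]
    · refine squeeze_zero_norm (fun n => hsmall n (u x)) ?_
      simpa using tendsto_one_div.mul_const 2
    · simp only [hF, fderiv_regArctan (one_div_pos' _)]
      by_cases h0 : u x j = 0
      · simp [hVd, h0]
      · have h1 : Tendsto (fun n : ℕ => 1 + (u x j / (1 / ((n : ℝ) + 1))) ^ 2) atTop atTop := by
          refine tendsto_atTop_add_const_left _ _ ?_
          have h2 : Tendsto (fun n : ℕ => (n : ℝ) + 1) atTop atTop :=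
            tendsto_atTop_add_const_right _ _ tendsto_natCast_atTop_atTop
          have h3 := ((tendsto_pow_atTop two_ne_zero).comp h2).const_mul_atTop
            (pow_pos (abs_pos.2 h0) 2)
          refine h3.congr fun n => ?_
          simp only [Function.comp, sq_abs, div_div_eq_mul_div, div_one]
          ring
        have h2 : V x = 0 := by simp [hVd, h0]
        rw [h2]
        exact tendsto_const_nhds.div_atTop h1
  have hz : HasWeakPartial U i (fun _ => 0) (fun _ => 0) := by
    intro η _ _ _
    simp
  have := hweak.ae_eq hU (locallyIntegrableOn_of_memLp hVm)
    (locallyIntegrableOn_of_memLp (memLp_const 0)) hz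
  filter_upwards [this] with x hx h0
  simpa [hVd, h0] using hx

/-- The energy density in terms of the gradient. -/
def dens (c : ℝ) (u : R m) (P : Fin d → R m) : ℝ :=
  ∑ i, (‖P i‖ ^ 2 + c * (inner ℝ (dir u) (P i)) ^ 2)

theorem VecH1.energy_eq [IsFiniteMeasure (volume.restrict U)] (hU : IsOpen U) {u : R d → R m}
    {P : Fin d → R d → R m} (h : VecH1 U u P) (ε : ℝ) :
    energy ε U u = ∫ x in U, dens (1 / ε ^ 2 - 1) (u x) (fun i => P i x) := by
  refine integral_congr_ae ?_
  have h1 : ∀ᵐ x ∂volume.restrict U, ∀ i j, weakPartial U i (fun y => u y j) x = P i x j :=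
    ae_all_iff.2 fun i => ae_all_iff.2 fun j => (h j).weakPartial_ae_eq hU i
  have h2 : ∀ᵐ x ∂volume.restrict U, ∀ i,
      weakPartial U i (fun y => ‖u y‖) x = inner ℝ (dir (u x)) (P i x) :=
    ae_all_iff.2 fun i => ThinFilm.weakPartial_ae_eq hU (h.hasWeakPartial_norm i).2
      (h.hasWeakPartial_norm i).1
  filter_upwards [h1, h2] with x hx1 hx2
  simp only [hx1, hx2, dens, Finset.sum_add_distrib, Finset.mul_sum, EuclideanSpace.real_norm_sq_eq]

end

/-! ### Pullback by linear maps; the film and its rescaling. -/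

section

section Pullback

/-- Only an inequality between the pushforward and a multiple of the target measure is needed; this
treats volume and surface measures, projection and scaling, in the same way. -/
theorem eLpNorm_comp_le {α β E : Type*} [MeasurableSpace α] [MeasurableSpace β]
    [NormedAddCommGroup E] {μ : Measure α} {ν : Measure β} {T : β → α} {c : ℝ≥0∞}
    (hT : Measurable T) (h : ν.map T ≤ c • μ) {f : α → E} (hf : AEStronglyMeasurable f μ) :
    eLpNorm (fun x => f (T x)) 2 ν ≤ c ^ (1 / 2 : ℝ) * eLpNorm f 2 μ := by
  have hf' : AEStronglyMeasurable f (ν.map T) := (hf.smul_measure c).mono_measure h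
  have h1 := eLpNorm_map_measure (p := 2) hf' hT.aemeasurable
  change eLpNorm (f ∘ T) 2 ν ≤ _
  rw [← h1]
  refine (eLpNorm_mono_measure f h).trans ?_
  rw [eLpNorm_smul_measure_of_ne_top (by norm_num)]
  simp

theorem memLp_comp_map {α β E : Type*} [MeasurableSpace α] [MeasurableSpace β]
    [NormedAddCommGroup E] {μ : Measure α} {ν : Measure β} {T : β → α} {c : ℝ≥0∞} (hc : c ≠ ⊤)
    (hT : Measurable T) (h : ν.map T ≤ c • μ) {f : α → E} (hf : MemLp f 2 μ) :
    MemLp (fun x => f (T x)) 2 ν := by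
  have hf' : AEStronglyMeasurable f (ν.map T) := (hf.1.smul_measure c).mono_measure h
  refine ⟨hf'.comp_measurable hT, (eLpNorm_comp_le hT h hf.1).trans_lt ?_⟩
  exact ENNReal.mul_lt_top (ENNReal.rpow_lt_top_of_nonneg (by norm_num) hc) hf.2

variable {d d' : ℕ} {U : Set (R d)} {U' : Set (R d')} {σ : Measure (R d)} {σ' : Measure (R d')}
  {u g : R d → ℝ} {p : Fin d → R d → ℝ}

theorem pd_comp {T : R d' →L[ℝ] R d} {a : Fin d' → ℝ} {k : Fin d' → Fin d}
    (hT : ∀ i, T (EuclideanSpace.single i 1) = a i • EuclideanSpace.single (k i) 1)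
    {φ : R d → ℝ} (hφ : ContDiff ℝ 1 φ) (i : Fin d') (x : R d') :
    pd i (fun x => φ (T x)) x = a i * pd (k i) φ (T x) := by
  have := ((hφ.differentiable one_ne_zero (T x)).hasFDerivAt.comp x T.hasFDerivAt).fderiv
  rw [pd]
  change fderiv ℝ (φ ∘ T) x _ = _
  rw [this]
  simp [hT, pd]

/-- Composition with a linear map that sends coordinate directions to coordinate directions. -/
theorem H1Trace.comp (h : H1Trace U σ u p g) (T : R d' →L[ℝ] R d) {a : Fin d' → ℝ}
    {k : Fin d' → Fin d}
    (hT : ∀ i, T (EuclideanSpace.single i 1) = a i • EuclideanSpace.single (k i) 1)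
    {c c' : ℝ≥0∞} (hc : c ≠ ⊤) (hc' : c' ≠ ⊤)
    (hU : (volume.restrict U').map T ≤ c • volume.restrict U) (hσ : σ'.map T ≤ c' • σ)
    (hg : AEStronglyMeasurable g σ) :
    H1Trace U' σ' (fun x => u (T x)) (fun i x => a i * p (k i) (T x)) (fun x => g (T x)) := by
  have hTm : Measurable T := T.continuous.measurable
  refine ⟨memLp_comp_map hc hTm hU h.memLp,
    fun i => (memLp_comp_map hc hTm hU (h.memLp_grad (k i))).const_mul (a i), fun e he => ?_⟩
  -- D dominates the norm distortion of the function, of the trace and of every partial derivative,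
  -- so the tolerance e / D brings all errors below e.
  set D : ℝ≥0∞ := c ^ (1 / 2 : ℝ) + c' ^ (1 / 2 : ℝ) + ∑ i, ‖a i‖ₑ * c ^ (1 / 2 : ℝ) with hD
  have hcr : c ^ (1 / 2 : ℝ) ≠ ⊤ := ENNReal.rpow_ne_top_of_nonneg (by norm_num) hc
  have hcr' : c' ^ (1 / 2 : ℝ) ≠ ⊤ := ENNReal.rpow_ne_top_of_nonneg (by norm_num) hc'
  have hDt : D ≠ ⊤ := by
    refine ENNReal.add_ne_top.2 ⟨ENNReal.add_ne_top.2 ⟨hcr, hcr'⟩, ?_⟩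
    exact ENNReal.sum_ne_top.2 fun i _ => ENNReal.mul_ne_top enorm_ne_top hcr
  have hmul : ∀ {b : ℝ≥0∞}, b ≤ D → b * (e / D) ≤ e := fun hb =>
    (mul_le_mul_left hb _).trans ENNReal.mul_div_le
  obtain ⟨φ, hφ, h1, h2, h3⟩ := h.approx (e / D) (ENNReal.div_ne_zero.2 ⟨he, hDt⟩)
  have hφ1 := contDiff_one hφ
  refine ⟨fun x => φ (T x), hφ.comp T.contDiff, ?_, fun i => ?_, ?_⟩
  · refine (eLpNorm_comp_le hTm hU (f := fun x => φ x - u x)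
      (hφ.continuous.aestronglyMeasurable.sub h.memLp.1)).trans ?_
    exact (mul_le_mul_right h1 _).trans (hmul (by rw [hD, add_assoc]; exact le_self_add))
  · have e1 : (fun x => pd i (fun x => φ (T x)) x - a i * p (k i) (T x))
        = a i • fun x => (pd (k i) φ (T x) - p (k i) (T x)) := by
      ext x; rw [pd_comp hT hφ1]; simp [mul_sub]
    rw [e1, eLpNorm_const_smul]
    refine (mul_le_mul_right ((eLpNorm_comp_le hTm hU (f := fun x => pd (k i) φ x - p (k i) x)
      ((continuous_pd hφ1).aestronglyMeasurable.sub (h.memLp_grad (k i)).1)).trans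
        (mul_le_mul_right (h2 (k i)) _)) _).trans ?_
    rw [← mul_assoc]
    refine hmul (le_trans ?_ le_add_self)
    exact Finset.single_le_sum (f := fun i => ‖a i‖ₑ * c ^ (1 / 2 : ℝ)) (fun _ _ => zero_le)
      (Finset.mem_univ i)
  · refine (eLpNorm_comp_le hTm hσ (f := fun x => φ x - g x)
      (hφ.continuous.aestronglyMeasurable.sub hg)).trans ?_
    refine (mul_le_mul_right h3 _).trans (hmul ?_)
    rw [hD]
    exact le_add_self.trans le_self_add

end Pullback

section Film

@[simp] theorem point_zero (x : R 2) (z : ℝ) : point x z 0 = x 0 := rfl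
@[simp] theorem point_one (x : R 2) (z : ℝ) : point x z 1 = x 1 := rfl
@[simp] theorem point_two (x : R 2) (z : ℝ) : point x z 2 = z := rfl
@[simp] theorem proj_zero (p : R 3) : proj p 0 = p 0 := rfl
@[simp] theorem proj_one (p : R 3) : proj p 1 = p 1 := rfl

@[simp] theorem proj_point (x : R 2) (z : ℝ) : proj (point x z) = x := by
  ext j; fin_cases j <;> rfl

@[simp] theorem point_proj (p : R 3) : point (proj p) (p 2) = p := by
  ext j; fin_cases j <;> rfl

/-- The projection to the plane as a continuous linear map. -/
def projL : R 3 →L[ℝ] R 2 :=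
  LinearMap.toContinuousLinearMap
    { toFun := proj
      map_add' := fun p q => by ext j; fin_cases j <;> simp
      map_smul' := fun c p => by ext j; fin_cases j <;> simp }

@[simp] theorem projL_apply (p : R 3) : projL p = proj p := rfl

/-- The linear map `(x, y, z) ↦ (x, y, h z)`. -/
def scaleL (h : ℝ) : R 3 →L[ℝ] R 3 :=
  LinearMap.toContinuousLinearMap
    { toFun := fun p => point (proj p) (h * p 2)
      map_add' := fun p q => by ext j; fin_cases j <;> simp [mul_add]
      map_smul' := fun c p => by ext j; fin_cases j <;> simp [mul_left_comm] }

@[simp] theorem scaleL_apply (h : ℝ) (p : R 3) : scaleL h p = point (proj p) (h * p 2) := rfl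

/-- The identification of `ℝ² × ℝ` with `ℝ³`. -/
def pointE : WithLp 2 (R 2 × ℝ) ≃ₗᵢ[ℝ] R 3 where
  toFun q := point q.fst q.snd
  invFun p := WithLp.toLp 2 (proj p, p 2)
  map_add' p q := by ext j; fin_cases j <;> simp
  map_smul' c p := by ext j; fin_cases j <;> simp
  left_inv q := by simp; rfl
  right_inv p := by simp
  norm_map' q := by
    rw [← sq_eq_sq₀ (norm_nonneg _) (norm_nonneg _), WithLp.prod_norm_sq_eq_of_L2]
    simp only [EuclideanSpace.real_norm_sq_eq, Fin.sum_univ_two, Fin.sum_univ_three]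
    simp

theorem measurePreserving_point :
    MeasurePreserving (fun q : R 2 × ℝ => point q.1 q.2) (volume.prod volume) volume :=
  pointE.measurePreserving.comp (WithLp.volume_preserving_toLp (R 2) ℝ)

theorem continuous_point : Continuous (fun q : R 2 × ℝ => point q.1 q.2) :=
  pointE.continuous.comp (WithLp.prod_continuous_toLp 2 (R 2) ℝ)

theorem continuous_proj : Continuous proj := projL.continuous

theorem measurableEmbedding_point : MeasurableEmbedding (fun q : R 2 × ℝ => point q.1 q.2) :=
  (Homeomorph.mk ⟨fun q : R 2 × ℝ => point q.1 q.2, fun p => (proj p, p 2), fun q => by simp,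
    fun p => by simp⟩ continuous_point
    (continuous_proj.prodMk (EuclideanSpace.proj (𝕜 := ℝ) 2).continuous)).measurableEmbedding

/-- The product of a measure on the plane with the length on `(0,h)`. -/
def cyl (μ : Measure (R 2)) (h : ℝ) : Measure (R 3) :=
  (μ.prod (volume.restrict (Set.Ioo 0 h))).map (fun q => point q.1 q.2)

/-- Volume on the film and surface measure on its lateral boundary are both of the form `cyl μ h`,
so each change of variables is computed once for both. -/
theorem volume_film (Ω : Set (R 2)) (h : ℝ) :
    volume.restrict (film Ω h) = cyl (volume.restrict Ω) h := by
  rw [cyl, Measure.prod_restrict, ← measurePreserving_point.map_eq,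
    measurableEmbedding_point.restrict_map]
  congr 2
  ext q
  simp [film]

theorem map_proj_cyl (μ : Measure (R 2)) [SFinite μ] (h : ℝ) :
    (cyl μ h).map proj = ENNReal.ofReal h • μ := by
  rw [cyl, Measure.map_map continuous_proj.measurable continuous_point.measurable]
  have : proj ∘ (fun q : R 2 × ℝ => point q.1 q.2) = Prod.fst := by ext1 q; simp
  rw [this, Measure.map_fst_prod]
  simp

theorem map_mul_Ioo {h : ℝ} (hh : 0 < h) :
    (volume.restrict (Set.Ioo (0:ℝ) 1)).map (h * ·) =
      ENNReal.ofReal h⁻¹ • volume.restrict (Set.Ioo 0 h) := by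
  have hemb : MeasurableEmbedding (fun x : ℝ => h * x) :=
    (Homeomorph.mulLeft₀ h hh.ne').measurableEmbedding
  have e : Set.Ioo (0:ℝ) 1 = (fun x : ℝ => h * x) ⁻¹' Set.Ioo 0 h := by
    ext x
    simp only [Set.mem_Ioo, Set.mem_preimage]
    constructor
    · exact fun ⟨h1, h2⟩ => ⟨by positivity, by nlinarith⟩
    · exact fun ⟨h1, h2⟩ => ⟨pos_of_mul_pos_right h1 hh.le, by nlinarith⟩
  rw [e, ← hemb.restrict_map, Real.map_volume_mul_left hh.ne', Measure.restrict_smul,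
    abs_of_pos (inv_pos.2 hh)]

theorem map_scale_cyl (μ : Measure (R 2)) [SFinite μ] {h : ℝ} (hh : 0 < h) :
    (cyl μ 1).map (scaleL h) = ENNReal.ofReal h⁻¹ • cyl μ h := by
  have hm : Measurable (fun x : ℝ => h * x) := measurable_const_mul h
  rw [cyl, Measure.map_map (scaleL h).continuous.measurable continuous_point.measurable]
  have : scaleL h ∘ (fun q : R 2 × ℝ => point q.1 q.2)
      = (fun q : R 2 × ℝ => point q.1 q.2) ∘ Prod.map id (fun x => h * x) := by
    ext1 q; simp
  rw [this, ← Measure.map_map continuous_point.measurable (measurable_id.prodMap hm),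
    ← Measure.map_prod_map _ _ measurable_id hm, Measure.map_id, map_mul_Ioo hh,
    Measure.prod_smul_right, Measure.map_smul, cyl]

/-- Vertical scaling carries faces to faces without distorting area, so no factor of h appears, in
contrast to the cylindrical measures. -/
theorem map_scale_face (Ω : Set (R 2)) (h : ℝ) :
    (faceMeasure Ω 1).map (scaleL h) = faceMeasure Ω h := by
  have hm : ∀ z : ℝ, Measurable (fun x : R 2 => point x z) := fun z =>
    (continuous_point.comp (continuous_id.prodMk continuous_const)).measurable
  have hs := (scaleL h).continuous.measurable
  have : ∀ z : ℝ, (scaleL h) ∘ (fun x : R 2 => point x z) = fun x => point x (h * z) := fun z => by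
    ext1 x; simp
  rw [faceMeasure, Measure.map_add _ _ hs, Measure.map_map hs (hm _), Measure.map_map hs (hm _),
    this, this, mul_zero, mul_one, faceMeasure]

theorem projL_single (i : Fin 3) : projL (EuclideanSpace.single i 1)
    = (![1, 1, 0] : Fin 3 → ℝ) i • EuclideanSpace.single ((![0, 1, 0] : Fin 3 → Fin 2) i) 1 := by
  ext j; fin_cases i <;> fin_cases j <;> simp

theorem scaleL_single (h : ℝ) (i : Fin 3) : scaleL h (EuclideanSpace.single i 1)
    = (![1, 1, h] : Fin 3 → ℝ) i • EuclideanSpace.single i 1 := by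
  ext j; fin_cases i <;> fin_cases j <;> simp

theorem isOpen_film {Ω : Set (R 2)} (hΩ : IsOpen Ω) (h : ℝ) : IsOpen (film Ω h) :=
  (hΩ.preimage continuous_proj).inter
    (isOpen_Ioo.preimage (EuclideanSpace.proj (𝕜 := ℝ) (2 : Fin 3)).continuous)

instance isFiniteMeasure_film (Ω : Set (R 2)) [IsFiniteMeasure (volume.restrict Ω)] (h : ℝ) :
    IsFiniteMeasure (volume.restrict (film Ω h)) := by
  rw [volume_film, cyl]
  infer_instance

/-- The constant extension in the thin direction. -/
theorem H1Trace.extend {Ω : Set (R 2)} {σ : Measure (R 2)} [SFinite σ] {u g : R 2 → ℝ}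
    {p : Fin 2 → R 2 → ℝ} (h : H1Trace Ω σ u p g) (hg : AEStronglyMeasurable g σ) (t : ℝ) :
    H1Trace (film Ω t) (cyl σ t) (fun x => u (proj x))
      (fun i x => (![1, 1, 0] : Fin 3 → ℝ) i * p ((![0, 1, 0] : Fin 3 → Fin 2) i) (proj x))
      (fun x => g (proj x)) :=
  h.comp (U' := film Ω t) (σ' := cyl σ t) projL projL_single
    (c := ENNReal.ofReal t) (c' := ENNReal.ofReal t) ENNReal.ofReal_ne_top ENNReal.ofReal_ne_top
    (by rw [volume_film]; exact (map_proj_cyl _ t).le) (map_proj_cyl _ t).le hg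

/-- The chain rule multiplies only the vertical derivative by t. This factor later turns a bound on
the original gradient into smallness of the vertical derivative. -/
theorem H1Trace.rescale_cyl {Ω : Set (R 2)} {σ : Measure (R 2)} [SFinite σ] {u g : R 3 → ℝ}
    {p : Fin 3 → R 3 → ℝ} {t : ℝ} (ht : 0 < t) (h : H1Trace (film Ω t) (cyl σ t) u p g)
    (hg : AEStronglyMeasurable g (cyl σ t)) :
    H1Trace (film Ω 1) (cyl σ 1) (fun x => u (scaleL t x))
      (fun i x => (![1, 1, t] : Fin 3 → ℝ) i * p i (scaleL t x)) (fun x => g (scaleL t x)) :=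
  h.comp (U' := film Ω 1) (σ' := cyl σ 1) (scaleL t) (scaleL_single t) 
    (c := ENNReal.ofReal t⁻¹) (c' := ENNReal.ofReal t⁻¹) ENNReal.ofReal_ne_top ENNReal.ofReal_ne_top
    (by rw [volume_film, volume_film]; exact (map_scale_cyl _ ht).le) (map_scale_cyl _ ht).le hg

theorem H1Trace.rescale_face {Ω : Set (R 2)} {u g : R 3 → ℝ}
    {p : Fin 3 → R 3 → ℝ} {t : ℝ} (ht : 0 < t) (h : H1Trace (film Ω t) (faceMeasure Ω t) u p g)
    (hg : AEStronglyMeasurable g (faceMeasure Ω t)) :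
    H1Trace (film Ω 1) (faceMeasure Ω 1) (fun x => u (scaleL t x))
      (fun i x => (![1, 1, t] : Fin 3 → ℝ) i * p i (scaleL t x)) (fun x => g (scaleL t x)) :=
  h.comp (U' := film Ω 1) (σ' := faceMeasure Ω 1) (scaleL t) (scaleL_single t)
    (c := ENNReal.ofReal t⁻¹) (c' := 1) ENNReal.ofReal_ne_top ENNReal.one_ne_top
    (by rw [volume_film, volume_film]; exact (map_scale_cyl _ ht).le)
    (by rw [one_smul]; exact (map_scale_face Ω t).le) hg

theorem integral_film_proj (Ω : Set (R 2)) [IsFiniteMeasure (volume.restrict Ω)] {t : ℝ}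
    (ht : 0 < t) (f : R 2 → ℝ) (hf : AEStronglyMeasurable f (volume.restrict Ω)) :
    ∫ x in film Ω t, f (proj x) = t * ∫ x in Ω, f x := by
  have hm : AEStronglyMeasurable f ((volume.restrict (film Ω t)).map proj) := by
    rw [volume_film, map_proj_cyl]
    exact hf.smul_measure _
  rw [← integral_map continuous_proj.measurable.aemeasurable hm, volume_film, map_proj_cyl,
    integral_smul_measure, ENNReal.toReal_ofReal ht.le, smul_eq_mul]

theorem integral_film_scale (Ω : Set (R 2)) {t : ℝ} (ht : 0 < t) (f : R 3 → ℝ) :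
    ∫ x in film Ω t, f x = t * ∫ x in film Ω 1, f (scaleL t x) := by
  have hemb : MeasurableEmbedding (scaleL t) := by
    refine (Homeomorph.mk ⟨scaleL t, scaleL t⁻¹, fun x => ?_, fun x => ?_⟩ (scaleL t).continuous
      (scaleL t⁻¹).continuous).measurableEmbedding
    · simp [inv_mul_cancel_left₀ ht.ne']
    · simp [mul_inv_cancel_left₀ ht.ne']
  rw [← hemb.integral_map, volume_film, volume_film, map_scale_cyl _ ht, integral_smul_measure,
    ENNReal.toReal_ofReal (inv_pos.2 ht).le, smul_eq_mul, mul_inv_cancel_left₀ ht.ne']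

end Film

end

/-! ### Finite length of the boundary curve. -/

section

/-- A set of zeros of a function near a point with nonvanishing strict derivative has finite
length. -/
theorem exists_nhds_hausdorffMeasure_zeros_lt_top {ρ : R 2 → ℝ} {p : R 2} {D : R 2 →L[ℝ] ℝ}
    (hρ : HasStrictFDerivAt ρ D p) (hD : D ≠ 0) :
    ∃ W ∈ 𝓝 p, μH[1] ({x | ρ x = 0} ∩ W) < ⊤ := by
  set a := D (EuclideanSpace.single 0 1) with ha
  set b := D (EuclideanSpace.single 1 1) with hb
  have hDx : ∀ x : R 2, D x = a * x 0 + b * x 1 := by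
    intro x
    have hx : x = x 0 • EuclideanSpace.single 0 1 + x 1 • EuclideanSpace.single 1 1 := by
      ext j; fin_cases j <;> simp
    conv_lhs => rw [hx]
    simp [ha, hb, mul_comm]
  have hab : 0 < a ^ 2 + b ^ 2 := by
    by_contra hcon
    have h0 : a = 0 ∧ b = 0 := by
      constructor <;> nlinarith [sq_nonneg a, sq_nonneg b]
    refine hD ?_
    ext x
    simp [hDx, h0.1, h0.2]
  set r := √(a ^ 2 + b ^ 2) with hr
  have hr0 : 0 < r := Real.sqrt_pos.2 hab
  have hr2 : r ^ 2 = a ^ 2 + b ^ 2 := Real.sq_sqrt hab.le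
  -- τ is D turned by a right angle: D/r and τ/r are orthonormal coordinates, normal and tangential
  -- to the zero set.
  set τ : R 2 →L[ℝ] ℝ := a • (EuclideanSpace.proj 1 : R 2 →L[ℝ] ℝ)
    - b • (EuclideanSpace.proj 0 : R 2 →L[ℝ] ℝ) with hτ
  have hτx : ∀ x : R 2, τ x = a * x 1 - b * x 0 := fun x => by simp [hτ]
  have hpyth : ∀ x : R 2, r ^ 2 * ‖x‖ ^ 2 = D x ^ 2 + τ x ^ 2 := by
    intro x
    rw [hr2, hDx, hτx, EuclideanSpace.real_norm_sq_eq, Fin.sum_univ_two]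
    ring
  -- For two zeros of ρ near p the normal part of the difference is at most half of its length. So τ
  -- is antilipschitz on the zero set, whose length is at most 2/r times that of a bounded subset of
  -- the line.
  have hsmall : ∀ᶠ q : R 2 × R 2 in 𝓝 (p, p),
      ‖ρ q.1 - ρ q.2 - D (q.1 - q.2)‖ ≤ (r / 2) * ‖q.1 - q.2‖ :=
    hρ.isLittleO.def (by positivity)
  rw [nhds_prod_eq] at hsmall
  obtain ⟨W, hW, hWs⟩ := Filter.eventually_prod_self_iff'.1 hsmall
  set S : Set (R 2) := {x | ρ x = 0} ∩ (W ∩ Metric.ball p 1) with hS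
  have hanti : AntilipschitzWith (Real.toNNReal (2 / r)) (fun x : S => τ x) := by
    refine AntilipschitzWith.of_le_mul_dist fun x y => ?_
    rw [Real.coe_toNNReal _ (by positivity)]
    have h1 := hWs x x.2.2.1 y y.2.2.1
    have hx : ρ x = 0 := x.2.1
    have hy : ρ y = 0 := y.2.1
    rw [hx, hy, sub_zero, zero_sub, norm_neg] at h1
    set v : R 2 := (x : R 2) - y with hv
    have h2 := hpyth v
    have h3 : D v ^ 2 ≤ (r / 2 * ‖v‖) ^ 2 := by
      rw [← sq_abs (D v)]
      exact pow_le_pow_left₀ (abs_nonneg _) h1 2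
    have h4 : (r / 2 * ‖v‖) ^ 2 ≤ |τ v| ^ 2 := by
      rw [sq_abs]
      nlinarith [sq_nonneg (r * ‖v‖)]
    have h5 : r / 2 * ‖v‖ ≤ |τ v| := abs_le_of_sq_le_sq' h4 (abs_nonneg _) |>.2
    have h6 : dist x y = ‖v‖ := by rw [Subtype.dist_eq, dist_eq_norm]
    have h7 : dist (τ x) (τ y) = |τ v| := by rw [Real.dist_eq, hv, map_sub]
    rw [h6, h7]
    calc ‖v‖ = 2 / r * (r / 2 * ‖v‖) := by field_simp
      _ ≤ 2 / r * |τ v| := mul_le_mul_of_nonneg_left h5 (by positivity)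
  refine ⟨W ∩ Metric.ball p 1, inter_mem hW (Metric.ball_mem_nhds p one_pos), ?_⟩
  have h1 := hanti.le_hausdorffMeasure_image zero_le_one Set.univ
  have h2 : μH[1] (Set.univ : Set S) = μH[1] S := by
    have := (isometry_subtype_coe (s := S)).hausdorffMeasure_image (d := 1)
      (Or.inl zero_le_one) Set.univ
    rw [← this]; simp
  rw [h2, Set.image_univ] at h1
  refine h1.trans_lt (ENNReal.mul_lt_top (by simp) ?_)
  rw [hausdorffMeasure_real]
  have hbd : Bornology.IsBounded (Set.range fun x : S => τ x) := by
    have e : (Set.range fun x : S => τ x) = τ '' S := by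
      ext y; simp
    rw [e]
    exact τ.lipschitz.isBounded_image (Metric.isBounded_ball.subset (fun x hx => hx.2.2))
  exact hbd.measure_lt_top

/-- Near each of its points ∂Ω lies in the zero set of ρ: points outside Ω have ρ ≥ 0, and limits of
points of Ω have ρ ≤ 0. Compactness of ∂Ω then makes local finiteness global. -/
theorem hausdorffMeasure_frontier_lt_top {Ω : Set (R 2)} (hΩ : IsSmoothOpen Ω)
    (hb : Bornology.IsBounded Ω) : μH[1] (frontier Ω) < ⊤ := by
  have hK : IsCompact (frontier Ω) :=
    Metric.isCompact_of_isClosed_isBounded isClosed_frontier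
      (hb.closure.subset frontier_subset_closure)
  refine hK.measure_lt_top_of_nhdsWithin fun p hp => ?_
  obtain ⟨W, hW, ρ, hρ, hD, hiff⟩ := hΩ.boundary p hp
  obtain ⟨V, hV, hfin⟩ := exists_nhds_hausdorffMeasure_zeros_lt_top
    (hρ.contDiffAt.hasStrictFDerivAt (by simp)) hD
  refine ⟨frontier Ω ∩ (interior W ∩ V), inter_mem_nhdsWithin _
    (inter_mem (interior_mem_nhds.2 hW) hV), (measure_mono ?_).trans_lt hfin⟩
  rintro x ⟨hx, hxW, hxV⟩
  refine ⟨?_, hxV⟩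
  have h1 : x ∉ Ω := fun h => by
    rw [hΩ.isOpen.frontier_eq] at hx
    exact hx.2 h
  have h2 : 0 ≤ ρ x := not_lt.1 fun h => h1 ((hiff x (interior_subset hxW)).2 h)
  refine le_antisymm ?_ h2
  have hx' : x ∈ closure (interior W ∩ Ω) :=
    isOpen_interior.inter_closure ⟨hxW, hx.1⟩
  have hcl : IsClosed {y | ρ y ≤ 0} := isClosed_le hρ.continuous continuous_const
  refine closure_minimal (fun y hy => ?_) hcl hx'
  exact ((hiff y (interior_subset hy.1)).1 hy.2).le

theorem isFiniteMeasure_arcLength {Ω : Set (R 2)} (hΩ : IsSmoothOpen Ω)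
    (hb : Bornology.IsBounded Ω) : IsFiniteMeasure (arcLength Ω) :=
  ⟨by simpa [arcLength] using hausdorffMeasure_frontier_lt_top hΩ hb⟩

end

/-! ### Horizontal slices and control by the vertical derivative. -/

section

instance isProbabilityMeasure_Ioo :
    IsProbabilityMeasure ((volume : Measure ℝ).restrict (Set.Ioo 0 1)) := ⟨by simp⟩

theorem lintegral_cyl (μ : Measure (R 2)) [SFinite μ] (h : ℝ) {f : R 3 → ℝ≥0∞}
    (hf : Measurable f) :
    ∫⁻ p, f p ∂(cyl μ h) = ∫⁻ x, (∫⁻ s in Set.Ioo 0 h, f (point x s)) ∂μ := by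
  rw [cyl, lintegral_map hf continuous_point.measurable,
    lintegral_prod (fun q : R 2 × ℝ => f (point q.1 q.2))
      (hf.comp continuous_point.measurable).aemeasurable]

/-- The inclusion of the plane at height `0`. -/
def baseL : R 2 →L[ℝ] R 3 :=
  LinearMap.toContinuousLinearMap
    { toFun := fun x => point x 0
      map_add' := fun p q => by ext j; fin_cases j <;> simp
      map_smul' := fun c p => by ext j; fin_cases j <;> simp }

theorem point_eq (x : R 2) (z : ℝ) : point x z = baseL x + z • EuclideanSpace.single 2 1 := by
  ext j; fin_cases j <;> simp [baseL]

theorem hasFDerivAt_point (x : R 2) (z : ℝ) : HasFDerivAt (fun x => point x z) baseL x := by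
  simp only [point_eq]
  exact baseL.hasFDerivAt.add_const _

theorem contDiff_slice {φ : R 3 → ℝ} {n : ℕ∞ω} (hφ : ContDiff ℝ n φ) (z : ℝ) :
    ContDiff ℝ n fun x => φ (point x z) := by
  simp only [point_eq]
  exact hφ.comp (baseL.contDiff.add contDiff_const)

theorem pd_slice {φ : R 3 → ℝ} (hφ : ContDiff ℝ 1 φ) (z : ℝ) (i : Fin 2) (x : R 2) :
    pd i (fun x => φ (point x z)) x = pd i.castSucc φ (point x z) := by
  have := ((hφ.differentiable one_ne_zero (point x z)).hasFDerivAt.comp x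
    (hasFDerivAt_point x z)).fderiv
  change fderiv ℝ (φ ∘ fun x => point x z) x _ = _
  rw [this]
  change fderiv ℝ φ (point x z) (baseL _) = _
  congr 1
  fin_cases i <;> ext j <;> fin_cases j <;> simp [baseL]

theorem hasDerivAt_vertical {φ : R 3 → ℝ} (hφ : ContDiff ℝ 1 φ) (x : R 2) (t : ℝ) :
    HasDerivAt (fun t => φ (point x t)) (pd 2 φ (point x t)) t := by
  have h1 : HasDerivAt (fun t : ℝ => point x t) (EuclideanSpace.single 2 1) t := by
    simp only [point_eq]
    simpa using ((hasDerivAt_id t).smul_const (EuclideanSpace.single (2 : Fin 3) (1 : ℝ))).const_add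
      (baseL x)
  exact ((hφ.differentiable one_ne_zero (point x t)).hasFDerivAt).comp_hasDerivAt t h1

theorem continuous_vertical (x : R 2) : Continuous fun t : ℝ => point x t :=
  continuous_point.comp (continuous_const.prodMk continuous_id)

theorem enorm_sub_le_lintegral {f f' : ℝ → ℝ} (hf : ∀ t, HasDerivAt f (f' t) t)
    (hf' : Continuous f') (a b : ℝ) : ‖f b - f a‖ₑ ≤ ∫⁻ t in Set.uIoc a b, ‖f' t‖ₑ := by
  rw [← intervalIntegral.integral_eq_sub_of_hasDerivAt (fun t _ => hf t)
    (hf'.intervalIntegrable a b)]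
  rw [← enorm_norm, intervalIntegral.norm_intervalIntegral_eq, enorm_norm]
  exact enorm_integral_le_lintegral_enorm _

theorem sq_lintegral_le {α : Type*} [MeasurableSpace α] {μ : Measure α} [IsProbabilityMeasure μ]
    {f : α → ℝ} (hf : AEStronglyMeasurable f μ) :
    (∫⁻ x, ‖f x‖ₑ ∂μ) ^ 2 ≤ ∫⁻ x, ‖f x‖ₑ ^ 2 ∂μ := by
  rw [← eLpNorm_two_sq, ← eLpNorm_one_eq_lintegral_enorm]
  exact pow_le_pow_left₀ zero_le (eLpNorm_le_eLpNorm_of_exponent_le one_le_two hf) 2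

/-- The fundamental theorem of calculus on a vertical segment, followed by Cauchy–Schwarz on an
interval of length one. -/
theorem sq_vertical_le {φ : R 3 → ℝ} (hφ : ContDiff ℝ 1 φ) (x : R 2) {s z : ℝ}
    (hs : s ∈ Set.Icc (0:ℝ) 1) (hz : z ∈ Set.Icc (0:ℝ) 1) :
    ‖φ (point x s) - φ (point x z)‖ₑ ^ 2 ≤ ∫⁻ t in Set.Ioo 0 1, ‖pd 2 φ (point x t)‖ₑ ^ 2 := by
  have hc : Continuous fun t => pd 2 φ (point x t) :=
    (continuous_pd hφ).comp (continuous_vertical x)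
  refine le_trans (pow_le_pow_left₀ zero_le ?_ 2) (sq_lintegral_le hc.aestronglyMeasurable)
  refine (enorm_sub_le_lintegral (hasDerivAt_vertical hφ x) hc z s).trans ?_
  rw [← restrict_Ioo_eq_restrict_Ioc.symm]
  refine lintegral_mono_set ?_
  exact Set.Ioc_subset_Ioc (le_min hz.1 hs.1) (max_le hz.2 hs.2)

theorem le_of_sq_le_sq {a b : ℝ≥0∞} (h : a ^ 2 ≤ b ^ 2) : a ≤ b := by
  by_contra hab
  exact absurd h (not_le.2 (ENNReal.pow_lt_pow_left two_ne_zero (not_le.1 hab)))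

theorem eLpNorm_sub_slice_le (Ω : Set (R 2)) {φ : R 3 → ℝ} (hφ : ContDiff ℝ 1 φ) {z : ℝ}
    (hz : z ∈ Set.Icc (0:ℝ) 1) :
    eLpNorm (fun p => φ p - φ (point (proj p) z)) 2 (volume.restrict (film Ω 1)) ≤
      eLpNorm (pd 2 φ) 2 (volume.restrict (film Ω 1)) := by
  have hc : Continuous fun p => φ p - φ (point (proj p) z) :=
    hφ.continuous.sub ((contDiff_slice hφ z).continuous.comp continuous_proj)
  refine le_of_sq_le_sq ?_
  rw [eLpNorm_two_sq, eLpNorm_two_sq, volume_film,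
    lintegral_cyl _ _ (hc.enorm.measurable.pow_const 2),
    lintegral_cyl _ _ ((continuous_pd hφ).enorm.measurable.pow_const 2)]
  refine lintegral_mono fun x => ?_
  refine (setLIntegral_mono' measurableSet_Ioo fun s hs => ?_).trans
    (lintegral_const _).le |>.trans_eq (by rw [measure_univ, mul_one])
  rw [proj_point]
  exact sq_vertical_le hφ x (Set.Ioo_subset_Icc_self hs) hz

/-- A nonnegative function of the height is at most its mean somewhere. Applied to a single weighted
sum, this gives one height that is good for both horizontal derivatives and for the trace at once.
-/
theorem exists_slice_le (Ω : Set (R 2)) {σ : Measure (R 2)} [SFinite σ] {φ : R 3 → ℝ}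
    (hφ : ContDiff ℝ 1 φ) {G : R 2 → ℝ} (hG : Continuous G) {A b : ℝ≥0∞} (hb : b ≠ 0) (hb' : b ≠ ⊤)
    (hA : ∀ i, eLpNorm (pd i φ) 2 (volume.restrict (film Ω 1)) ≤ A)
    (hB : eLpNorm (fun p => φ p - G (proj p)) 2 (cyl σ 1) ≤ b) :
    ∃ z ∈ Set.Icc (0:ℝ) 1,
      (∀ i : Fin 2, eLpNorm (pd i fun x => φ (point x z)) 2 (volume.restrict Ω) ^ 2
        ≤ 2 * A ^ 2 + 1) ∧
      eLpNorm (fun x => φ (point x z) - G x) 2 σ ^ 2 ≤ (2 * A ^ 2 + 1) * b ^ 2 := by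
  set ν := (volume : Measure ℝ).restrict (Set.Ioo 0 1)
  set a : Fin 2 → ℝ → ℝ≥0∞ := fun i z => ∫⁻ x in Ω, ‖pd i.castSucc φ (point x z)‖ₑ ^ 2 with ha
  set t : ℝ → ℝ≥0∞ := fun z => ∫⁻ x, ‖φ (point x z) - G x‖ₑ ^ 2 ∂σ with ht
  have hm : ∀ {f : R 3 → ℝ}, Continuous f →
      Measurable (Function.uncurry fun (x : R 2) (z : ℝ) => ‖f (point x z)‖ₑ ^ 2) := fun hf =>
    (hf.comp continuous_point).enorm.measurable.pow_const 2
  have hct : Continuous fun p => φ p - G (proj p) := hφ.continuous.sub (hG.comp continuous_proj)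
  have hm2 : Measurable (Function.uncurry fun (x : R 2) (z : ℝ) => ‖φ (point x z) - G x‖ₑ ^ 2) := by
    simpa using hm hct
  have ham : ∀ i, Measurable (a i) := fun i =>
    (hm (continuous_pd hφ)).lintegral_prod_left'
  have htm : Measurable t := hm2.lintegral_prod_left'
  have hai : ∀ i, ∫⁻ z, a i z ∂ν ≤ A ^ 2 := by
    intro i
    have h1 : ∫⁻ z, a i z ∂ν = eLpNorm (pd i.castSucc φ) 2 (volume.restrict (film Ω 1)) ^ 2 := by
      rw [eLpNorm_two_sq, volume_film,
        lintegral_cyl _ _ ((continuous_pd hφ).enorm.measurable.pow_const 2),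
        lintegral_lintegral_swap (hm (continuous_pd hφ)).aemeasurable]
    rw [h1]
    exact pow_le_pow_left₀ zero_le (hA _) 2
  have hti : ∫⁻ z, t z ∂ν ≤ b ^ 2 := by
    have h1 : ∫⁻ z, t z ∂ν = eLpNorm (fun p => φ p - G (proj p)) 2 (cyl σ 1) ^ 2 := by
      rw [eLpNorm_two_sq, lintegral_cyl _ _ (hct.enorm.measurable.pow_const 2)]
      simp only [proj_point]
      rw [lintegral_lintegral_swap hm2.aemeasurable]
    rw [h1]
    exact pow_le_pow_left₀ zero_le hB 2
  have hbb : (b ^ 2) ≠ 0 := pow_ne_zero 2 hb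
  have hbb' : (b ^ 2) ≠ ⊤ := ENNReal.pow_ne_top hb'
  -- The weight b⁻² normalizes the trace term to mean at most 1, so the sum has mean at most 2A² +
  -- 1; multiplying back keeps the trace error of the slice of order b.
  obtain ⟨z, hz, hle⟩ := exists_notMem_null_le_lintegral (μ := ν) (N := (Set.Ioo (0:ℝ) 1)ᶜ)
    (f := fun z => a 0 z + a 1 z + (b ^ 2)⁻¹ * t z)
    (((ham 0).add (ham 1)).add (htm.const_mul _)).aemeasurable
    (by rw [Measure.restrict_apply measurableSet_Ioo.compl]; simp)
  have hz' : z ∈ Set.Ioo (0:ℝ) 1 := by simpa using hz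
  have hle' : a 0 z + a 1 z + (b ^ 2)⁻¹ * t z ≤ 2 * A ^ 2 + 1 := by
    refine hle.trans ?_
    rw [lintegral_add_left (f := fun z => a 0 z + a 1 z) ((ham 0).add (ham 1)),
      lintegral_add_left (ham 0),
      lintegral_const_mul _ htm, two_mul]
    refine add_le_add (add_le_add (hai 0) (hai 1)) ?_
    exact (mul_le_mul_right hti _).trans (ENNReal.inv_mul_cancel hbb hbb').le
  refine ⟨z, Set.Ioo_subset_Icc_self hz', fun i => ?_, ?_⟩
  · rw [eLpNorm_two_sq]
    simp only [pd_slice hφ]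
    refine le_trans ?_ (le_self_add.trans hle')
    fin_cases i
    · exact le_self_add
    · exact le_add_self
  · rw [eLpNorm_two_sq]
    have h1 : (b ^ 2)⁻¹ * t z ≤ 2 * A ^ 2 + 1 := le_add_self.trans hle'
    calc t z = (b ^ 2)⁻¹ * t z * b ^ 2 := by
          rw [mul_comm _ (t z), mul_assoc, ENNReal.inv_mul_cancel hbb hbb', mul_one]
      _ ≤ (2 * A ^ 2 + 1) * b ^ 2 := mul_le_mul_left h1 _

theorem eLpNorm_proj (Ω : Set (R 2)) (f : R 2 → ℝ) (hf : AEStronglyMeasurable f (volume.restrict Ω)) :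
    eLpNorm (fun p => f (proj p)) 2 (volume.restrict (film Ω 1)) ≤
      eLpNorm f 2 (volume.restrict Ω) := by
  have := eLpNorm_comp_le (c := 1) (ν := volume.restrict (film Ω 1)) (μ := volume.restrict Ω)
    continuous_proj.measurable (by rw [volume_film, map_proj_cyl]; simp) hf
  simpa using this

/-- This replaces a film function by a smooth planar one. The error 2e is one e for approximating u
and one for approximating its vertical derivative; A + 1 appears because the gradient of the
approximant exceeds that of u by at most e ≤ 1. -/
theorem H1Trace.exists_slice {Ω : Set (R 2)} {σ : Measure (R 2)} [SFinite σ] {u : R 3 → ℝ}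
    {p : Fin 3 → R 3 → ℝ} {G : R 2 → ℝ} (hG : Continuous G)
    (h : H1Trace (film Ω 1) (cyl σ 1) u p (fun x => G (proj x))) {A e : ℝ≥0∞}
    (hA : ∀ i, eLpNorm (p i) 2 (volume.restrict (film Ω 1)) ≤ A) (he : e ≠ 0) (he1 : e ≤ 1) :
    ∃ ψ : R 2 → ℝ, ContDiff ℝ ∞ ψ ∧
      eLpNorm (fun x => ψ (proj x) - u x) 2 (volume.restrict (film Ω 1))
        ≤ eLpNorm (p 2) 2 (volume.restrict (film Ω 1)) + 2 * e ∧
      (∀ i, eLpNorm (pd i ψ) 2 (volume.restrict Ω) ^ 2 ≤ 2 * (A + 1) ^ 2 + 1) ∧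
      eLpNorm (fun x => ψ x - G x) 2 σ ^ 2 ≤ (2 * (A + 1) ^ 2 + 1) * e ^ 2 := by
  obtain ⟨φ, hφ, h1, h2, h3⟩ := h.approx e he
  have hφ1 := contDiff_one hφ
  have hpd : ∀ i, eLpNorm (pd i φ) 2 (volume.restrict (film Ω 1)) ≤
      eLpNorm (p i) 2 (volume.restrict (film Ω 1)) + e := by
    intro i
    have e1 : pd i φ = p i + fun x => pd i φ x - p i x := by ext x; simp
    rw [e1]
    exact (eLpNorm_add_le (h.memLp_grad i).1 
      ((continuous_pd hφ1).aestronglyMeasurable.sub (h.memLp_grad i).1) one_le_two).trans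
      (add_le_add le_rfl (h2 i))
  obtain ⟨z, hz, h4, h5⟩ := exists_slice_le Ω hφ1 hG he (he1.trans_lt ENNReal.one_lt_top).ne
    (A := A + 1) (fun i => (hpd i).trans (add_le_add (hA i) he1)) h3
  refine ⟨fun x => φ (point x z), contDiff_slice hφ z, ?_, h4, h5⟩
  have e2 : (fun x => φ (point (proj x) z) - u x)
      = (fun x => φ x - u x) - fun x => φ x - φ (point (proj x) z) := by ext x; simp
  have hcs := ((contDiff_slice hφ1 z).continuous.comp continuous_proj)
  rw [e2]
  refine (eLpNorm_sub_le (hφ.continuous.aestronglyMeasurable.sub h.memLp.1)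
    (hφ.continuous.sub hcs).aestronglyMeasurable one_le_two).trans ?_
  refine (add_le_add h1 ((eLpNorm_sub_slice_le Ω hφ1 hz).trans (hpd 2))).trans_eq ?_
  ring

/-- A function vanishing on the faces is controlled by its vertical derivative. -/
theorem H1Trace.eLpNorm_le_of_face {Ω : Set (R 2)} {u : R 3 → ℝ} {p : Fin 3 → R 3 → ℝ}
    (h : H1Trace (film Ω 1) (faceMeasure Ω 1) u p (fun _ => 0)) :
    eLpNorm u 2 (volume.restrict (film Ω 1)) ≤ eLpNorm (p 2) 2 (volume.restrict (film Ω 1)) := by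
  refine ENNReal.le_of_forall_pos_le_add fun r hr _ => ?_
  -- Three errors share r: the approximation of u, that of its vertical derivative, and the value on
  -- the bottom face.
  have he : ((r / 3 : ℝ≥0) : ℝ≥0∞) ≠ 0 := by
    rw [ENNReal.coe_ne_zero]; positivity
  obtain ⟨φ, hφ, h1, h2, h3⟩ := h.approx _ he
  set e : ℝ≥0∞ := ((r / 3 : ℝ≥0) : ℝ≥0∞)
  have hφ1 := contDiff_one hφ
  have hpd : eLpNorm (pd 2 φ) 2 (volume.restrict (film Ω 1)) ≤
      eLpNorm (p 2) 2 (volume.restrict (film Ω 1)) + e := by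
    have e1 : pd 2 φ = p 2 + fun x => pd 2 φ x - p 2 x := by ext x; simp
    rw [e1]
    exact (eLpNorm_add_le (h.memLp_grad 2).1
      ((continuous_pd hφ1).aestronglyMeasurable.sub (h.memLp_grad 2).1) one_le_two).trans
      (add_le_add le_rfl (h2 2))
  have hs := (contDiff_slice hφ1 0).continuous
  have hface : eLpNorm (fun x => φ (point (proj x) 0)) 2 (volume.restrict (film Ω 1)) ≤ e := by
    refine (eLpNorm_proj Ω _ hs.aestronglyMeasurable).trans ?_
    have hm : Measurable (fun x : R 2 => point x 0) := baseL.continuous.measurable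
    have := eLpNorm_map_measure (p := 2) (μ := volume.restrict Ω) (f := fun x : R 2 => point x 0)
      (g := φ) hφ.continuous.aestronglyMeasurable hm.aemeasurable
    change eLpNorm (φ ∘ fun x => point x 0) 2 _ ≤ _
    rw [← this]
    refine le_trans (eLpNorm_mono_measure φ ?_) (by simpa using h3)
    exact Measure.le_add_right le_rfl
  have e2 : u = ((fun x => φ x - φ (point (proj x) 0)) + fun x => φ (point (proj x) 0))
      - fun x => φ x - u x := by ext x; simp
  have hcs := hs.comp continuous_proj
  rw [e2]
  refine (eLpNorm_sub_le ((hφ.continuous.sub hcs).add hcs).aestronglyMeasurable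
    (hφ.continuous.aestronglyMeasurable.sub h.memLp.1) one_le_two).trans ?_
  refine (add_le_add ((eLpNorm_add_le (hφ.continuous.sub hcs).aestronglyMeasurable
    hcs.aestronglyMeasurable one_le_two).trans (add_le_add ((eLpNorm_sub_slice_le Ω hφ1
      (Set.left_mem_Icc.2 zero_le_one)).trans hpd) hface)) h1).trans_eq ?_
  rw [add_assoc, add_assoc]
  congr 1
  simp only [e, ← ENNReal.coe_add]
  congr 1
  rw [← NNReal.coe_inj]
  push_cast
  ring

end

/-! ### Translations of planar functions cut off at the boundary. -/

section

/-- The coordinate direction. -/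
abbrev ee (i : Fin 2) : R 2 := EuclideanSpace.single i (1 : ℝ)

/-- The points from which a segment of length `t` in a coordinate direction meets `K`. -/
def shadow (i : Fin 2) (t : ℝ) (K : Set (R 2)) : Set (R 2) :=
  {x | ∃ s ∈ Set.Icc 0 t, x + s • ee i ∈ K}

theorem volume_box (l r : Fin 2 → ℝ) :
    volume {x : R 2 | ∀ j, x j ∈ Set.Icc (l j) (r j)} = ∏ j, ENNReal.ofReal (r j - l j) := by
  have h1 : {x : R 2 | ∀ j, x j ∈ Set.Icc (l j) (r j)} = WithLp.ofLp ⁻¹' Set.Icc l r := by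
    ext x
    simp only [Set.mem_Icc, Set.mem_ofPred_eq, Set.mem_preimage, Pi.le_def, forall_and]
  rw [h1, (PiLp.volume_preserving_ofLp (Fin 2)).measure_preimage
    measurableSet_Icc.nullMeasurableSet, Real.volume_Icc_pi]

/-- With D the diameter, the shadow lies in a box with sides 2D and 2D + t, and D ≤ t bounds its
area by 6tD. -/
theorem volume_shadow_le_of_diam (i : Fin 2) {t : ℝ} (ht : 0 < t) {A : Set (R 2)}
    (hA : A.Nonempty) (hd : Metric.ediam A ≤ ENNReal.ofReal t) :
    volume (shadow i t A) ≤ ENNReal.ofReal (6 * t) * Metric.ediam A := by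
  obtain ⟨a, ha⟩ := hA
  have hfin : Metric.ediam A ≠ ⊤ := (hd.trans_lt ENNReal.ofReal_lt_top).ne
  set D : ℝ := (Metric.ediam A).toReal with hD
  have hD0 : 0 ≤ D := ENNReal.toReal_nonneg
  have hDA : Metric.ediam A = ENNReal.ofReal D := (ENNReal.ofReal_toReal hfin).symm
  have hDt : D ≤ t := ENNReal.toReal_le_of_le_ofReal ht.le hd
  have hsub : shadow i t A ⊆ {x : R 2 | ∀ j, x j ∈
      Set.Icc (a j - D - (if j = i then t else 0)) (a j + D)} := by
    rintro x ⟨s, hs, hx⟩ j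
    have h1 : dist (x + s • ee i) a ≤ D := by
      rw [hD, dist_edist]
      exact ENNReal.toReal_mono hfin (Metric.edist_le_ediam_of_mem hx ha)
    have h2 : |(x + s • ee i) j - a j| ≤ D := by
      rw [dist_eq_norm] at h1
      exact (abs_apply_le _ j).trans h1
    have h3 : (x + s • ee i) j = x j + (if j = i then s else 0) := by
      simp
    rw [h3, abs_le] at h2
    rw [Set.mem_Icc]
    split_ifs at h2 ⊢ with hji
    · exact ⟨by linarith [hs.2], by linarith [hs.1]⟩
    · exact ⟨by linarith, by linarith⟩
  refine (measure_mono hsub).trans ?_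
  rw [volume_box, hDA, ← ENNReal.ofReal_mul (by positivity), Fin.prod_univ_two,
    ← ENNReal.ofReal_mul' (by split_ifs <;> linarith)]
  refine ENNReal.ofReal_le_ofReal ?_
  fin_cases i <;> simp <;> nlinarith

/-- Sum the estimate for small sets over a countable cover by sets of diameter at most t; the
infimum over such covers is already below the Hausdorff measure. -/
theorem volume_shadow_le (i : Fin 2) {t : ℝ} (ht : 0 < t) (K : Set (R 2)) :
    volume (shadow i t K) ≤ ENNReal.ofReal (6 * t) * μH[1] K := by
  have hc0 : ENNReal.ofReal (6 * t) ≠ 0 := by simpa using ht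
  rw [mul_comm, ← ENNReal.div_le_iff_le_mul (Or.inl hc0) (Or.inl ENNReal.ofReal_ne_top),
    Measure.hausdorffMeasure_apply]
  refine le_trans ?_ (le_iSup₂_of_le (ENNReal.ofReal t) (by simpa using ht) le_rfl)
  refine le_iInf fun A => le_iInf₂ fun hKA hdA => ?_
  rw [ENNReal.div_le_iff_le_mul (Or.inl hc0) (Or.inl ENNReal.ofReal_ne_top), mul_comm,
    ← ENNReal.tsum_mul_left]
  have hsub : shadow i t K ⊆ ⋃ n, shadow i t (A n) := by
    rintro x ⟨s, hs, hx⟩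
    obtain ⟨n, hn⟩ := Set.mem_iUnion.1 (hKA hx)
    exact Set.mem_iUnion.2 ⟨n, s, hs, hn⟩
  refine (measure_mono hsub).trans ((measure_iUnion_le _).trans (ENNReal.tsum_le_tsum fun n => ?_))
  rcases (A n).eq_empty_or_nonempty with h0 | h0
  · simp [h0, shadow]
  · simpa [h0] using volume_shadow_le_of_diam i ht h0 (hdA n)

/-- A function on a set of the plane is dominated along segments in a coordinate direction, with
a bound in `L¹` of the plane controlled by the integral over the set for the length. -/
theorem exists_shadow_bound (i : Fin 2) {t : ℝ} (ht : 0 < t) {Γ : Set (R 2)}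
    (hΓ : MeasurableSet Γ) {f : R 2 → ℝ} (hf : Measurable f) :
    ∃ b : R 2 → ℝ≥0∞, Measurable b ∧
      (∀ x, ∀ s ∈ Set.Icc 0 t, x + s • ee i ∈ Γ → ‖f (x + s • ee i)‖ₑ ≤ b x) ∧
      ∫⁻ x, b x ≤ ENNReal.ofReal (12 * t) * ∫⁻ x in Γ, ‖f x‖ₑ ∂μH[1] := by
  -- Dyadic layers of |f|: on each layer f is constant up to a factor 2, so the bound for shadows of
  -- sets gives one for functions, and 6t becomes 12t.
  set K : ℤ → Set (R 2) := fun k => Γ ∩ (fun x => |f x|) ⁻¹' Set.Ico ((2:ℝ) ^ k) (2 ^ (k + 1))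
    with hK
  have hKm : ∀ k, MeasurableSet (K k) := fun k =>
    hΓ.inter ((continuous_abs.measurable.comp hf) measurableSet_Ico)
  have hKd : Pairwise (Function.onFun Disjoint K) := by
    have key : ∀ k l : ℤ, k < l → ∀ x, x ∈ K k → x ∈ K l → False := fun k l hkl x hk hl => by
      have h1 : (2:ℝ) ^ (k + 1) ≤ 2 ^ l := zpow_le_zpow_right₀ one_le_two hkl
      exact absurd hk.2.2 (not_lt.2 (h1.trans hl.2.1))
    intro k l hkl
    refine Set.disjoint_left.2 fun x hk hl => ?_
    rcases lt_or_gt_of_ne hkl with h | h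
    · exact key k l h x hk hl
    · exact key l k h x hl hk
  -- Measurable hulls replace the shadows, whose own measurability is not needed; their volume is
  -- the same.
  have hm : ∀ k : ℤ, Measurable fun x => ENNReal.ofReal ((2:ℝ) ^ (k + 1)) *
      (toMeasurable volume (shadow i t (K k))).indicator (fun _ => (1 : ℝ≥0∞)) x := fun k =>
    (measurable_const.indicator (measurableSet_toMeasurable _ _)).const_mul _
  refine ⟨fun x => ∑' k : ℤ, ENNReal.ofReal ((2:ℝ) ^ (k + 1)) *
    (toMeasurable volume (shadow i t (K k))).indicator (fun _ => 1) x, Measurable.tsum hm,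
    fun x s hs hx => ?_, ?_⟩
  · by_cases h0 : f (x + s • ee i) = 0
    · simp [h0]
    obtain ⟨k, hk⟩ := exists_mem_Ico_zpow (abs_pos.2 h0) (one_lt_two (α := ℝ))
    refine le_trans ?_ (ENNReal.le_tsum k)
    have hmem : x ∈ toMeasurable volume (shadow i t (K k)) :=
      subset_toMeasurable _ _ ⟨s, hs, hx, hk⟩
    rw [Set.indicator_of_mem hmem, mul_one, Real.enorm_eq_ofReal_abs]
    exact ENNReal.ofReal_le_ofReal hk.2.le
  · rw [lintegral_tsum fun k => (hm k).aemeasurable]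
    have h1 : ∀ k : ℤ, ∫⁻ x, ENNReal.ofReal ((2:ℝ) ^ (k + 1)) *
        (toMeasurable volume (shadow i t (K k))).indicator (fun _ => (1 : ℝ≥0∞)) x
        ≤ ENNReal.ofReal (12 * t) * ∫⁻ x in K k, ‖f x‖ₑ ∂μH[1] := by
      intro k
      rw [lintegral_const_mul _ (measurable_const.indicator (measurableSet_toMeasurable _ _)),
        lintegral_indicator (measurableSet_toMeasurable _ _), setLIntegral_one,
        measure_toMeasurable]
      have h2 : ENNReal.ofReal ((2:ℝ) ^ k) * μH[1] (K k) ≤ ∫⁻ x in K k, ‖f x‖ₑ ∂μH[1] := by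
        rw [← setLIntegral_const]
        refine setLIntegral_mono' (hKm k) fun x hx => ?_
        rw [Real.enorm_eq_ofReal_abs]
        exact ENNReal.ofReal_le_ofReal hx.2.1
      calc ENNReal.ofReal ((2:ℝ) ^ (k + 1)) * volume (shadow i t (K k))
          ≤ ENNReal.ofReal ((2:ℝ) ^ (k + 1)) * (ENNReal.ofReal (6 * t) * μH[1] (K k)) :=
            mul_le_mul_right (volume_shadow_le i ht _) _
        _ = ENNReal.ofReal (12 * t) * (ENNReal.ofReal ((2:ℝ) ^ k) * μH[1] (K k)) := by
            rw [← mul_assoc, ← mul_assoc, ← ENNReal.ofReal_mul (by positivity),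
              ← ENNReal.ofReal_mul (by positivity), zpow_add_one₀ two_ne_zero]
            congr 2
            ring
        _ ≤ _ := mul_le_mul_right h2 _
    refine (ENNReal.tsum_le_tsum h1).trans ?_
    rw [ENNReal.tsum_mul_left, ← lintegral_iUnion hKm hKd]
    exact mul_le_mul_right (lintegral_mono_set (Set.iUnion_subset fun k => Set.inter_subset_left)) _

section Segment

variable {f f' : ℝ → ℝ} {O : Set ℝ}

theorem enorm_le_of_Ioo_subset (hf : ∀ t, HasDerivAt f (f' t) t) (hf' : Continuous f')
    {α β a b : ℝ} (hab : a ≤ b) (hO : Set.Ioo a b ⊆ Set.Icc α β ∩ O) :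
    ‖f b - f a‖ₑ ≤ ∫⁻ t in Set.Icc α β ∩ O, ‖f' t‖ₑ := by
  refine (enorm_sub_le_lintegral hf hf' a b).trans ?_
  rw [Set.uIoc_of_le hab, ← restrict_Ioo_eq_restrict_Ioc]
  exact lintegral_mono_set hO

/-- Take c to be the first point of the segment outside O: everything before it lies in O, so only
the derivative inside O enters. -/
theorem exists_exit (hf : ∀ t, HasDerivAt f (f' t) t) (hf' : Continuous f') (hO : IsOpen O)
    {α β : ℝ} (hαβ : α ≤ β) (hα : α ∈ O) (hβ : β ∉ O) :
    ∃ c ∈ Set.Icc α β, c ∈ frontier O ∧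
      ‖f α‖ₑ ≤ ‖f c‖ₑ + ∫⁻ t in Set.Icc α β ∩ O, ‖f' t‖ₑ := by
  set S := Set.Icc α β ∩ Oᶜ with hS
  have hSc : IsClosed S := isClosed_Icc.inter hO.isClosed_compl
  have hSb : BddBelow S := ⟨α, fun x hx => hx.1.1⟩
  have hmem : sInf S ∈ S := hSc.csInf_mem ⟨β, ⟨hαβ, le_rfl⟩, hβ⟩ hSb
  set c := sInf S with hc
  have hlt : α < c := lt_of_le_of_ne hmem.1.1 fun h => hmem.2 (h ▸ hα)
  have hsub : Set.Ioo α c ⊆ Set.Icc α β ∩ O := fun x hx => by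
    refine ⟨⟨hx.1.le, hx.2.le.trans hmem.1.2⟩, ?_⟩
    by_contra hxO
    exact absurd (csInf_le hSb ⟨⟨hx.1.le, hx.2.le.trans hmem.1.2⟩, hxO⟩) (not_le.2 hx.2)
  refine ⟨c, hmem.1, ?_, ?_⟩
  · rw [hO.frontier_eq]
    refine ⟨closure_mono (hsub.trans Set.inter_subset_right) ?_, hmem.2⟩
    rw [closure_Ioo hlt.ne]
    exact ⟨hlt.le, le_rfl⟩
  · have h1 : f α = f c - (f c - f α) := by ring
    conv_lhs => rw [h1]
    exact enorm_sub_le.trans (add_le_add le_rfl (enorm_le_of_Ioo_subset hf hf' hlt.le hsub))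

theorem exists_entry (hf : ∀ t, HasDerivAt f (f' t) t) (hf' : Continuous f') (hO : IsOpen O)
    {α β : ℝ} (hαβ : α ≤ β) (hα : α ∉ O) (hβ : β ∈ O) :
    ∃ c ∈ Set.Icc α β, c ∈ frontier O ∧
      ‖f β‖ₑ ≤ ‖f c‖ₑ + ∫⁻ t in Set.Icc α β ∩ O, ‖f' t‖ₑ := by
  set S := Set.Icc α β ∩ Oᶜ with hS
  have hSc : IsClosed S := isClosed_Icc.inter hO.isClosed_compl
  have hSb : BddAbove S := ⟨β, fun x hx => hx.1.2⟩
  have hmem : sSup S ∈ S := hSc.csSup_mem ⟨α, ⟨le_rfl, hαβ⟩, hα⟩ hSb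
  set c := sSup S with hc
  have hlt : c < β := lt_of_le_of_ne hmem.1.2 fun h => hmem.2 (h ▸ hβ)
  have hsub : Set.Ioo c β ⊆ Set.Icc α β ∩ O := fun x hx => by
    refine ⟨⟨hmem.1.1.trans hx.1.le, hx.2.le⟩, ?_⟩
    by_contra hxO
    exact absurd (le_csSup hSb ⟨⟨hmem.1.1.trans hx.1.le, hx.2.le⟩, hxO⟩) (not_le.2 hx.1)
  refine ⟨c, hmem.1, ?_, ?_⟩
  · rw [hO.frontier_eq]
    refine ⟨closure_mono (hsub.trans Set.inter_subset_right) ?_, hmem.2⟩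
    rw [closure_Ioo hlt.ne]
    exact ⟨le_rfl, hlt.le⟩
  · have h1 : f β = f c + (f β - f c) := by ring
    conv_lhs => rw [h1]
    exact (enorm_add_le _ _).trans (add_le_add le_rfl (enorm_le_of_Ioo_subset hf hf' hlt.le hsub))

/-- If the segment stays in O, integrate f'. Otherwise each endpoint lying in O is joined within O
to a frontier point where |f| ≤ B; the two endpoints account for the factor 2. -/
theorem enorm_indicator_sub_le (hf : ∀ t, HasDerivAt f (f' t) t) (hf' : Continuous f')
    (hO : IsOpen O) {t : ℝ} (ht : 0 ≤ t) {B : ℝ≥0∞}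
    (hB : ∀ s ∈ Set.Icc 0 t, s ∈ frontier O → ‖f s‖ₑ ≤ B) :
    ‖O.indicator f t - O.indicator f 0‖ₑ ≤ 2 * (B + ∫⁻ s in Set.Icc 0 t ∩ O, ‖f' s‖ₑ) := by
  set J := ∫⁻ s in Set.Icc 0 t ∩ O, ‖f' s‖ₑ with hJ
  have hexit : ∀ s ∈ Set.Icc 0 t, s ∉ O → ‖O.indicator f 0‖ₑ ≤ B + J := by
    intro s hs hsO
    by_cases h0 : (0:ℝ) ∈ O
    · rw [Set.indicator_of_mem h0]
      obtain ⟨c, hc, hcf, hle⟩ := exists_exit hf hf' hO hs.1 h0 hsO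
      refine hle.trans (add_le_add (hB c ⟨hc.1, hc.2.trans hs.2⟩ hcf) (lintegral_mono_set ?_))
      exact Set.inter_subset_inter_left _ (Set.Icc_subset_Icc le_rfl hs.2)
    · simp [Set.indicator_of_notMem h0]
  have hentry : ∀ s ∈ Set.Icc 0 t, s ∉ O → ‖O.indicator f t‖ₑ ≤ B + J := by
    intro s hs hsO
    by_cases h0 : t ∈ O
    · rw [Set.indicator_of_mem h0]
      obtain ⟨c, hc, hcf, hle⟩ := exists_entry hf hf' hO hs.2 hsO h0
      refine hle.trans (add_le_add (hB c ⟨hs.1.trans hc.1, hc.2⟩ hcf) (lintegral_mono_set ?_))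
      exact Set.inter_subset_inter_left _ (Set.Icc_subset_Icc hs.1 le_rfl)
    · simp [Set.indicator_of_notMem h0]
  by_cases hall : ∀ s ∈ Set.Icc 0 t, s ∈ O
  · rw [Set.indicator_of_mem (hall t ⟨ht, le_rfl⟩), Set.indicator_of_mem (hall 0 ⟨le_rfl, ht⟩)]
    refine (enorm_le_of_Ioo_subset hf hf' ht fun s hs => ⟨Set.Ioo_subset_Icc_self hs,
      hall s (Set.Ioo_subset_Icc_self hs)⟩).trans ?_
    rw [two_mul]
    exact le_add_self.trans le_self_add
  · push Not at hall
    obtain ⟨s, hs, hsO⟩ := hall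
    rw [two_mul]
    exact enorm_sub_le.trans (add_le_add (hentry s hs hsO) (hexit s hs hsO))

end Segment

/-- The translates of a function that is cut off outside of an open set are close in `L¹`. -/
theorem lintegral_translate_sub_le {Ω : Set (R 2)} (hΩ : IsOpen Ω) (i : Fin 2) {t : ℝ} (ht : 0 < t)
    {v v' : R 2 → ℝ} (hv : Continuous v) (hv' : Continuous v')
    (hd : ∀ (x : R 2) (s : ℝ), HasDerivAt (fun s => v (x + s • ee i)) (v' (x + s • ee i)) s) :
    ∫⁻ x, ‖Ω.indicator v (x + t • ee i) - Ω.indicator v x‖ₑ ≤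
      ENNReal.ofReal (24 * t) * (∫⁻ x, ‖v x‖ₑ ∂arcLength Ω + ∫⁻ x in Ω, ‖v' x‖ₑ) := by
  obtain ⟨b, hbm, hb, hbi⟩ := exists_shadow_bound i ht (isClosed_frontier (s := Ω)).measurableSet
    hv.measurable
  have hline : ∀ x : R 2, Continuous fun s : ℝ => x + s • ee i := fun x => by fun_prop
  set w : R 2 → ℝ≥0∞ := Ω.indicator fun x => ‖v' x‖ₑ with hw
  have hwm : Measurable w := hv'.enorm.measurable.indicator hΩ.measurableSet
  have hpt : ∀ x, ‖Ω.indicator v (x + t • ee i) - Ω.indicator v x‖ₑ ≤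
      2 * (b x + ∫⁻ s in Set.Icc 0 t, w (x + s • ee i)) := by
    intro x
    set O : Set ℝ := (fun s : ℝ => x + s • ee i) ⁻¹' Ω with hO
    have hOo : IsOpen O := hΩ.preimage (hline x)
    have h1 := enorm_indicator_sub_le (hd x) (hv'.comp (hline x)) hOo ht.le (B := b x)
      fun s hs hsf => hb x s hs ((hline x).frontier_preimage_subset Ω hsf)
    have h2 : ∀ s : ℝ, O.indicator (fun s => v (x + s • ee i)) s = Ω.indicator v (x + s • ee i) :=
      fun s => Set.indicator_comp_right (s := Ω) (g := v) fun s : ℝ => x + s • ee i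
    rw [h2, h2, zero_smul, add_zero] at h1
    have h3 : ∫⁻ s in Set.Icc 0 t ∩ O, ‖v' (x + s • ee i)‖ₑ
        = ∫⁻ s in Set.Icc 0 t, w (x + s • ee i) := by
      rw [Set.inter_comm, ← Measure.restrict_restrict hOo.measurableSet,
        ← lintegral_indicator hOo.measurableSet]
      exact lintegral_congr fun s => Set.indicator_comp_right (s := Ω)
        (g := fun x => ‖v' x‖ₑ) fun s : ℝ => x + s • ee i
    rw [← h3]
    exact h1
  have hjm : Measurable (Function.uncurry fun (x : R 2) (s : ℝ) => w (x + s • ee i)) := by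
    refine hwm.comp ?_
    exact (by fun_prop : Continuous fun q : R 2 × ℝ => q.1 + q.2 • ee i).measurable
  -- By Tonelli and translation invariance, every s in [0, t] contributes the same integral over Ω.
  have hfub : ∫⁻ x, (∫⁻ s in Set.Icc 0 t, w (x + s • ee i))
      = ENNReal.ofReal t * ∫⁻ x in Ω, ‖v' x‖ₑ := by
    rw [lintegral_lintegral_swap hjm.aemeasurable]
    simp only [lintegral_add_right_eq_self w, lintegral_const]
    rw [hw, lintegral_indicator hΩ.measurableSet, Measure.restrict_apply_univ, Real.volume_Icc,
      sub_zero, mul_comm]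
  refine (lintegral_mono hpt).trans ?_
  rw [lintegral_const_mul' _ _ (by norm_num), lintegral_add_left hbm, hfub]
  have e24 : ENNReal.ofReal (24 * t) = 2 * ENNReal.ofReal (12 * t) := by
    rw [show 24 * t = 2 * (12 * t) by ring, ENNReal.ofReal_mul (by norm_num)]
    simp
  rw [e24, mul_assoc]
  refine mul_le_mul_right ?_ _
  rw [mul_add]
  refine add_le_add hbi (mul_le_mul_left (ENNReal.ofReal_le_ofReal ?_) _)
  linarith

/-- The signed square s|s| is C¹ even at 0 and keeps the sign of s; it converts the L¹ translation
estimate into an L² one. -/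
theorem hasDerivAt_mul_abs (t : ℝ) : HasDerivAt (fun t : ℝ => t * |t|) (2 * |t|) t := by
  rcases lt_trichotomy t 0 with h | h | h
  · have h1 : HasDerivAt (fun t : ℝ => -(t ^ 2)) (2 * |t|) t :=
      (hasDerivAt_pow 2 t).neg.congr_deriv (by rw [abs_of_neg h]; push_cast; ring)
    refine h1.congr_of_eventuallyEq ?_
    filter_upwards [gt_mem_nhds h] with s hs
    rw [abs_of_neg hs]; ring
  · subst h
    rw [hasDerivAt_iff_isLittleO_nhds_zero]
    simp only [zero_add, abs_zero, mul_zero, sub_zero, smul_zero]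
    refine Asymptotics.isLittleO_iff.2 fun c hc => ?_
    filter_upwards [Metric.ball_mem_nhds (0:ℝ) hc] with s hs
    rw [norm_mul, Real.norm_eq_abs, Real.norm_eq_abs, abs_abs]
    rw [mem_ball_zero_iff, Real.norm_eq_abs] at hs
    exact mul_le_mul_of_nonneg_right hs.le (abs_nonneg _)
  · have h1 : HasDerivAt (fun t : ℝ => t ^ 2) (2 * |t|) t :=
      (hasDerivAt_pow 2 t).congr_deriv (by rw [abs_of_pos h]; push_cast; ring)
    refine h1.congr_of_eventuallyEq ?_
    filter_upwards [lt_mem_nhds h] with s hs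
    rw [abs_of_pos hs]; ring

/-- For equal signs |a - b| ≤ |a + b| reduces the bound to |a² - b²|; for opposite signs (a - b)² ≤
2(a² + b²), which is where the factor 2 is needed. -/
theorem sq_sub_le (a b : ℝ) : |a - b| ^ 2 ≤ 2 * abs (a * |a| - b * |b|) := by
  rw [sq_abs]
  rcases le_total 0 a with ha | ha <;> rcases le_total 0 b with hb | hb
  · rw [abs_of_nonneg ha, abs_of_nonneg hb]
    rcases le_total a b with h | h
    · nlinarith [neg_le_abs (a * a - b * b), mul_nonneg ha (sub_nonneg.2 h)]
    · nlinarith [le_abs_self (a * a - b * b), mul_nonneg hb (sub_nonneg.2 h)]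
  · rw [abs_of_nonneg ha, abs_of_nonpos hb]
    nlinarith [le_abs_self (a * a - b * -b), sq_nonneg (a + b)]
  · rw [abs_of_nonpos ha, abs_of_nonneg hb]
    nlinarith [neg_le_abs (a * -a - b * b), sq_nonneg (a + b)]
  · rw [abs_of_nonpos ha, abs_of_nonpos hb]
    rcases le_total a b with h | h
    · nlinarith [neg_le_abs (a * -a - b * -b), mul_nonneg (neg_nonneg.2 hb) (sub_nonneg.2 h)]
    · nlinarith [le_abs_self (a * -a - b * -b), mul_nonneg (neg_nonneg.2 ha) (sub_nonneg.2 h)]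

theorem lintegral_mul_le_eLpNorm {α : Type*} [MeasurableSpace α] {μ : Measure α} {f g : α → ℝ}
    (hf : AEStronglyMeasurable f μ) (hg : AEStronglyMeasurable g μ) :
    ∫⁻ x, ‖f x * g x‖ₑ ∂μ ≤ eLpNorm f 2 μ * eLpNorm g 2 μ := by
  have := eLpNorm_smul_le_mul_eLpNorm (p := 2) (q := 2) (r := 1) hg hf
  rw [eLpNorm_one_eq_lintegral_enorm] at this
  exact this

/-- The `L²` modulus of continuity of a smooth function that is cut off outside of `Ω`. -/
theorem lintegral_translate_sq_le {Ω : Set (R 2)} (hΩ : IsOpen Ω) (i : Fin 2) {t : ℝ} (ht : 0 < t)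
    {ψ : R 2 → ℝ} (hψ : ContDiff ℝ 1 ψ) :
    ∫⁻ x, ‖Ω.indicator ψ (x + t • ee i) - Ω.indicator ψ x‖ₑ ^ 2 ≤
      ENNReal.ofReal (48 * t) * (eLpNorm ψ 2 (arcLength Ω) ^ 2 +
        2 * (eLpNorm ψ 2 (volume.restrict Ω) * eLpNorm (pd i ψ) 2 (volume.restrict Ω))) := by
  -- The signed square commutes with the cutoff, and an L¹ bound on translates of v is an L² bound
  -- on translates of ψ. The derivative 2|ψ|∂ᵢψ of v is integrable by Cauchy–Schwarz.
  set v : R 2 → ℝ := fun x => ψ x * |ψ x| with hvdef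
  set v' : R 2 → ℝ := fun x => 2 * |ψ x| * pd i ψ x with hv'def
  have hv : Continuous v := hψ.continuous.mul hψ.continuous.abs
  have hv' : Continuous v' := (continuous_const.mul hψ.continuous.abs).mul (continuous_pd hψ)
  have hd : ∀ (x : R 2) (s : ℝ), HasDerivAt (fun s => v (x + s • ee i)) (v' (x + s • ee i)) s := by
    intro x s
    have h1 : HasDerivAt (fun s : ℝ => x + s • ee i) (ee i) s := by
      simpa using ((hasDerivAt_id s).smul_const (ee i)).const_add x
    have h2 : HasDerivAt (fun s => ψ (x + s • ee i)) (pd i ψ (x + s • ee i)) s :=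
      ((hψ.differentiable one_ne_zero (x + s • ee i)).hasFDerivAt).comp_hasDerivAt s h1
    exact (hasDerivAt_mul_abs (ψ (x + s • ee i))).comp s h2
  have hi : ∀ x, Ω.indicator v x = Ω.indicator ψ x * |Ω.indicator ψ x| := fun x => by
    by_cases hx : x ∈ Ω <;> simp [hx, hvdef]
  have hpt : ∀ x, ‖Ω.indicator ψ (x + t • ee i) - Ω.indicator ψ x‖ₑ ^ 2 ≤
      2 * ‖Ω.indicator v (x + t • ee i) - Ω.indicator v x‖ₑ := fun x => by
    rw [hi, hi, Real.enorm_eq_ofReal_abs, Real.enorm_eq_ofReal_abs,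
      ← ENNReal.ofReal_pow (abs_nonneg _)]
    refine (ENNReal.ofReal_le_ofReal (sq_sub_le _ _)).trans_eq ?_
    rw [ENNReal.ofReal_mul (by norm_num)]
    simp
  refine (lintegral_mono hpt).trans ?_
  rw [lintegral_const_mul' _ _ (by norm_num)]
  have e48 : ENNReal.ofReal (48 * t) = 2 * ENNReal.ofReal (24 * t) := by
    rw [show 48 * t = 2 * (24 * t) by ring, ENNReal.ofReal_mul (by norm_num)]
    simp
  rw [e48, mul_assoc]
  refine mul_le_mul_right ((lintegral_translate_sub_le hΩ i ht hv hv' hd).trans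
    (mul_le_mul_right (add_le_add ?_ ?_) _)) _
  · rw [eLpNorm_two_sq]
    refine lintegral_mono fun x => ?_
    simp [hvdef, sq]
  · have h1 : ∀ x, ‖v' x‖ₑ = 2 * ‖ψ x * pd i ψ x‖ₑ := fun x => by
      simp only [hv'def, enorm_mul, Real.enorm_eq_ofReal_abs, abs_abs, mul_assoc]
      congr 1
      norm_num
    simp only [h1]
    rw [lintegral_const_mul' _ _ (by norm_num)]
    exact mul_le_mul_right (lintegral_mul_le_eLpNorm hψ.continuous.aestronglyMeasurable
      (continuous_pd hψ).aestronglyMeasurable) _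

end

/-! ### Poincaré's inequality and L² compactness in the plane. -/

section

/-- Bounded sequences in a separable Hilbert space have weakly convergent subsequences. -/
theorem exists_weak_subseq {H : Type*} [NormedAddCommGroup H] [InnerProductSpace ℝ H]
    [CompleteSpace H] [TopologicalSpace.SeparableSpace H] {x : ℕ → H} {C : ℝ}
    (hx : ∀ n, ‖x n‖ ≤ C) :
    ∃ k : ℕ → ℕ, StrictMono k ∧ ∃ x' : H, ∀ y,
      Tendsto (fun n => inner ℝ (x (k n)) y) atTop (𝓝 (inner ℝ x' y)) := by
  have hseq := WeakDual.isSeqCompact_closedBall ℝ H 0 C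
  obtain ⟨f, -, k, hk, hlim⟩ := hseq (x := fun n => StrongDual.toWeakDual
    (InnerProductSpace.toDual ℝ H (x n))) (fun n => by
      change InnerProductSpace.toDual ℝ H (x n) ∈ Metric.closedBall 0 C
      rw [mem_closedBall_zero_iff, LinearIsometryEquiv.norm_map]
      exact hx n)
  refine ⟨k, hk, (InnerProductSpace.toDual ℝ H).symm (WeakDual.toStrongDual f), fun y => ?_⟩
  rw [InnerProductSpace.toDual_symm_apply]
  exact ((WeakDual.eval_continuous y).tendsto f).comp hlim

theorem exists_weak_subseq_memLp {d : ℕ} {U : Set (R d)} {f : ℕ → R d → ℝ} {C : ℝ≥0∞} (hC : C ≠ ⊤)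
    (hf : ∀ n, MemLp (f n) 2 (volume.restrict U))
    (hb : ∀ n, eLpNorm (f n) 2 (volume.restrict U) ≤ C) :
    ∃ k : ℕ → ℕ, StrictMono k ∧ ∃ f', MemLp f' 2 (volume.restrict U) ∧
      ∀ g, MemLp g 2 (volume.restrict U) →
        Tendsto (fun n => ∫ x in U, f (k n) x * g x) atTop (𝓝 (∫ x in U, f' x * g x)) := by
  have : Fact ((2 : ℝ≥0∞) ≠ ⊤) := ⟨by norm_num⟩
  obtain ⟨k, hk, x', hx'⟩ := exists_weak_subseq (x := fun n => (hf n).toLp (f n)) (C := C.toReal)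
    (fun n => by
      rw [Lp.norm_toLp]
      exact ENNReal.toReal_mono hC (hb n))
  refine ⟨k, hk, x', Lp.memLp x', fun g hg => ?_⟩
  have h1 := hx' (hg.toLp g)
  have h2 : ∀ {a b : R d → ℝ} {a' b' : Lp ℝ 2 (volume.restrict U)}, a' =ᵐ[volume.restrict U] a →
      b' =ᵐ[volume.restrict U] b → inner ℝ a' b' = ∫ x in U, a x * b x := by
    intro a b a' b' ha hb
    rw [L2.inner_def]
    refine integral_congr_ae ?_
    filter_upwards [ha, hb] with x hxa hxb
    rw [hxa, hxb]
    simp [mul_comm]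
  rw [h2 (a := x') (b := g) (by rfl) hg.coeFn_toLp] at h1
  refine h1.congr fun n => ?_
  rw [h2 (hf (k n)).coeFn_toLp hg.coeFn_toLp]

theorem memLp_of_continuous {d : ℕ} {U : Set (R d)} (hb : Bornology.IsBounded U) {f : R d → ℝ}
    (hf : Continuous f) : MemLp f 2 (volume.restrict U) := by
  have hc : IsCompact (closure U) := hb.isCompact_closure
  have hfin : IsFiniteMeasure (volume.restrict U) := ⟨by simpa using hb.measure_lt_top⟩
  obtain ⟨C, hC⟩ := hc.exists_bound_of_continuousOn hf.continuousOn
  have hlt := hb.measure_lt_top (μ := (volume : Measure (R d)))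
  exact MemLp.mono' (g := fun _ => |C|) (memLp_const _) hf.aestronglyMeasurable
    ((ae_restrict_of_ae_restrict_of_subset subset_closure
      (ae_restrict_of_forall_mem isClosed_closure.measurableSet
        fun x hx => (hC x hx).trans (le_abs_self C))))

/-- Absorbs the term linear in N: if the conclusion failed then N > 1, and multiplying the failed
bound by N would contradict the hypothesis. The summand 1 serves only to force N > 1. -/
theorem le_of_sq_le_add {N a B : ℝ} (ha : 0 ≤ a) (hB : 0 ≤ B)
    (h : N ^ 2 ≤ a * (B ^ 2 + 2 * (N * B))) : N ≤ a * B ^ 2 + 2 * a * B + 1 := by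
  by_contra hcon
  push Not at hcon
  have h1 : 0 ≤ a * B ^ 2 := by positivity
  have h2 : 0 ≤ 2 * a * B := by positivity
  have h3 : 1 < N := by linarith
  nlinarith [mul_lt_mul_of_pos_left hcon (by linarith : 0 < N)]

/-- Poincaré's inequality with a boundary term. -/
theorem exists_poincare {Ω : Set (R 2)} (hΩ : IsOpen Ω) (hb : Bornology.IsBounded Ω) {M : ℝ≥0∞}
    (hM : M ≠ ⊤) : ∃ N : ℝ≥0∞, N ≠ ⊤ ∧ ∀ ψ : R 2 → ℝ, ContDiff ℝ 1 ψ →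
      (∀ i, eLpNorm (pd i ψ) 2 (volume.restrict Ω) ≤ M) → eLpNorm ψ 2 (arcLength Ω) ≤ M →
      eLpNorm ψ 2 (volume.restrict Ω) ≤ N := by
  obtain ⟨r, hr0, hr⟩ := hb.subset_closedBall_lt 0 0
  -- A translation by more than the diameter moves Ω off itself, so on Ω the translation difference
  -- of the cut-off function is ψ up to sign.
  set t : ℝ := 2 * r + 1 with ht
  have ht0 : 0 < t := by positivity
  have hout : ∀ x ∈ Ω, x + t • ee 0 ∉ Ω := by
    intro x hx hx'
    have h1 := mem_closedBall_zero_iff.1 (hr hx)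
    have h2 := mem_closedBall_zero_iff.1 (hr hx')
    have h3 : ‖t • ee 0‖ = t := by
      rw [norm_smul, PiLp.norm_single, norm_one, mul_one, Real.norm_of_nonneg ht0.le]
    have h4 : t ≤ 2 * r := by
      rw [← h3]
      calc ‖t • ee 0‖ = ‖(x + t • ee 0) - x‖ := by simp
        _ ≤ 2 * r := (norm_sub_le _ _).trans (by linarith)
    linarith
  refine ⟨ENNReal.ofReal (48 * t * M.toReal ^ 2 + 2 * (48 * t) * M.toReal + 1),
    ENNReal.ofReal_ne_top, fun ψ hψ hD hT => ?_⟩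
  have hmem : eLpNorm ψ 2 (volume.restrict Ω) ≠ ⊤ := (memLp_of_continuous hb hψ.continuous).2.ne
  have h1 : eLpNorm ψ 2 (volume.restrict Ω) ^ 2 ≤ ENNReal.ofReal (48 * t) *
      (M ^ 2 + 2 * (eLpNorm ψ 2 (volume.restrict Ω) * M)) := by
    have h2 : eLpNorm ψ 2 (volume.restrict Ω) ^ 2 ≤
        ∫⁻ x, ‖Ω.indicator ψ (x + t • ee 0) - Ω.indicator ψ x‖ₑ ^ 2 := by
      rw [eLpNorm_two_sq]
      refine (setLIntegral_mono' hΩ.measurableSet fun x hx => ?_).trans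
        (setLIntegral_le_lintegral Ω _)
      rw [Set.indicator_of_mem hx, Set.indicator_of_notMem (hout x hx), zero_sub, enorm_neg]
    refine (h2.trans (lintegral_translate_sq_le hΩ 0 ht0 hψ)).trans ?_
    gcongr
    exact hD 0
  rw [← ENNReal.ofReal_toReal hmem]
  refine ENNReal.ofReal_le_ofReal (le_of_sq_le_add (by positivity) ENNReal.toReal_nonneg ?_)
  have h3 := ENNReal.toReal_mono (by finiteness) h1
  rwa [ENNReal.toReal_pow, ENNReal.toReal_mul, ENNReal.toReal_ofReal (by positivity),
    ENNReal.toReal_add (by finiteness) (by finiteness), ENNReal.toReal_pow, ENNReal.toReal_mul,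
    ENNReal.toReal_mul, ENNReal.toReal_ofNat] at h3

theorem eLpNorm_translate {d : ℕ} {f : R d → ℝ} (hf : Measurable f) (y : R d) :
    eLpNorm (fun x => f (x + y)) 2 volume = eLpNorm f 2 volume :=
  eLpNorm_comp_measurePreserving hf.aestronglyMeasurable (measurePreserving_add_right volume y)

/-- An average of translates is close to the function if the translates are. -/
theorem eLpNorm_average_sub_le {d : ℕ} {f : R d → ℝ} (hf : Measurable f) {ν : Measure (R d)}
    [IsProbabilityMeasure ν] (hint : ∀ x, Integrable (fun y => f (x + y)) ν) {W : ℝ≥0∞}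
    (hW : ∀ᵐ y ∂ν, eLpNorm (fun x => f (x + y) - f x) 2 volume ≤ W) :
    eLpNorm (fun x => (∫ y, f (x + y) ∂ν) - f x) 2 volume ≤ W := by
  have hm : Measurable (Function.uncurry fun (x y : R d) => ‖f (x + y) - f x‖ₑ ^ 2) :=
    ((hf.comp measurable_add).sub (hf.comp measurable_fst)).enorm.pow_const 2
  refine le_of_sq_le_sq ?_
  rw [eLpNorm_two_sq]
  calc ∫⁻ x, ‖(∫ y, f (x + y) ∂ν) - f x‖ₑ ^ 2
      ≤ ∫⁻ x, ∫⁻ y, ‖f (x + y) - f x‖ₑ ^ 2 ∂ν := by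
        refine lintegral_mono fun x => ?_
        have h1 : (∫ y, f (x + y) ∂ν) - f x = ∫ y, (f (x + y) - f x) ∂ν := by
          rw [integral_sub (hint x) (integrable_const _)]; simp
        rw [h1]
        exact (pow_le_pow_left₀ zero_le (enorm_integral_le_lintegral_enorm _) 2).trans
          (sq_lintegral_le ((hint x).1.sub aestronglyMeasurable_const))
    _ = ∫⁻ y, ∫⁻ x, ‖f (x + y) - f x‖ₑ ^ 2 ∂volume ∂ν := lintegral_lintegral_swap hm.aemeasurable
    _ ≤ ∫⁻ _, W ^ 2 ∂ν := by
        refine lintegral_mono_ae ?_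
        filter_upwards [hW] with y hy
        rw [← eLpNorm_two_sq]
        exact pow_le_pow_left₀ zero_le hy 2
    _ = W ^ 2 := by simp

/-- The cube with side `δ` in the positive quadrant. -/
def cube (δ : ℝ) : Set (R 2) := {y | ∀ j, y j ∈ Set.Ioo 0 δ}

theorem isOpen_cube (δ : ℝ) : IsOpen (cube δ) := by
  simp only [cube, Set.ofPred_forall]
  exact isOpen_iInter_of_finite fun j =>
    isOpen_Ioo.preimage (EuclideanSpace.proj (𝕜 := ℝ) j).continuous

theorem volume_cube_pos {δ : ℝ} (hδ : 0 < δ) : 0 < volume (cube δ) := by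
  refine (isOpen_cube δ).measure_pos volume ⟨WithLp.toLp 2 fun _ => δ / 2, fun j => ?_⟩
  simp [hδ]

theorem volume_cube_lt_top (δ : ℝ) : volume (cube δ) < ⊤ := by
  have hsub : cube δ ⊆ {x : R 2 | ∀ j, x j ∈ Set.Icc ((fun _ => 0 : Fin 2 → ℝ) j)
    ((fun _ => δ : Fin 2 → ℝ) j)} := fun y hy j => Set.Ioo_subset_Icc_self (hy j)
  refine (measure_mono hsub).trans_lt ?_
  rw [volume_box]
  exact ENNReal.prod_lt_top fun j _ => ENNReal.ofReal_lt_top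

theorem le_rpow_half {a b : ℝ≥0∞} (h : a ^ 2 ≤ b) : a ≤ b ^ (1 / 2 : ℝ) := by
  have h1 := ENNReal.rpow_le_rpow h (by norm_num : (0:ℝ) ≤ 1 / 2)
  rw [← ENNReal.rpow_natCast, ← ENNReal.rpow_mul] at h1
  simpa using h1

/-- Move along one coordinate and then the other. The cube lies in the positive quadrant because the
modulus of continuity is assumed for t > 0 only. -/
theorem eLpNorm_translate_sub_le_of_cube {f : R 2 → ℝ} (hf : Measurable f) {C : ℝ≥0∞}
    (h : ∀ i, ∀ t : ℝ, 0 < t →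
      ∫⁻ x, ‖f (x + t • ee i) - f x‖ₑ ^ 2 ≤ ENNReal.ofReal (48 * t) * C) {δ : ℝ} {y : R 2}
    (hy : y ∈ cube δ) :
    eLpNorm (fun x => f (x + y) - f x) 2 volume ≤
      2 * (ENNReal.ofReal (48 * δ) * C) ^ (1 / 2 : ℝ) := by
  have hi : ∀ i, eLpNorm (fun x => f (x + y i • ee i) - f x) 2 volume ≤
      (ENNReal.ofReal (48 * δ) * C) ^ (1 / 2 : ℝ) := by
    intro i
    refine le_rpow_half ?_
    rw [eLpNorm_two_sq]
    refine (h i (y i) (hy i).1).trans (mul_le_mul_left (ENNReal.ofReal_le_ofReal ?_) _)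
    linarith [(hy i).2]
  have hm : ∀ v : R 2, Measurable fun x => f (x + v) := fun v => hf.comp (measurable_add_const v)
  have hy2 : ∀ x, x + y = (x + y 1 • ee 1) + y 0 • ee 0 := fun x => by
    ext j; fin_cases j <;> simp
  have e : (fun x => f (x + y) - f x) = (fun x => f ((x + y 1 • ee 1) + y 0 • ee 0)
      - f (x + y 1 • ee 1)) + fun x => f (x + y 1 • ee 1) - f x := by
    ext x; simp [hy2]
  rw [e, two_mul]
  refine (eLpNorm_add_le (((hm _).comp (measurable_add_const _)).sub (hm _)).aestronglyMeasurable
    ((hm _).sub hf).aestronglyMeasurable one_le_two).trans (add_le_add ?_ (hi 1))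
  exact (eLpNorm_translate (f := fun x => f (x + y 0 • ee 0) - f x) ((hm _).sub hf) _).trans_le
    (hi 0)

/-- The uniform distribution on a cube. -/
def cubeMeasure (δ : ℝ) : Measure (R 2) := (volume (cube δ))⁻¹ • volume.restrict (cube δ)

theorem isProbabilityMeasure_cubeMeasure {δ : ℝ} (hδ : 0 < δ) :
    IsProbabilityMeasure (cubeMeasure δ) :=
  ⟨by simp [cubeMeasure, ENNReal.inv_mul_cancel (volume_cube_pos hδ).ne' (volume_cube_lt_top δ).ne]⟩

theorem memLp_indicator_cube (δ : ℝ) (x : R 2) :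
    MemLp (fun z => (cube δ).indicator (fun _ => (1 : ℝ)) (z - x)) 2 volume := by
  have h : MemLp ((cube δ).indicator fun _ => (1 : ℝ)) 2 volume :=
    memLp_indicator_const 2 (isOpen_cube δ).measurableSet 1 (Or.inr (volume_cube_lt_top δ).ne)
  exact h.comp_measurePreserving (measurePreserving_sub_right volume x)

/-- Written this way, an average of translates at x is a pairing of ψ with a fixed L² function, so
weak convergence of ψ makes the averages converge pointwise. -/
theorem integral_cubeMeasure {Ω : Set (R 2)} (hΩ : IsOpen Ω) (ψ : R 2 → ℝ) (δ : ℝ) (x : R 2) :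
    ∫ y, Ω.indicator ψ (x + y) ∂cubeMeasure δ = (volume (cube δ))⁻¹.toReal *
      ∫ z in Ω, ψ z * (cube δ).indicator (fun _ => (1 : ℝ)) (z - x) := by
  rw [cubeMeasure, integral_smul_measure, smul_eq_mul,
    ← integral_indicator (isOpen_cube δ).measurableSet, ← integral_indicator hΩ.measurableSet]
  congr 1
  rw [← integral_add_left_eq_self (Ω.indicator fun z => ψ z *
    (cube δ).indicator (fun _ => (1 : ℝ)) (z - x)) x]
  congr 1
  ext y
  by_cases h1 : y ∈ cube δ <;> by_cases h2 : x + y ∈ Ω <;> simp [h1, h2]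

/-- `L²` compactness of smooth functions with bounded gradients and boundary values. -/
theorem exists_subseq_tendsto_L2 {Ω : Set (R 2)} (hΩ : IsOpen Ω) (hb : Bornology.IsBounded Ω)
    {ψ : ℕ → R 2 → ℝ} (hψ : ∀ n, ContDiff ℝ 1 (ψ n)) {M : ℝ≥0∞} (hM : M ≠ ⊤)
    (hD : ∀ n i, eLpNorm (pd i (ψ n)) 2 (volume.restrict Ω) ≤ M)
    (hT : ∀ n, eLpNorm (ψ n) 2 (arcLength Ω) ≤ M) :
    ∃ k : ℕ → ℕ, StrictMono k ∧ ∃ f, MemLp f 2 (volume.restrict Ω) ∧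
      Tendsto (fun n => eLpNorm (fun x => ψ (k n) x - f x) 2 (volume.restrict Ω)) atTop (𝓝 0) := by
  have hfin : IsFiniteMeasure (volume.restrict Ω) := ⟨by simpa using hb.measure_lt_top⟩
  obtain ⟨N, hN, hNψ⟩ := exists_poincare hΩ hb hM
  have hmem : ∀ n, MemLp (ψ n) 2 (volume.restrict Ω) := fun n =>
    memLp_of_continuous hb (hψ n).continuous
  have hψN : ∀ n, eLpNorm (ψ n) 2 (volume.restrict Ω) ≤ N := fun n =>
    hNψ (ψ n) (hψ n) (hD n) (hT n)
  set C : ℝ≥0∞ := M ^ 2 + 2 * (N * M) with hC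
  have hCt : C ≠ ⊤ := by finiteness
  set f : ℕ → R 2 → ℝ := fun n => Ω.indicator (ψ n) with hf
  have hfm : ∀ n, Measurable (f n) := fun n =>
    (hψ n).continuous.measurable.indicator hΩ.measurableSet
  have hfL : ∀ n, MemLp (f n) 2 volume := fun n =>
    (memLp_indicator_iff_restrict hΩ.measurableSet).2 (hmem n)
  have hmod : ∀ n i, ∀ t : ℝ, 0 < t →
      ∫⁻ x, ‖f n (x + t • ee i) - f n x‖ₑ ^ 2 ≤ ENNReal.ofReal (48 * t) * C := by
    intro n i t ht
    refine (lintegral_translate_sq_le hΩ i ht (hψ n)).trans ?_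
    rw [hC]
    gcongr
    · exact hT n
    · exact hψN n
    · exact hD n i
  obtain ⟨k, hk, f', hf', hweak⟩ := exists_weak_subseq_memLp hN hmem hψN
  refine ⟨k, hk, ?_⟩
  set A : ℝ → ℕ → R 2 → ℝ := fun δ n x => ∫ y, f n (x + y) ∂cubeMeasure δ with hA
  have hAm : ∀ δ, 0 < δ → ∀ n, StronglyMeasurable (A δ n) := by
    intro δ hδ n
    have := isProbabilityMeasure_cubeMeasure hδ
    have h1 : StronglyMeasurable (Function.uncurry fun x y : R 2 => f n (x + y)) :=
      ((hfm n).comp measurable_add).stronglyMeasurable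
    exact h1.integral_prod_right
  -- Averaging over a small cube changes every member of the sequence by an amount that is small
  -- uniformly in n.
  have hclose : ∀ δ, 0 < δ → ∀ n, eLpNorm (fun x => A δ n x - f n x) 2 (volume.restrict Ω) ≤
      2 * (ENNReal.ofReal (48 * δ) * C) ^ (1 / 2 : ℝ) := by
    intro δ hδ n
    have := isProbabilityMeasure_cubeMeasure hδ
    refine (eLpNorm_mono_measure _ Measure.restrict_le_self).trans
      (eLpNorm_average_sub_le (hfm n) (fun x => ?_) ?_)
    · have h1 : MemLp (fun y => f n (x + y)) 2 (volume.restrict (cube δ)) :=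
        ((hfL n).comp_measurePreserving (measurePreserving_add_left volume x)).restrict _
      have : Fact (volume (cube δ) < ⊤) := ⟨volume_cube_lt_top δ⟩
      exact (h1.integrable one_le_two).smul_measure
        (ENNReal.inv_ne_top.2 (volume_cube_pos hδ).ne')
    · refine Measure.ae_smul_measure ?_ _
      exact ae_restrict_of_forall_mem (isOpen_cube δ).measurableSet fun y hy =>
        eLpNorm_translate_sub_le_of_cube (hfm n) (hmod n) hy
  -- For fixed δ the averages converge pointwise by weak convergence and are uniformly bounded by
  -- Cauchy–Schwarz, hence converge in L² of the bounded set Ω.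
  have hconv : ∀ δ, 0 < δ → ∃ g : R 2 → ℝ, AEStronglyMeasurable g (volume.restrict Ω) ∧
      Tendsto (fun n => eLpNorm (fun x => A δ (k n) x - g x) 2 (volume.restrict Ω)) atTop
        (𝓝 0) := by
    intro δ hδ
    set c : ℝ := (volume (cube δ))⁻¹.toReal
    set q : R 2 → R 2 → ℝ := fun x z => (cube δ).indicator (fun _ => (1 : ℝ)) (z - x) with hq
    have hlim : ∀ x, Tendsto (fun n => A δ (k n) x) atTop (𝓝 (c * ∫ z in Ω, f' z * q x z)) := by
      intro x
      refine ((hweak (q x) ((memLp_indicator_cube δ x).restrict Ω)).const_mul c).congr fun n => ?_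
      exact (integral_cubeMeasure hΩ (ψ (k n)) δ x).symm
    set K : ℝ≥0∞ := eLpNorm ((cube δ).indicator fun _ => (1 : ℝ)) 2 volume with hK
    have hKt : K ≠ ⊤ := (memLp_indicator_const 2 (isOpen_cube δ).measurableSet (1:ℝ)
      (Or.inr (volume_cube_lt_top δ).ne)).2.ne
    set B : ℝ := |c| * (N * K).toReal with hB
    have hbd : ∀ n x, |A δ n x| ≤ B := by
      intro n x
      have h1 : A δ n x = c * ∫ z in Ω, ψ n z * q x z := integral_cubeMeasure hΩ (ψ n) δ x
      rw [h1, abs_mul]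
      refine mul_le_mul_of_nonneg_left ?_ (abs_nonneg _)
      have hqL := (memLp_indicator_cube δ x).restrict Ω
      have h2 := enorm_integral_mul_le (hmem n).1 hqL.1
      have h3 : eLpNorm (q x) 2 (volume.restrict Ω) ≤ K := by
        refine (eLpNorm_mono_measure _ Measure.restrict_le_self).trans_eq ?_
        exact eLpNorm_comp_measurePreserving (g := (cube δ).indicator fun _ => (1 : ℝ))
          ((measurable_const.indicator (isOpen_cube δ).measurableSet).aestronglyMeasurable)
          (measurePreserving_sub_right volume x)
      have h4 := h2.trans (mul_le_mul' (hψN n) h3)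
      have h5 := ENNReal.toReal_mono (by finiteness) h4
      rwa [toReal_enorm] at h5
    have hgm : AEStronglyMeasurable (fun x => c * ∫ z in Ω, f' z * q x z) (volume.restrict Ω) :=
      aestronglyMeasurable_of_tendsto_ae atTop
        (fun n => (hAm δ hδ (k n)).aestronglyMeasurable) (Eventually.of_forall hlim)
    refine ⟨_, hgm, tendsto_eLpNorm_of_dominated (b := fun _ => 2 * B)
      (fun n => (hAm δ hδ (k n)).aestronglyMeasurable) hgm (memLp_const _)
      (fun n => Eventually.of_forall fun x => ?_) (Eventually.of_forall hlim)⟩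
    have h1 : ‖c * ∫ z in Ω, f' z * q x z‖ ≤ B :=
      le_of_tendsto (hlim x).norm (Eventually.of_forall fun n => hbd (k n) x)
    have h2 : ‖A δ (k n) x‖ ≤ B := hbd (k n) x
    exact (norm_sub_le _ _).trans (by linarith)
  -- Four quarters of e: for each of the two indices, one for the averaging error and one for the
  -- distance of the average to its limit.
  have hcauchy : CauchySeq fun n => (hmem (k n)).toLp (ψ (k n)) := by
    rw [EMetric.cauchySeq_iff]
    intro e he
    have hWlim : Tendsto (fun n : ℕ => 2 * (ENNReal.ofReal (48 * (1 / ((n : ℝ) + 1))) * C)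
        ^ (1 / 2 : ℝ)) atTop (𝓝 0) := by
      have h1 : Tendsto (fun n : ℕ => ENNReal.ofReal (48 * (1 / ((n : ℝ) + 1)))) atTop (𝓝 0) := by
        simpa using ENNReal.tendsto_ofReal (tendsto_one_div.const_mul 48)
      have h2 := (ENNReal.Tendsto.mul_const (b := C) h1 (Or.inr hCt)).ennrpow_const (1 / 2)
      have h3 := ENNReal.Tendsto.const_mul (a := 2) h2 (Or.inr (by norm_num))
      simpa using h3
    have he4 : 0 < e / 4 := ENNReal.div_pos he.ne' (by norm_num)
    obtain ⟨m, hm⟩ := (hWlim.eventually (gt_mem_nhds he4)).exists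
    obtain ⟨g, hgm, hg⟩ := hconv _ (one_div_pos' m)
    obtain ⟨n₀, hn₀⟩ := eventually_atTop.1 (hg.eventually (gt_mem_nhds he4))
    refine ⟨n₀, fun a ha b hb' => ?_⟩
    have hne : ∀ n ≥ n₀, eLpNorm (fun x => ψ (k n) x - g x) 2 (volume.restrict Ω) < e / 4 + e / 4 := by
      intro n hn
      have e1 : (fun x => ψ (k n) x - g x) =ᵐ[volume.restrict Ω]
          (fun x => A (1 / ((m : ℝ) + 1)) (k n) x - g x)
            - fun x => A (1 / ((m : ℝ) + 1)) (k n) x - f (k n) x := by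
        refine ae_restrict_of_forall_mem hΩ.measurableSet fun x hx => ?_
        simp [hf, hx]
      rw [eLpNorm_congr_ae e1]
      have hAs := (hAm _ (one_div_pos' m) (k n)).aestronglyMeasurable (μ := volume.restrict Ω)
      refine (eLpNorm_sub_le (hAs.sub hgm) (hAs.sub (hfm _).aestronglyMeasurable)
        one_le_two).trans_lt ?_
      exact ENNReal.add_lt_add (hn₀ n hn) ((hclose _ (one_div_pos' m) (k n)).trans_lt hm)
    rw [Lp.edist_toLp_toLp]
    have e2 : ψ (k a) - ψ (k b) = (fun x => ψ (k a) x - g x) - fun x => ψ (k b) x - g x := by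
      ext x; simp
    rw [e2]
    refine (eLpNorm_sub_le ((hmem _).1.sub hgm) ((hmem _).1.sub hgm) one_le_two).trans_lt
      ((ENNReal.add_lt_add (hne a ha) (hne b hb')).trans_eq ?_)
    rw [← two_mul, ← two_mul, ← mul_assoc]
    norm_num
    exact ENNReal.mul_div_cancel (by norm_num) (by norm_num)
  obtain ⟨F, hF⟩ := cauchySeq_tendsto_of_complete hcauchy
  refine ⟨F, Lp.memLp F, ?_⟩
  rw [tendsto_iff_edist_tendsto_0] at hF
  refine hF.congr fun n => ?_
  rw [Lp.edist_def]
  refine eLpNorm_congr_ae ?_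
  filter_upwards [(hmem (k n)).coeFn_toLp] with x hx
  simp [hx]

end

/-! ### Weak limits of gradients and the trace of a limit. -/

section

/-- Closed convex sets of a Hilbert space are weakly sequentially closed. -/
theorem mem_of_weak_limit {H : Type*} [NormedAddCommGroup H] [InnerProductSpace ℝ H]
    [CompleteSpace H] {K : Set H} (hc : IsClosed K) (hK : Convex ℝ K) {x : ℕ → H} {x' : H}
    (hx : ∀ᶠ n in atTop, x n ∈ K)
    (h : ∀ y, Tendsto (fun n => inner ℝ (x n) y) atTop (𝓝 (inner ℝ x' y))) : x' ∈ K := by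
  obtain ⟨n, hn⟩ := hx.exists
  obtain ⟨v, hv, hmin⟩ := exists_norm_eq_iInf_of_complete_convex ⟨x n, hn⟩ hc.isComplete hK x'
  have hle := (norm_eq_iInf_iff_real_inner_le_zero hK hv).1 hmin
  -- With v the projection of x' onto K, the inequality ⟨x' - v, xₙ - v⟩ ≤ 0 passes to the limit and
  -- gives ‖x' - v‖² ≤ 0.
  have h1 : Tendsto (fun n => inner ℝ (x' - v) (x n - v)) atTop (𝓝 (inner ℝ (x' - v) (x' - v))) := by
    simp only [inner_sub_right (x' - v)]
    refine Tendsto.sub_const ?_ _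
    simp only [real_inner_comm _ (x' - v)]
    exact h _
  have h2 : inner ℝ (x' - v) (x' - v) ≤ 0 := le_of_tendsto h1 (hx.mono fun n hn => hle _ hn)
  rw [real_inner_self_eq_norm_sq] at h2
  have h3 : ‖x' - v‖ = 0 := by nlinarith [norm_nonneg (x' - v)]
  rwa [sub_eq_zero.1 (norm_eq_zero.1 h3)]

variable {d : ℕ} {U : Set (R d)}

/-- The gradient of a smooth function. -/
def gradV (ψ : R d → ℝ) (x : R d) : R d := WithLp.toLp 2 fun i => pd i ψ x

theorem gradV_combo {ψ₁ ψ₂ : R d → ℝ} (h1 : ContDiff ℝ 1 ψ₁) (h2 : ContDiff ℝ 1 ψ₂) (a b : ℝ)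
    (x : R d) : gradV (fun x => a * ψ₁ x + b * ψ₂ x) x = a • gradV ψ₁ x + b • gradV ψ₂ x := by
  ext i
  have e := ((((h1.differentiable one_ne_zero) x).hasFDerivAt.const_mul a).add
    (((h2.differentiable one_ne_zero) x).hasFDerivAt.const_mul b)).fderiv
  simp only [gradV, pd, PiLp.add_apply, PiLp.smul_apply, smul_eq_mul]
  change fderiv ℝ ((fun x => a * ψ₁ x) + fun x => b * ψ₂ x) x _ = _
  rw [e]
  simp

theorem eLpNorm_combo_le {α : Type*} [MeasurableSpace α] {μ : Measure α} {f₁ f₂ g : α → ℝ}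
    {e : ℝ≥0∞} {a b : ℝ} (ha : 0 ≤ a) (hb : 0 ≤ b) (hab : a + b = 1)
    (hf₁ : AEStronglyMeasurable f₁ μ) (hf₂ : AEStronglyMeasurable f₂ μ)
    (hg : AEStronglyMeasurable g μ) (h1 : eLpNorm (fun x => f₁ x - g x) 2 μ ≤ e)
    (h2 : eLpNorm (fun x => f₂ x - g x) 2 μ ≤ e) :
    eLpNorm (fun x => a * f₁ x + b * f₂ x - g x) 2 μ ≤ e := by
  have e1 : (fun x => a * f₁ x + b * f₂ x - g x)
      = (a • fun x => f₁ x - g x) + b • fun x => f₂ x - g x := by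
    ext x
    simp only [Pi.add_apply, Pi.smul_apply, smul_eq_mul]
    linear_combination (g x) * hab
  rw [e1]
  refine (eLpNorm_add_le ((hf₁.sub hg).const_smul a) ((hf₂.sub hg).const_smul b)
    one_le_two).trans ?_
  rw [eLpNorm_const_smul, eLpNorm_const_smul, Real.enorm_of_nonneg ha, Real.enorm_of_nonneg hb]
  calc ENNReal.ofReal a * eLpNorm (fun x => f₁ x - g x) 2 μ
        + ENNReal.ofReal b * eLpNorm (fun x => f₂ x - g x) 2 μ
      ≤ ENNReal.ofReal a * e + ENNReal.ofReal b * e :=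
        add_le_add (mul_le_mul_right h1 _) (mul_le_mul_right h2 _)
    _ = e := by rw [← add_mul, ← ENNReal.ofReal_add ha hb, hab, ENNReal.ofReal_one, one_mul]

/-- The gradients of smooth functions that are close to `u` in `U` and to `g` for `σ`. -/
def gradSet (U : Set (R d)) (σ : Measure (R d)) (u g : R d → ℝ) (e : ℝ≥0∞) :
    Set (Lp (R d) 2 (volume.restrict U)) :=
  {x | ∃ ψ : R d → ℝ, ContDiff ℝ ∞ ψ ∧ eLpNorm (fun x => ψ x - u x) 2 (volume.restrict U) ≤ e ∧
    eLpNorm (fun x => ψ x - g x) 2 σ ≤ e ∧ x =ᵐ[volume.restrict U] gradV ψ}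

/-- The side conditions are balls about fixed functions and the gradient is linear, so convex
combinations are allowed. Convexity makes the norm closure weakly closed. -/
theorem convex_gradSet {σ : Measure (R d)} {u g : R d → ℝ} (e : ℝ≥0∞)
    (hu : AEStronglyMeasurable u (volume.restrict U)) (hg : AEStronglyMeasurable g σ) :
    Convex ℝ (gradSet U σ u g e) := by
  rintro x ⟨ψ₁, h1, h2, h3, h4⟩ y ⟨ψ₂, k1, k2, k3, k4⟩ a b ha hb hab
  refine ⟨fun x => a * ψ₁ x + b * ψ₂ x, (contDiff_const.mul h1).add (contDiff_const.mul k1),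
    eLpNorm_combo_le ha hb hab h1.continuous.aestronglyMeasurable
      k1.continuous.aestronglyMeasurable hu h2 k2,
    eLpNorm_combo_le ha hb hab h1.continuous.aestronglyMeasurable
      k1.continuous.aestronglyMeasurable hg h3 k3, ?_⟩
  filter_upwards [Lp.coeFn_add (a • x) (b • y), Lp.coeFn_smul a x, Lp.coeFn_smul b y, h4, k4]
    with z e1 e2 e3 e4 e5
  rw [e1, Pi.add_apply, e2, e3, Pi.smul_apply, Pi.smul_apply, e4, e5,
    gradV_combo (contDiff_one h1) (contDiff_one k1)]

/-- Weak closedness: a limit in `L²` of smooth functions with bounded gradients whose boundary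
values converge has the limit as its trace. -/
theorem exists_h1Trace_of_tendsto {σ : Measure (R d)} {u g : R d → ℝ}
    (hu : MemLp u 2 (volume.restrict U)) (hg : AEStronglyMeasurable g σ) {ψ : ℕ → R d → ℝ}
    (hψ : ∀ n, ContDiff ℝ ∞ (ψ n)) {M : ℝ≥0∞} (hM : M ≠ ⊤)
    (hD : ∀ n i, eLpNorm (pd i (ψ n)) 2 (volume.restrict U) ≤ M)
    (hL : Tendsto (fun n => eLpNorm (fun x => ψ n x - u x) 2 (volume.restrict U)) atTop (𝓝 0))
    (hT : Tendsto (fun n => eLpNorm (fun x => ψ n x - g x) 2 σ) atTop (𝓝 0)) :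
    ∃ q, H1Trace U σ u q g := by
  have : Fact ((2 : ℝ≥0∞) ≠ ⊤) := ⟨by norm_num⟩
  have hmem : ∀ n, MemLp (gradV (ψ n)) 2 (volume.restrict U) := fun n => memLp_of_apply fun i =>
    ⟨(continuous_pd (contDiff_one (hψ n))).aestronglyMeasurable, (hD n i).trans_lt hM.lt_top⟩
  have hbd : ∀ n, eLpNorm (gradV (ψ n)) 2 (volume.restrict U) ≤ ∑ _i : Fin d, M := fun n =>
    (eLpNorm_le_sum fun i => aestronglyMeasurable_apply (hmem n).1 i).trans
      (Finset.sum_le_sum fun i _ => hD n i)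
  have hMt : ∑ _i : Fin d, M ≠ ⊤ := ENNReal.sum_ne_top.2 fun _ _ => hM
  obtain ⟨k, hk, x', hx'⟩ := exists_weak_subseq (x := fun n => (hmem n).toLp (gradV (ψ n)))
    (C := (∑ _i : Fin d, M).toReal) (fun n => by
      rw [Lp.norm_toLp]
      exact ENNReal.toReal_mono hMt (hbd n))
  -- The tail of the sequence lies in the set with tolerance e, so its weak limit lies in the norm
  -- closure. One and the same x' thus has, for every e, a smooth function close to u and g whose
  -- gradient is close to x'.
  have hcl : ∀ e : ℝ≥0∞, e ≠ 0 → x' ∈ closure (gradSet U σ u g e) := by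
    intro e he
    refine mem_of_weak_limit isClosed_closure (convex_gradSet e hu.1 hg).closure ?_ hx'
    have he' : 0 < e := pos_iff_ne_zero.2 he
    filter_upwards [(hL.comp hk.tendsto_atTop).eventually (ge_mem_nhds he'),
      (hT.comp hk.tendsto_atTop).eventually (ge_mem_nhds he')] with n h1 h2
    exact subset_closure ⟨ψ (k n), hψ _, h1, h2, (hmem (k n)).coeFn_toLp⟩
  refine ⟨fun i x => x' x i, hu, fun i => memLp_apply (Lp.memLp x') i, fun e he => ?_⟩
  obtain ⟨y, ⟨φ, h1, h2, h3, h4⟩, hxy⟩ := EMetric.mem_closure_iff.1 (hcl e he) e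
    (pos_iff_ne_zero.2 he)
  refine ⟨φ, h1, h2, fun i => ?_, h3⟩
  rw [edist_comm, Lp.edist_def] at hxy
  refine le_trans ?_ hxy.le
  refine eLpNorm_mono_ae ?_
  filter_upwards [h4] with z hz
  rw [Pi.sub_apply, hz]
  exact abs_apply_le (gradV φ z - x' z) i

/-- Weak partial derivatives that are bounded in `L²` converge weakly if the functions converge. -/
theorem tendsto_integral_partial (hU : IsOpen U) {i : Fin d} {u p : ℕ → R d → ℝ}
    {u' p' : R d → ℝ} (h : ∀ n, HasWeakPartial U i (u n) (p n))
    (hu : ∀ n, MemLp (u n) 2 (volume.restrict U)) (hu' : MemLp u' 2 (volume.restrict U))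
    (hp : ∀ n, MemLp (p n) 2 (volume.restrict U)) (hp' : MemLp p' 2 (volume.restrict U))
    {M : ℝ≥0∞} (hM : M ≠ ⊤) (hb : ∀ n, eLpNorm (p n) 2 (volume.restrict U) ≤ M)
    (hL : Tendsto (fun n => eLpNorm (fun x => u n x - u' x) 2 (volume.restrict U)) atTop (𝓝 0))
    (h' : HasWeakPartial U i u' p') {y : R d → ℝ} (hy : MemLp y 2 (volume.restrict U)) :
    Tendsto (fun n => ∫ x in U, p n x * y x) atTop (𝓝 (∫ x in U, p' x * y x)) := by
  -- Every subsequence has a further one converging weakly, and uniqueness of weak derivatives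
  -- identifies its limit as p'.
  refine tendsto_of_subseq_tendsto fun ns hns => ?_
  obtain ⟨k, hk, q, hq, hweak⟩ := exists_weak_subseq_memLp hM (fun n => hp (ns n))
    fun n => hb (ns n)
  refine ⟨k, ?_⟩
  have h1 : HasWeakPartial U i u' q :=
    HasWeakPartial.of_tendsto (fun n => h (ns (k n)))
      (fun η hη => tendsto_integral_mul (fun n => hu _) hu' hη
        (hL.comp (hns.comp hk.tendsto_atTop))) hweak
  have h2 : q =ᵐ[volume.restrict U] p' :=
    h1.ae_eq hU (locallyIntegrableOn_of_memLp hq) (locallyIntegrableOn_of_memLp hp') h'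
  have h3 : ∫ x in U, p' x * y x = ∫ x in U, q x * y x := by
    refine integral_congr_ae ?_
    filter_upwards [h2] with x hx
    rw [hx]
  rw [h3]
  exact hweak y hy

end

/-! ### The quadratic form with frozen coefficient; planar competitors and rescaled minimizers. -/

section

section Algebra

variable {d m : ℕ}

/-- The linear map of the quadratic form `p ↦ |p|² + c (u/|u| · p)²`. -/
def amap (c : ℝ) (u q : R m) : R m := q + (c * inner ℝ (dir u) q) • dir u

theorem inner_amap (c : ℝ) (u p q : R m) :
    inner ℝ p (amap c u q) = inner ℝ p q + c * inner ℝ (dir u) p * inner ℝ (dir u) q := by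
  rw [amap, inner_add_right, real_inner_smul_right, real_inner_comm (dir u) p]
  ring

theorem sq_inner_dir_le (u p : R m) : (inner ℝ (dir u) p) ^ 2 ≤ ‖p‖ ^ 2 := by
  rw [← sq_abs (inner ℝ (dir u) p)]
  exact pow_le_pow_left₀ (abs_nonneg _) (abs_inner_dir_le u p) 2

/-- For c ≥ 0 the extra term can be dropped; for c ≤ 0 it is at least c|p|² because the direction
has norm at most 1. -/
theorem coercive (c : ℝ) (u p : R m) :
    min 1 (1 + c) * ‖p‖ ^ 2 ≤ ‖p‖ ^ 2 + c * (inner ℝ (dir u) p) ^ 2 := by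
  have h1 := sq_inner_dir_le u p
  rcases le_total 0 c with hc | hc
  · rw [min_eq_left (by linarith)]
    nlinarith [mul_nonneg hc (sq_nonneg (inner ℝ (dir u) p))]
  · rw [min_eq_right (by linarith)]
    nlinarith [mul_le_mul_of_nonpos_left h1 hc]

theorem coercive_sub (c : ℝ) (u p q : R m) :
    min 1 (1 + c) * ‖p - q‖ ^ 2 ≤ (‖p‖ ^ 2 + c * (inner ℝ (dir u) p) ^ 2)
      - 2 * inner ℝ p (amap c u q) + inner ℝ q (amap c u q) := by
  refine (coercive c u (p - q)).trans_eq ?_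
  rw [inner_amap, inner_amap, inner_sub_right, norm_sub_sq_real, real_inner_self_eq_norm_sq]
  ring

theorem sum_inner_amap (c : ℝ) (u : R m) (P : Fin d → R m) :
    ∑ i, inner ℝ (P i) (amap c u (P i)) = dens c u P := by
  refine Finset.sum_congr rfl fun i _ => ?_
  rw [inner_amap, real_inner_self_eq_norm_sq]
  ring

/-- Coercivity of the form at Q - P, expanded with both arguments sharing the same u. The density is
not jointly convex in u and the gradient, so freezing u is what replaces lower semicontinuity. -/
theorem coercive_dens (c : ℝ) (u : R m) (P Q : Fin d → R m) :
    ∑ i, min 1 (1 + c) * ‖Q i - P i‖ ^ 2 ≤ dens c u Q - 2 * ∑ i, inner ℝ (Q i) (amap c u (P i))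
      + ∑ i, inner ℝ (P i) (amap c u (P i)) := by
  rw [dens, Finset.mul_sum, ← Finset.sum_sub_distrib, ← Finset.sum_add_distrib]
  exact Finset.sum_le_sum fun i _ => coercive_sub c u (Q i) (P i)

theorem norm_amap_le (c : ℝ) (u q : R m) : ‖amap c u q‖ ≤ (1 + |c|) * ‖q‖ := by
  refine (norm_add_le _ _).trans ?_
  rw [norm_smul, Real.norm_eq_abs, abs_mul]
  have h1 := abs_inner_dir_le u q
  have h2 := norm_dir_le u
  have h3 : |c| * |inner ℝ (dir u) q| * ‖dir u‖ ≤ |c| * ‖q‖ * 1 := by gcongr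
  linarith

theorem norm_dens_le (c : ℝ) (u : R m) (P : Fin d → R m) :
    ‖dens c u P‖ ≤ ∑ i, (1 + |c|) * ‖P i‖ ^ 2 := by
  refine (norm_sum_le _ _).trans (Finset.sum_le_sum fun i _ => ?_)
  refine (norm_add_le _ _).trans ?_
  rw [norm_mul, Real.norm_eq_abs c, Real.norm_of_nonneg (sq_nonneg _),
    Real.norm_of_nonneg (sq_nonneg _)]
  nlinarith [mul_le_mul_of_nonneg_left (sq_inner_dir_le u (P i)) (abs_nonneg c)]

/-- The direction field is discontinuous only at 0, and there q = 0 makes both sides vanish. -/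
theorem tendsto_amap {c : ℝ} {u : ℕ → R m} {u' q : R m} (hu : Tendsto u atTop (𝓝 u'))
    (h : u' = 0 → q = 0) : Tendsto (fun n => amap c (u n) q) atTop (𝓝 (amap c u' q)) := by
  by_cases h0 : u' = 0
  · simp [h h0, amap]
  · have h1 : Tendsto (fun n => dir (u n)) atTop (𝓝 (dir u')) :=
      (hu.norm.inv₀ (norm_ne_zero_iff.2 h0)).smul hu
    exact tendsto_const_nhds.add
      ((tendsto_const_nhds.mul (h1.inner tendsto_const_nhds)).smul h1)

theorem measurable_amap (c : ℝ) : Measurable fun q : R m × R m => amap c q.1 q.2 := by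
  have h1 : Measurable fun q : R m × R m => dir q.1 := measurable_dir.comp measurable_fst
  exact measurable_snd.add (((h1.inner measurable_snd).const_mul c).smul h1)

theorem measurable_dens (c : ℝ) : Measurable fun q : R m × (Fin d → R m) => dens c q.1 q.2 := by
  have h1 : Measurable fun q : R m × (Fin d → R m) => dir q.1 := measurable_dir.comp measurable_fst
  have h2 : ∀ i, Measurable fun q : R m × (Fin d → R m) => q.2 i := fun i =>
    (measurable_pi_apply i).comp measurable_snd
  exact Finset.measurable_sum _ fun i _ =>
    ((h2 i).norm.pow_const 2).add (((h1.inner (h2 i)).pow_const 2).const_mul c)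

variable {α : Type*} [MeasurableSpace α] {μ : Measure α}

theorem integrable_dens (c : ℝ) {u : α → R m} {P : Fin d → α → R m}
    (hu : AEStronglyMeasurable u μ) (hP : ∀ i, MemLp (P i) 2 μ) :
    Integrable (fun x => dens c (u x) fun i => P i x) μ := by
  have hb : Integrable (fun x => ∑ i, (1 + |c|) * ‖P i x‖ ^ 2) μ :=
    integrable_finsetSum _ fun i _ =>
      ((memLp_two_iff_integrable_sq_norm (hP i).1).1 (hP i)).const_mul _
  refine hb.mono' ?_ (Eventually.of_forall fun x => norm_dens_le c _ _)
  exact ((measurable_dens c).comp_aemeasurable (hu.aemeasurable.prodMk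
    (aemeasurable_pi_lambda _ fun i => (hP i).1.aemeasurable))).aestronglyMeasurable

theorem memLp_amap (c : ℝ) {u q : α → R m} (hu : AEStronglyMeasurable u μ) (hq : MemLp q 2 μ) :
    MemLp (fun x => amap c (u x) (q x)) 2 μ :=
  (hq.norm.const_mul (1 + |c|)).mono' ((measurable_amap c).comp_aemeasurable
    (hu.aemeasurable.prodMk hq.1.aemeasurable)).aestronglyMeasurable
    (Eventually.of_forall fun _ => norm_amap_le c _ _)

theorem integrable_inner {f g : α → R m} (hf : MemLp f 2 μ) (hg : MemLp g 2 μ) :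
    Integrable (fun x => inner ℝ (f x) (g x)) μ := by
  have : (fun x => inner ℝ (f x) (g x)) = fun x => ∑ j, f x j * g x j := by
    ext x; simp [PiLp.inner_apply, mul_comm]
  rw [this]
  exact integrable_finsetSum _ fun j _ => (memLp_apply hf j).integrable_mul (memLp_apply hg j)

theorem eLpNorm_sq_eq_ofReal {f : α → R m} (hf : MemLp f 2 μ) :
    eLpNorm f 2 μ ^ 2 = ENNReal.ofReal (∫ x, ‖f x‖ ^ 2 ∂μ) := by
  rw [eLpNorm_two_sq, ofReal_integral_eq_lintegral_ofReal
    ((memLp_two_iff_integrable_sq_norm hf.1).1 hf) (Eventually.of_forall fun _ => sq_nonneg _)]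
  refine lintegral_congr fun x => ?_
  rw [ENNReal.ofReal_pow (norm_nonneg _), ofReal_norm]

/-- Products of weakly and strongly convergent sequences. -/
theorem tendsto_integral_mul_weak {f Y : ℕ → α → ℝ} {f' Y' : α → ℝ} (hf : ∀ n, MemLp (f n) 2 μ)
    (hY : ∀ n, MemLp (Y n) 2 μ) (hY' : MemLp Y' 2 μ) {M : ℝ≥0∞} (hM : M ≠ ⊤)
    (hb : ∀ n, eLpNorm (f n) 2 μ ≤ M)
    (hL : Tendsto (fun n => eLpNorm (fun x => Y n x - Y' x) 2 μ) atTop (𝓝 0))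
    (hw : Tendsto (fun n => ∫ x, f n x * Y' x ∂μ) atTop (𝓝 (∫ x, f' x * Y' x ∂μ))) :
    Tendsto (fun n => ∫ x, f n x * Y n x ∂μ) atTop (𝓝 (∫ x, f' x * Y' x ∂μ)) := by
  have h0 : Tendsto (fun n => ∫ x, f n x * (Y n x - Y' x) ∂μ) atTop (𝓝 0) := by
    rw [tendsto_zero_iff_enorm_tendsto_zero]
    have h1 : Tendsto (fun n => M * eLpNorm (fun x => Y n x - Y' x) 2 μ) atTop (𝓝 0) := by
      simpa using ENNReal.Tendsto.const_mul (a := M) hL (Or.inr hM)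
    refine tendsto_of_tendsto_of_tendsto_of_le_of_le tendsto_const_nhds h1 (fun _ => zero_le) ?_
    intro n
    exact (enorm_integral_mul_le (hf n).1 ((hY n).1.sub hY'.1)).trans (mul_le_mul_left (hb n) _)
  have h2 := hw.add h0
  rw [add_zero] at h2
  refine h2.congr fun n => ?_
  rw [← integral_add (f := fun x => f n x * Y' x) (g := fun x => f n x * (Y n x - Y' x))
    ((hf n).integrable_mul hY') ((hf n).integrable_mul ((hY n).sub hY'))]
  congr 1; ext x
  ring

end Algebra

section Extension

theorem norm_point (v : R 2) : ‖point v 0‖ = ‖v‖ := by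
  simp [EuclideanSpace.norm_eq, Fin.sum_univ_two, Fin.sum_univ_three]

theorem inner_point (v w : R 2) : inner ℝ (point v 0) (point w 0) = inner ℝ v w := by
  simp [PiLp.inner_apply, Fin.sum_univ_two, Fin.sum_univ_three]

theorem dir_point (v : R 2) : dir (point v 0) = point (dir v) 0 := by
  rw [dir, dir, norm_point]
  ext j; fin_cases j <;> simp

/-- The gradient of the constant extension in the thin direction. -/
def extGrad (P : Fin 2 → R 2 → R 2) (i : Fin 3) (x : R 3) : R 3 :=
  (![1, 1, 0] : Fin 3 → ℝ) i • point (P ((![0, 1, 0] : Fin 3 → Fin 2) i) (proj x)) 0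

theorem dens_extGrad (c : ℝ) (v : R 2) (P : Fin 2 → R 2 → R 2) (x : R 3) :
    dens c (point v 0) (fun i => extGrad P i x) = dens c v (fun i => P i (proj x)) := by
  simp [dens, Fin.sum_univ_three, Fin.sum_univ_two, extGrad, dir_point, inner_point, norm_point]

theorem h1Trace_zero {d : ℕ} (U : Set (R d)) (σ : Measure (R d)) :
    H1Trace U σ (fun _ => 0) (fun _ _ => 0) (fun _ => 0) :=
  ⟨MemLp.zero', fun _ => MemLp.zero', fun e _ => ⟨fun _ => 0, contDiff_const, by simp,
    fun i => by simp [show pd i (fun _ : R d => (0:ℝ)) = fun _ => 0 by ext; simp [pd]], by simp⟩⟩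

theorem h1Trace_extend {Ω : Set (R 2)} {σ : Measure (R 2)} [SFinite σ] {v G : R 2 → R 2}
    {P : Fin 2 → R 2 → R 2}
    (h : ∀ j, H1Trace Ω σ (fun x => v x j) (fun i x => P i x j) (fun x => G x j))
    (hG : Continuous G) (t : ℝ) (j : Fin 3) :
    H1Trace (film Ω t) (cyl σ t) (fun p => point (v (proj p)) 0 j)
      (fun i x => extGrad P i x j) (fun p => point (G (proj p)) 0 j) := by
  have hGj : ∀ j, AEStronglyMeasurable (fun x => G x j) σ := fun j =>
    aestronglyMeasurable_apply hG.aestronglyMeasurable j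
  fin_cases j
  · simpa [extGrad] using (h 0).extend (hGj 0) t
  · simpa [extGrad] using (h 1).extend (hGj 1) t
  · simpa [extGrad] using h1Trace_zero (film Ω t) (cyl σ t)

end Extension

section Classes

variable {Ω : Set (R 2)} {g G : R 2 → R 2}

theorem ae_arcLength (hG : Set.EqOn g G (frontier Ω)) : ∀ᵐ x ∂arcLength Ω, g x = G x :=
  ae_restrict_of_forall_mem isClosed_frontier.measurableSet hG

theorem ae_lateral [SFinite (arcLength Ω)] (hG : Set.EqOn g G (frontier Ω)) (h : ℝ) :
    ∀ᵐ p ∂cyl (arcLength Ω) h, g (proj p) = G (proj p) := by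
  refine ae_of_ae_map (f := proj) (p := fun x => g x = G x) continuous_proj.measurable.aemeasurable
    ?_
  rw [map_proj_cyl]
  exact Measure.ae_smul_measure (ae_arcLength hG) _

/-- On ∂Ω the datum g may be exchanged for its continuous extension G to the plane, and gradients
may be taken explicit; the slicing argument needs both. -/
theorem mem_H1g_iff (hΩ : IsOpen Ω) (hG : Set.EqOn g G (frontier Ω)) {u : R 2 → R 2} :
    u ∈ H1g Ω g ↔ ∀ j, ∃ p, H1Trace Ω (arcLength Ω) (fun x => u x j) p (fun x => G x j) := by
  have hae : ∀ j : Fin 2, (fun x => g x j) =ᵐ[arcLength Ω] fun x => G x j := fun j => by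
    filter_upwards [ae_arcLength hG] with x hx
    rw [hx]
  constructor
  · exact fun hu j => ⟨_, ((hu.2 j).h1Trace hΩ).congr_trace (hae j)⟩
  · intro h
    choose p hp using h
    exact ⟨fun j => (hp j).memH1, fun j => ((hp j).congr_trace (hae j).symm).hasTrace hΩ⟩

theorem exists_grad_of_mem_H1g (hΩ : IsOpen Ω) (hG : Set.EqOn g G (frontier Ω)) {u : R 2 → R 2}
    (hu : u ∈ H1g Ω g) : ∃ P : Fin 2 → R 2 → R 2,
      ∀ j, H1Trace Ω (arcLength Ω) (fun x => u x j) (fun i x => P i x j) (fun x => G x j) := by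
  choose p hp using (mem_H1g_iff hΩ hG).1 hu
  exact ⟨fun i x => WithLp.toLp 2 fun j => p j i x, hp⟩

theorem mem_filmClass_of_mem_H1g [SFinite (arcLength Ω)] (hΩ : IsOpen Ω)
    (hG : Set.EqOn g G (frontier Ω)) (hGc : Continuous G) {v : R 2 → R 2} (hv : v ∈ H1g Ω g)
    (t : ℝ) : (fun p => point (v (proj p)) 0) ∈ filmClass Ω g t := by
  obtain ⟨P, hP⟩ := exists_grad_of_mem_H1g hΩ hG hv
  have h1 := h1Trace_extend hP hGc t
  refine ⟨fun j => (h1 j).memH1, fun j => ?_, ?_⟩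
  · refine ((h1 j).congr_trace ?_).hasTrace (isOpen_film hΩ t)
    filter_upwards [ae_lateral hG t] with p hp
    rw [hp]
  · have h2 := (h1Trace_zero (film Ω t) (faceMeasure Ω t)).hasTrace (isOpen_film hΩ t)
    convert h2 using 2
    simp [PiLp.inner_apply]

theorem energy_H1g [IsFiniteMeasure (volume.restrict Ω)] (hΩ : IsOpen Ω) {v : R 2 → R 2}
    {P : Fin 2 → R 2 → R 2} {σ : Measure (R 2)}
    (hP : ∀ j, H1Trace Ω σ (fun x => v x j) (fun i x => P i x j) (fun x => G x j)) (ε : ℝ) :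
    energy ε Ω v = ∫ x in Ω, dens (1 / ε ^ 2 - 1) (v x) (fun i => P i x) :=
  VecH1.energy_eq hΩ (fun j => (hP j).zero) ε

theorem integral_dens_extGrad [IsFiniteMeasure (volume.restrict Ω)] {v : R 2 → R 2}
    {P : Fin 2 → R 2 → R 2} (hv : MemLp v 2 (volume.restrict Ω))
    (hP : ∀ i, MemLp (P i) 2 (volume.restrict Ω)) (c : ℝ) {t : ℝ} (ht : 0 < t) :
    ∫ x in film Ω t, dens c (point (v (proj x)) 0) (fun i => extGrad P i x)
      = t * ∫ x in Ω, dens c (v x) (fun i => P i x) := by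
  simp only [dens_extGrad]
  exact integral_film_proj Ω ht (fun x => dens c (v x) fun i => P i x) (integrable_dens c hv.1 hP).1

theorem energy_extend [IsFiniteMeasure (volume.restrict Ω)] [SFinite (arcLength Ω)]
    (hΩ : IsOpen Ω) (hG : Set.EqOn g G (frontier Ω)) (hGc : Continuous G) {v : R 2 → R 2}
    (hv : v ∈ H1g Ω g) (ε : ℝ) {t : ℝ} (ht : 0 < t) :
    energy ε (film Ω t) (fun p => point (v (proj p)) 0) = t * energy ε Ω v := by
  obtain ⟨P, hP⟩ := exists_grad_of_mem_H1g hΩ hG hv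
  have h1 := h1Trace_extend hP hGc t
  rw [energy_H1g hΩ hP, VecH1.energy_eq (isOpen_film hΩ t) (fun j => (h1 j).zero) ε]
  exact integral_dens_extGrad (memLp_of_apply fun j => (hP j).memLp)
    (fun i => memLp_of_apply fun j => (hP j).memLp_grad i) _ ht

/-- The properties of a rescaled minimizer `W`, with the rescaled gradient `Q` of the minimizer. -/
structure Rescaled (Ω : Set (R 2)) (g G : R 2 → R 2) (ε h : ℝ) (W : R 3 → R 3)
    (Q : Fin 3 → R 3 → R 3) : Prop where
  trace : ∀ j, H1Trace (film Ω 1) (cyl (arcLength Ω) 1) (fun p => W p j)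
    (fun i x => (![1, 1, h] : Fin 3 → ℝ) i * Q i x j) (fun p => point (G (proj p)) 0 j)
  vertical : eLpNorm (fun p => W p 2) 2 (volume.restrict (film Ω 1)) ≤
    eLpNorm (fun x => h * Q 2 x 2) 2 (volume.restrict (film Ω 1))
  memLp : ∀ i, MemLp (Q i) 2 (volume.restrict (film Ω 1))
  energy_le : ∀ v ∈ H1g Ω g,
    ∫ x in film Ω 1, dens (1 / ε ^ 2 - 1) (W x) (fun i => Q i x) ≤ energy ε Ω v

/-- Compare w with the constant extension of a planar v, whose energy is h times that of v; changing
variables puts the same factor h on the energy of w. Here Q is the gradient of w at the scaled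
point, so the vertical derivative of the rescaled map is h times the third entry of Q. -/
theorem exists_rescaled [IsFiniteMeasure (volume.restrict Ω)] [SFinite (arcLength Ω)]
    (hΩ : IsOpen Ω) (hG : Set.EqOn g G (frontier Ω)) (hGc : Continuous G) {ε h : ℝ} (hh : 0 < h)
    {w : R 3 → R 3} (hw : IsMinimizer (energy ε (film Ω h)) (filmClass Ω g h) w) :
    ∃ Q, Rescaled Ω g G ε h (rescale h w) Q := by
  have hopen := isOpen_film hΩ h
  set D : Fin 3 → R 3 → R 3 := fun i x =>
    WithLp.toLp 2 fun j => weakPartial (film Ω h) i (fun p => w p j) x with hD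
  have hlat : ∀ j, H1Trace (film Ω h) (cyl (arcLength Ω) h) (fun p => w p j)
      (fun i x => D i x j) (fun p => point (G (proj p)) 0 j) := fun j => by
    refine ((hw.1.2.1 j).h1Trace hopen).congr_trace ?_
    filter_upwards [ae_lateral hG h] with p hp
    rw [hp]
  have hface : H1Trace (film Ω h) (faceMeasure Ω h) (fun p => w p 2) (fun i x => D i x 2)
      (fun _ => 0) := by
    have h1 := hw.1.2.2
    have e : (fun p => inner ℝ (w p) (EuclideanSpace.single 2 (1 : ℝ))) = fun p => w p 2 := by
      ext p
      simp [PiLp.inner_apply]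
    rw [e] at h1
    exact h1.h1Trace hopen
  have hGm : ∀ j, AEStronglyMeasurable (fun p => point (G (proj p)) 0 j)
      (cyl (arcLength Ω) h) := fun j => by
    refine aestronglyMeasurable_apply (Continuous.aestronglyMeasurable ?_) j
    exact continuous_point.comp ((hGc.comp continuous_proj).prodMk continuous_const)
  have htr : ∀ j, H1Trace (film Ω 1) (cyl (arcLength Ω) 1) (fun p => rescale h w p j)
      (fun i x => (![1, 1, h] : Fin 3 → ℝ) i * D i (scaleL h x) j)
      (fun p => point (G (proj p)) 0 j) := fun j => by
    have h1 := (hlat j).rescale_cyl hh (hGm j)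
    simpa [rescale] using h1
  refine ⟨fun i x => D i (scaleL h x), htr, ?_, fun i => ?_, fun v hv => ?_⟩
  · exact (hface.rescale_face hh aestronglyMeasurable_const).eLpNorm_le_of_face
  · refine memLp_comp_map (c := ENNReal.ofReal h⁻¹) (μ := volume.restrict (film Ω h))
      ENNReal.ofReal_ne_top (scaleL h).continuous.measurable ?_
      (memLp_of_apply fun j => (hlat j).memLp_grad i)
    rw [volume_film, volume_film]
    exact (map_scale_cyl _ hh).le
  · have h1 := hw.2 _ (mem_filmClass_of_mem_H1g hΩ hG hGc hv h)
    rw [energy_extend hΩ hG hGc hv ε hh,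
      VecH1.energy_eq hopen (P := D) (fun j => (hlat j).zero) ε, integral_film_scale Ω hh] at h1
    exact le_of_mul_le_mul_left h1 hh

end Classes

end

/-! ### Planar limits, minimality and strong convergence of gradients. -/

section

theorem h1Trace_of_contDiff {d : ℕ} {U : Set (R d)} (hb : Bornology.IsBounded U)
    (σ : Measure (R d)) {φ : R d → ℝ} (hφ : ContDiff ℝ ∞ φ) :
    H1Trace U σ φ (fun i => pd i φ) φ :=
  ⟨memLp_of_continuous hb hφ.continuous,
    fun _ => memLp_of_continuous hb (continuous_pd (contDiff_one hφ)),
    fun e _ => ⟨φ, hφ, by simp, by simp, by simp⟩⟩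

theorem memLp_arcLength {Ω : Set (R 2)} (hb : Bornology.IsBounded Ω)
    [IsFiniteMeasure (arcLength Ω)] {f : R 2 → ℝ} (hf : Continuous f) :
    MemLp f 2 (arcLength Ω) := by
  have hK : IsCompact (frontier Ω) := hb.isCompact_closure.of_isClosed_subset isClosed_frontier
    frontier_subset_closure
  obtain ⟨C, hC⟩ := hK.exists_bound_of_continuousOn hf.continuousOn
  exact MemLp.mono' (g := fun _ => C) (memLp_const _) hf.aestronglyMeasurable
    (ae_restrict_of_forall_mem isClosed_frontier.measurableSet hC)

theorem eLpNorm_sub_proj_le {Ω : Set (R 2)} {ψ f : R 2 → ℝ} {u : R 3 → ℝ} (hψ : Continuous ψ)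
    (hu : MemLp u 2 (volume.restrict (film Ω 1))) (hf : MemLp f 2 (volume.restrict Ω)) :
    eLpNorm (fun x => u x - f (proj x)) 2 (volume.restrict (film Ω 1)) ≤
      eLpNorm (fun x => ψ x - f x) 2 (volume.restrict Ω) +
        eLpNorm (fun x => ψ (proj x) - u x) 2 (volume.restrict (film Ω 1)) := by
  have hψf : AEStronglyMeasurable (fun x => ψ x - f x) (volume.restrict Ω) :=
    hψ.aestronglyMeasurable.sub hf.1
  have hmap : (volume.restrict (film Ω 1)).map proj ≤ (1 : ℝ≥0∞) • volume.restrict Ω := by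
    rw [volume_film, map_proj_cyl]; simp
  have hcomp := (memLp_comp_map ENNReal.one_ne_top continuous_proj.measurable hmap hf).1
  have hψp : AEStronglyMeasurable (fun x => ψ (proj x)) (volume.restrict (film Ω 1)) :=
    (hψ.comp continuous_proj).aestronglyMeasurable
  have h1 := eLpNorm_sub_le (p := 2) (hψp.sub hcomp) (hψp.sub hu.1) one_le_two
  have e1 : (fun x => u x - f (proj x)) = ((fun x => ψ (proj x)) - fun x => f (proj x))
      - ((fun x => ψ (proj x)) - u) := by ext x; simp
  rw [e1]
  have h2 := eLpNorm_proj Ω (fun x => ψ x - f x) hψf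
  exact h1.trans (add_le_add h2 le_rfl)

/-- Compactness: if the vertical derivatives tend to zero, a subsequence converges in `L²` to a
function on the plane, which has the same trace. -/
theorem exists_planar_limit {Ω : Set (R 2)} (hΩ : IsOpen Ω) (hb : Bornology.IsBounded Ω)
    [IsFiniteMeasure (arcLength Ω)] {G : R 2 → ℝ} (hG : Continuous G) {u : ℕ → R 3 → ℝ}
    {p : ℕ → Fin 3 → R 3 → ℝ}
    (h : ∀ n, H1Trace (film Ω 1) (cyl (arcLength Ω) 1) (u n) (p n) fun x => G (proj x))
    {A : ℝ≥0∞} (hA : A ≠ ⊤) (hpA : ∀ n i, eLpNorm (p n i) 2 (volume.restrict (film Ω 1)) ≤ A)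
    (hz : Tendsto (fun n => eLpNorm (p n 2) 2 (volume.restrict (film Ω 1))) atTop (𝓝 0)) :
    ∃ k : ℕ → ℕ, StrictMono k ∧ ∃ f q, H1Trace Ω (arcLength Ω) f q G ∧
      Tendsto (fun n => eLpNorm (fun x => u (k n) x - f (proj x)) 2 (volume.restrict (film Ω 1)))
        atTop (𝓝 0) := by
  obtain ⟨e, he0, he1, helim⟩ : ∃ e : ℕ → ℝ≥0∞, (∀ n, e n ≠ 0) ∧ (∀ n, e n ≤ 1) ∧
      Tendsto e atTop (𝓝 0) := by
    refine ⟨fun n => ((n : ℝ≥0∞) + 1)⁻¹, fun n => ENNReal.inv_ne_zero.2 (by finiteness),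
      fun n => ENNReal.inv_le_one.2 le_add_self, ?_⟩
    exact_mod_cast (tendsto_add_atTop_iff_nat 1).2 ENNReal.tendsto_inv_nat_nhds_zero
  obtain ⟨B, hB⟩ : ∃ B : ℝ≥0∞, B = 2 * (A + 1) ^ 2 + 1 := ⟨_, rfl⟩
  have hBt : B ≠ ⊤ := by rw [hB]; finiteness
  have hBr : B ^ (1 / 2 : ℝ) ≠ ⊤ := ENNReal.rpow_ne_top_of_nonneg (by norm_num) hBt
  -- Smooth slices ψₙ stand in for uₙ, at an L² distance that tends to 0. Their gradient bound B
  -- depends only on A, and their trace errors are at most √B·eₙ.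
  choose ψ hψ h1 h2 h3 using fun n => (h n).exists_slice hG (hpA n) (he0 n) (he1 n)
  rw [← hB] at h2 h3
  have hGL := memLp_arcLength hb hG
  have hT : ∀ n, eLpNorm (ψ n) 2 (arcLength Ω) ≤
      B ^ (1 / 2 : ℝ) + eLpNorm G 2 (arcLength Ω) := by
    intro n
    have e1 : ψ n = (fun x => ψ n x - G x) + G := by ext x; simp
    rw [e1]
    refine (eLpNorm_add_le ((hψ n).continuous.sub hG).aestronglyMeasurable hGL.1
      one_le_two).trans (add_le_add (le_rpow_half ((h3 n).trans ?_)) le_rfl)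
    exact mul_le_of_le_one_right' (pow_le_one' (he1 n) 2)
  obtain ⟨k, hk, f, hf, hlim⟩ := exists_subseq_tendsto_L2 hΩ hb (fun n => contDiff_one (hψ n))
    (M := B ^ (1 / 2 : ℝ) + eLpNorm G 2 (arcLength Ω)) (ENNReal.add_ne_top.2 ⟨hBr, hGL.2.ne⟩)
    (fun n i => (le_rpow_half (h2 n i)).trans le_self_add) hT
  have hTlim : Tendsto (fun n => eLpNorm (fun x => ψ n x - G x) 2 (arcLength Ω)) atTop (𝓝 0) := by
    refine tendsto_zero_of_sq ?_
    have h4 : Tendsto (fun n => B * e n ^ 2) atTop (𝓝 0) := by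
      simpa using ENNReal.Tendsto.const_mul (a := B) (tendsto_sq_zero helim) (Or.inr hBt)
    exact tendsto_of_tendsto_of_tendsto_of_le_of_le tendsto_const_nhds h4 (fun _ => zero_le) h3
  obtain ⟨q, hq⟩ := exists_h1Trace_of_tendsto (σ := arcLength Ω) hf hGL.1 (fun n => hψ (k n)) hBr
    (fun n i => le_rpow_half (h2 (k n) i)) hlim (hTlim.comp hk.tendsto_atTop)
  refine ⟨k, hk, f, q, hq, ?_⟩
  have h5 : Tendsto (fun n => eLpNorm (fun x => ψ (k n) x - f x) 2 (volume.restrict Ω)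
      + (eLpNorm (p (k n) 2) 2 (volume.restrict (film Ω 1)) + 2 * e (k n))) atTop (𝓝 0) := by
    have h6 := ENNReal.Tendsto.const_mul (a := 2) (helim.comp hk.tendsto_atTop)
      (Or.inr (by norm_num))
    simpa using hlim.add ((hz.comp hk.tendsto_atTop).add h6)
  refine tendsto_of_tendsto_of_tendsto_of_le_of_le tendsto_const_nhds h5 (fun _ => zero_le) ?_
  intro n
  exact (eLpNorm_sub_proj_le (hψ (k n)).continuous (h (k n)).memLp hf).trans
    (add_le_add le_rfl (h1 (k n)))

section VectorWeak

variable {α : Type*} [MeasurableSpace α] {μ : Measure α} {m : ℕ}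

theorem eLpNorm_apply_le (f : α → R m) (j : Fin m) :
    eLpNorm (fun x => f x j) 2 μ ≤ eLpNorm f 2 μ :=
  eLpNorm_mono fun x => abs_apply_le (f x) j

theorem integral_inner_eq {f g : α → R m} (hf : MemLp f 2 μ) (hg : MemLp g 2 μ) :
    ∫ x, inner ℝ (f x) (g x) ∂μ = ∑ j, ∫ x, f x j * g x j ∂μ := by
  rw [← integral_finsetSum]
  · refine integral_congr_ae (Eventually.of_forall fun x => ?_)
    simp [PiLp.inner_apply, mul_comm]
  · exact fun j _ => (memLp_apply hf j).integrable_mul (memLp_apply hg j)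

theorem tendsto_integral_inner_weak {f Y : ℕ → α → R m} {f' Y' : α → R m}
    (hf : ∀ n, MemLp (f n) 2 μ) (hf' : MemLp f' 2 μ) (hY : ∀ n, MemLp (Y n) 2 μ)
    (hY' : MemLp Y' 2 μ) {M : ℝ≥0∞} (hM : M ≠ ⊤) (hb : ∀ n, eLpNorm (f n) 2 μ ≤ M)
    (hL : Tendsto (fun n => eLpNorm (fun x => Y n x - Y' x) 2 μ) atTop (𝓝 0))
    (hw : ∀ j, Tendsto (fun n => ∫ x, f n x j * Y' x j ∂μ) atTop (𝓝 (∫ x, f' x j * Y' x j ∂μ))) :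
    Tendsto (fun n => ∫ x, inner ℝ (f n x) (Y n x) ∂μ) atTop (𝓝 (∫ x, inner ℝ (f' x) (Y' x) ∂μ)) := by
  rw [integral_inner_eq hf' hY']
  simp only [fun n => integral_inner_eq (hf n) (hY n)]
  refine tendsto_finsetSum _ fun j _ => ?_
  refine tendsto_integral_mul_weak (fun n => memLp_apply (hf n) j) (fun n => memLp_apply (hY n) j)
    (memLp_apply hY' j) hM (fun n => (eLpNorm_apply_le _ j).trans (hb n)) ?_ (hw j)
  exact tendsto_of_tendsto_of_tendsto_of_le_of_le tendsto_const_nhds hL (fun _ => zero_le)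
    fun n => eLpNorm_apply_le (fun x => Y n x - Y' x) j

end VectorWeak

section Minimizers

variable {Ω : Set (R 2)} {g G : R 2 → R 2} {ε : ℝ}

/-- Here 1 + c = ε⁻², so the form stays positive definite also for ε > 1, when c < 0. -/
theorem ellipticity_pos (hε : 0 < ε) : 0 < min 1 (1 + (1 / ε ^ 2 - 1)) :=
  lt_min one_pos (by rw [add_sub_cancel]; positivity)

theorem Rescaled.memLp_fun {h : ℝ} {W : R 3 → R 3} {Q : Fin 3 → R 3 → R 3}
    (H : Rescaled Ω g G ε h W Q) : MemLp W 2 (volume.restrict (film Ω 1)) :=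
  memLp_of_apply fun j => (H.trace j).memLp

/-- The rescaled gradients are bounded by the energy of any planar competitor. -/
theorem Rescaled.eLpNorm_le (hε : 0 < ε) {h : ℝ} {W : R 3 → R 3} {Q : Fin 3 → R 3 → R 3}
    (H : Rescaled Ω g G ε h W Q) {v : R 2 → R 2} (hv : v ∈ H1g Ω g) (i : Fin 3) :
    eLpNorm (Q i) 2 (volume.restrict (film Ω 1)) ≤
      ENNReal.ofReal (energy ε Ω v / min 1 (1 + (1 / ε ^ 2 - 1))) ^ (1 / 2 : ℝ) := by
  have hm := ellipticity_pos hε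
  set c := 1 / ε ^ 2 - 1
  set m := min 1 (1 + c)
  refine le_rpow_half ?_
  rw [eLpNorm_sq_eq_ofReal (H.memLp i)]
  refine ENNReal.ofReal_le_ofReal ?_
  rw [le_div_iff₀ hm, mul_comm, ← integral_const_mul]
  refine le_trans ?_ (H.energy_le v hv)
  refine integral_mono (((memLp_two_iff_integrable_sq_norm (H.memLp i).1).1 (H.memLp i)).const_mul m)
    (integrable_dens c H.memLp_fun.1 H.memLp) fun x => ?_
  have h1 : ∀ j, 0 ≤ ‖Q j x‖ ^ 2 + c * (inner ℝ (dir (W x)) (Q j x)) ^ 2 := fun j =>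
    (mul_nonneg hm.le (sq_nonneg _)).trans (coercive c (W x) (Q j x))
  exact (coercive c (W x) (Q i x)).trans
    (Finset.single_le_sum (f := fun j => ‖Q j x‖ ^ 2 + c * (inner ℝ (dir (W x)) (Q j x)) ^ 2)
      (fun j _ => h1 j) (Finset.mem_univ i))

/-- A limit of rescaled minimizers minimizes the planar energy and the gradients converge. -/
theorem minimizes_and_tendsto [IsFiniteMeasure (volume.restrict Ω)] [IsFiniteMeasure (arcLength Ω)]
    (hΩ : IsOpen Ω) (hGc : Continuous G) (hε : 0 < ε)
    {h : ℕ → ℝ} {W : ℕ → R 3 → R 3} {Q : ℕ → Fin 3 → R 3 → R 3}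
    (H : ∀ n, Rescaled Ω g G ε (h n) (W n) (Q n)) {u : R 2 → R 2} (hu : u ∈ H1g Ω g)
    {P : Fin 2 → R 2 → R 2}
    (hP : ∀ j, H1Trace Ω (arcLength Ω) (fun x => u x j) (fun i x => P i x j) (fun x => G x j))
    (hL : Tendsto (fun n => eLpNorm (fun x => W n x - point (u (proj x)) 0) 2
      (volume.restrict (film Ω 1))) atTop (𝓝 0))
    (hae : ∀ᵐ x ∂volume.restrict (film Ω 1),
      Tendsto (fun n => W n x) atTop (𝓝 (point (u (proj x)) 0))) :
    (∀ v ∈ H1g Ω g, energy ε Ω u ≤ energy ε Ω v) ∧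
      ∀ i, Tendsto (fun n => eLpNorm (fun x => Q n i x - extGrad P i x) 2
        (volume.restrict (film Ω 1))) atTop (𝓝 0) := by
  have hm := ellipticity_pos hε
  have hopen := isOpen_film hΩ 1
  set μ := volume.restrict (film Ω 1) with hμ
  set c := 1 / ε ^ 2 - 1 with hc
  set m := min 1 (1 + c) with hmdef
  set U : R 3 → R 3 := fun x => point (u (proj x)) 0 with hUdef
  have hext := h1Trace_extend hP hGc 1
  have hvec : VecH1 (film Ω 1) U (extGrad P) := fun j => (hext j).zero
  have hUL : MemLp U 2 μ := hvec.memLp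
  have hPL : ∀ i, MemLp (extGrad P i) 2 μ := hvec.memLp_grad
  set M : ℝ≥0∞ := ENNReal.ofReal (energy ε Ω u / m) ^ (1 / 2 : ℝ) with hM
  have hMt : M ≠ ⊤ := ENNReal.rpow_ne_top_of_nonneg (by norm_num) ENNReal.ofReal_ne_top
  have hQM : ∀ n i, eLpNorm (Q n i) 2 μ ≤ M := fun n i => (H n).eLpNorm_le hε hu i
  have hYL : ∀ n i, MemLp (fun x => amap c (W n x) (extGrad P i x)) 2 μ := fun n i =>
    memLp_amap c (H n).memLp_fun.1 (hPL i)
  have hYL' : ∀ i, MemLp (fun x => amap c (U x) (extGrad P i x)) 2 μ := fun i =>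
    memLp_amap c hUL.1 (hPL i)
  -- Strong convergence of A(Wₙ)P: pointwise a.e. because P vanishes where the limit map does, and
  -- dominated by a multiple of |P|.
  have hYt : ∀ i, Tendsto (fun n => eLpNorm (fun x => amap c (W n x) (extGrad P i x)
      - amap c (U x) (extGrad P i x)) 2 μ) atTop (𝓝 0) := by
    intro i
    refine tendsto_eLpNorm_of_dominated (b := fun x => (2 * (1 + |c|)) * ‖extGrad P i x‖)
      (fun n => (hYL n i).1) (hYL' i).1 ((hPL i).norm.const_mul _)
      (fun n => Eventually.of_forall fun x => ?_) ?_
    · refine (norm_sub_le _ _).trans ?_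
      linarith [norm_amap_le c (W n x) (extGrad P i x), norm_amap_le c (U x) (extGrad P i x)]
    · filter_upwards [hae, hvec.grad_eq_zero hopen i] with x hx h0
      exact tendsto_amap hx h0
  have hweak : ∀ i j, Tendsto (fun n => ∫ x, Q n i x j * amap c (U x) (extGrad P i x) j ∂μ) atTop
      (𝓝 (∫ x, extGrad P i x j * amap c (U x) (extGrad P i x) j ∂μ)) := by
    intro i j
    have hLj : Tendsto (fun n => eLpNorm (fun x => W n x j - U x j) 2 μ) atTop (𝓝 0) :=
      tendsto_of_tendsto_of_tendsto_of_le_of_le tendsto_const_nhds hL (fun _ => zero_le)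
        fun n => eLpNorm_apply_le (fun x => W n x - U x) j
    have hpart : (∀ n, HasWeakPartial (film Ω 1) i (fun x => W n x j) (fun x => Q n i x j)) →
        Tendsto (fun n => ∫ x, Q n i x j * amap c (U x) (extGrad P i x) j ∂μ) atTop
          (𝓝 (∫ x, extGrad P i x j * amap c (U x) (extGrad P i x) j ∂μ)) := fun hw =>
      tendsto_integral_partial hopen hw (fun n => ((H n).trace j).memLp) (hext j).memLp
        (fun n => memLp_apply ((H n).memLp i) j) ((hext j).memLp_grad i) hMt
        (fun n => (eLpNorm_apply_le _ j).trans (hQM n i)) hLj ((hext j).hasWeakPartial i)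
        (memLp_apply (hYL' i) j)
    have hQw := fun n => ((H n).trace j).hasWeakPartial i
    fin_cases i
    · exact hpart fun n => by simpa using hQw n
    · exact hpart fun n => by simpa using hQw n
    -- The bounds alone do not identify a weak limit of ∂₃Wₙ/hₙ, but none is needed: it is paired
    -- with A(U)P₃ = 0.
    · have h0 : ∀ x, extGrad P 2 x = 0 := fun x => by simp [extGrad]
      simp [h0, amap]
  have hA : ∀ i, Tendsto (fun n => ∫ x, inner ℝ (Q n i x) (amap c (W n x) (extGrad P i x)) ∂μ) atTop
      (𝓝 (∫ x, inner ℝ (extGrad P i x) (amap c (U x) (extGrad P i x)) ∂μ)) := fun i =>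
    tendsto_integral_inner_weak (fun n => (H n).memLp i) (hPL i) (fun n => hYL n i) (hYL' i) hMt
      (fun n => hQM n i) (hYt i) (hweak i)
  have hB : ∀ i, Tendsto (fun n => ∫ x, inner ℝ (extGrad P i x) (amap c (W n x) (extGrad P i x)) ∂μ)
      atTop (𝓝 (∫ x, inner ℝ (extGrad P i x) (amap c (U x) (extGrad P i x)) ∂μ)) := fun i =>
    tendsto_integral_inner_weak (fun _ => hPL i) (hPL i) (fun n => hYL n i) (hYL' i) (hPL i).2.ne
      (fun _ => le_rfl) (hYt i) (fun _ => tendsto_const_nhds)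
  have hEu : ∑ i, ∫ x, inner ℝ (extGrad P i x) (amap c (U x) (extGrad P i x)) ∂μ
      = energy ε Ω u := by
    rw [← integral_finsetSum _ fun i _ => integrable_inner (hPL i) (hYL' i)]
    simp only [sum_inner_amap]
    rw [energy_H1g hΩ hP, ← hc, hμ, integral_dens_extGrad (memLp_of_apply fun j => (hP j).memLp)
      (fun i => memLp_of_apply fun j => (hP j).memLp_grad i) c one_pos, one_mul]
  -- Integrated positivity of the form frozen at Wₙ, with the energy of (Wₙ, Qₙ) replaced by that of
  -- an arbitrary competitor v.
  have hineq : ∀ v ∈ H1g Ω g, ∀ n, ∑ i, m * ∫ x, ‖Q n i x - extGrad P i x‖ ^ 2 ∂μ ≤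
      energy ε Ω v - 2 * ∑ i, ∫ x, inner ℝ (Q n i x) (amap c (W n x) (extGrad P i x)) ∂μ
        + ∑ i, ∫ x, inner ℝ (extGrad P i x) (amap c (W n x) (extGrad P i x)) ∂μ := by
    intro v hv n
    have hsq : ∀ i, Integrable (fun x => m * ‖Q n i x - extGrad P i x‖ ^ 2) μ := fun i => by
      have h1 := ((H n).memLp i).sub (hPL i)
      exact ((memLp_two_iff_integrable_sq_norm h1.1).1 h1).const_mul m
    have hdens : Integrable (fun x => dens c (W n x) fun i => Q n i x) μ :=
      integrable_dens c (H n).memLp_fun.1 (H n).memLp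
    have i1 : ∀ i, Integrable
        (fun x => inner ℝ (Q n i x) (amap c (W n x) (extGrad P i x))) μ := fun i =>
      integrable_inner ((H n).memLp i) (hYL n i)
    have i2 : ∀ i, Integrable
        (fun x => inner ℝ (extGrad P i x) (amap c (W n x) (extGrad P i x))) μ := fun i =>
      integrable_inner (hPL i) (hYL n i)
    have s1 := integrable_finsetSum Finset.univ fun i _ => i1 i
    have s2 := integrable_finsetSum Finset.univ fun i _ => i2 i
    have h1 := integral_mono (integrable_finsetSum Finset.univ fun i _ => hsq i)
      ((hdens.sub (s1.const_mul 2)).add s2)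
      fun x => coercive_dens c (W n x) (fun i => extGrad P i x) (fun i => Q n i x)
    rw [integral_finsetSum _ fun i _ => hsq i, integral_add' (hdens.sub (s1.const_mul 2)) s2,
      integral_sub' hdens (s1.const_mul 2), integral_const_mul,
      integral_finsetSum _ fun i _ => i1 i, integral_finsetSum _ fun i _ => i2 i] at h1
    simp only [integral_const_mul] at h1
    have h2 := (H n).energy_le v hv
    linarith
  -- The limit is E(v) - 2E(u) + E(u). Its sign for every v gives minimality; its vanishing for v =
  -- u gives strong convergence.
  have hlim : ∀ v : R 2 → R 2, Tendsto (fun n => energy ε Ω v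
      - 2 * ∑ i, ∫ x, inner ℝ (Q n i x) (amap c (W n x) (extGrad P i x)) ∂μ
        + ∑ i, ∫ x, inner ℝ (extGrad P i x) (amap c (W n x) (extGrad P i x)) ∂μ) atTop
      (𝓝 (energy ε Ω v - energy ε Ω u)) := by
    intro v
    have h1 := ((tendsto_const_nhds (x := energy ε Ω v)).sub
      ((tendsto_finsetSum Finset.univ fun i _ => hA i).const_mul 2)).add
      (tendsto_finsetSum Finset.univ fun i _ => hB i)
    rw [hEu] at h1
    convert h1 using 2
    ring
  have hnn : ∀ n i, 0 ≤ m * ∫ x, ‖Q n i x - extGrad P i x‖ ^ 2 ∂μ := fun n i =>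
    mul_nonneg hm.le (integral_nonneg fun x => sq_nonneg _)
  refine ⟨fun v hv => ?_, fun i => ?_⟩
  · have h1 : 0 ≤ energy ε Ω v - energy ε Ω u := ge_of_tendsto' (hlim v) fun n =>
      (Finset.sum_nonneg fun i _ => hnn n i).trans (hineq v hv n)
    linarith
  · have h1 : Tendsto (fun n => m * ∫ x, ‖Q n i x - extGrad P i x‖ ^ 2 ∂μ) atTop (𝓝 0) := by
      have h2 := hlim u
      rw [sub_self] at h2
      refine tendsto_of_tendsto_of_tendsto_of_le_of_le tendsto_const_nhds h2 (fun n => hnn n i) ?_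
      exact fun n => (Finset.single_le_sum
        (f := fun i => m * ∫ x, ‖Q n i x - extGrad P i x‖ ^ 2 ∂μ) (fun i _ => hnn n i)
        (Finset.mem_univ i)).trans (hineq u hu n)
    have h3 : Tendsto (fun n => ∫ x, ‖Q n i x - extGrad P i x‖ ^ 2 ∂μ) atTop (𝓝 0) := by
      have := h1.const_mul m⁻¹
      rw [mul_zero] at this
      refine this.congr fun n => ?_
      rw [inv_mul_cancel_left₀ hm.ne']
    refine tendsto_zero_of_sq ?_
    have h4 := ENNReal.tendsto_ofReal h3
    rw [ENNReal.ofReal_zero] at h4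
    exact h4.congr fun n => (eLpNorm_sq_eq_ofReal (((H n).memLp i).sub (hPL i))).symm

end Minimizers

end

/-! ### Extraction of the limit and convergence in H¹. -/

section

theorem eLpNorm_const_mul_apply_le {α : Type*} [MeasurableSpace α] {μ : Measure α} {m : ℕ}
    {M : ℝ≥0∞} {f : α → R m} (hf : eLpNorm f 2 μ ≤ M) (a : ℝ) (j : Fin m) :
    eLpNorm (fun x => a * f x j) 2 μ ≤ ‖a‖ₑ * M := by
  have h1 := eLpNorm_const_smul (p := 2) (μ := μ) a fun x => f x j
  have h2 : (a • fun x => f x j) = fun x => a * f x j := rfl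
  rw [h2] at h1
  rw [h1]
  exact mul_le_mul_right ((eLpNorm_apply_le f j).trans hf) _

section Limit

variable {Ω : Set (R 2)} {g G : R 2 → R 2} {ε : ℝ} {h : ℕ → ℝ} {W : ℕ → R 3 → R 3}
  {Q : ℕ → Fin 3 → R 3 → R 3} {M : ℝ≥0∞}

theorem tendsto_eLpNorm_vertical (hlim : Tendsto h atTop (𝓝 0)) (hM : M ≠ ⊤)
    (hQ : ∀ n i, eLpNorm (Q n i) 2 (volume.restrict (film Ω 1)) ≤ M) (j : Fin 3) :
    Tendsto (fun n => eLpNorm (fun x => h n * Q n 2 x j) 2 (volume.restrict (film Ω 1)))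
      atTop (𝓝 0) := by
  have h1 : Tendsto (fun n => ‖h n‖ₑ * M) atTop (𝓝 0) := by
    have h2 : Tendsto (fun n => ‖h n‖ₑ) atTop (𝓝 0) := by simpa using hlim.enorm
    simpa using ENNReal.Tendsto.mul_const h2 (Or.inr hM)
  exact tendsto_of_tendsto_of_tendsto_of_le_of_le tendsto_const_nhds h1 (fun _ => zero_le)
    fun n => eLpNorm_const_mul_apply_le (hQ n 2) (h n) j

theorem exists_bound_scaled (hlim : Tendsto h atTop (𝓝 0)) (hM : M ≠ ⊤)
    (hQ : ∀ n i, eLpNorm (Q n i) 2 (volume.restrict (film Ω 1)) ≤ M) :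
    ∃ A : ℝ≥0∞, A ≠ ⊤ ∧ ∀ j n i, eLpNorm (fun x => (![1, 1, h n] : Fin 3 → ℝ) i * Q n i x j) 2
      (volume.restrict (film Ω 1)) ≤ A := by
  obtain ⟨C, hC⟩ := isBounded_iff_forall_norm_le.1 (Metric.isBounded_range_of_tendsto h hlim)
  refine ⟨(1 + ENNReal.ofReal C) * M, by finiteness, fun j n i => ?_⟩
  refine (eLpNorm_const_mul_apply_le (hQ n i) _ j).trans (mul_le_mul_left ?_ M)
  have h1 : ‖h n‖ₑ ≤ ENNReal.ofReal C := by
    rw [← ofReal_norm]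
    exact ENNReal.ofReal_le_ofReal (hC _ ⟨n, rfl⟩)
  fin_cases i
  · simp
  · simp
  · simpa using h1.trans le_add_self

/-- A subsequence of rescaled minimizers converges in `L²` to a planar map. -/
theorem exists_limit (hΩ : IsOpen Ω) (hb : Bornology.IsBounded Ω)
    [IsFiniteMeasure (arcLength Ω)] (hG : Continuous G) (hlim : Tendsto h atTop (𝓝 0))
    (H : ∀ n, Rescaled Ω g G ε (h n) (W n) (Q n)) (hM : M ≠ ⊤)
    (hQ : ∀ n i, eLpNorm (Q n i) 2 (volume.restrict (film Ω 1)) ≤ M) :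
    ∃ k : ℕ → ℕ, StrictMono k ∧ ∃ (u : R 2 → R 2) (P : Fin 2 → R 2 → R 2),
      (∀ j, H1Trace Ω (arcLength Ω) (fun x => u x j) (fun i x => P i x j) (fun x => G x j)) ∧
      Tendsto (fun n => eLpNorm (fun x => W (k n) x - point (u (proj x)) 0) 2
        (volume.restrict (film Ω 1))) atTop (𝓝 0) := by
  obtain ⟨A, hA, hpA⟩ := exists_bound_scaled hlim hM hQ
  have hGj : ∀ j, Continuous fun x => G x j := fun j => by fun_prop
  obtain ⟨k, hk, f₀, q₀, hq₀, hf₀⟩ := exists_planar_limit hΩ hb (hGj 0)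
    (u := fun n x => W n x 0) (fun n => by simpa [point] using (H n).trace 0) hA (hpA 0)
    (by simpa using tendsto_eLpNorm_vertical hlim hM hQ 0)
  -- The second component is handled along the subsequence already chosen for the first.
  obtain ⟨l, hl, f₁, q₁, hq₁, hf₁⟩ := exists_planar_limit hΩ hb (hGj 1)
    (u := fun n x => W (k n) x 1) (fun n => by simpa [point] using (H (k n)).trace 1) hA
    (fun n => hpA 1 (k n))
    (by simpa [Function.comp_def] using (tendsto_eLpNorm_vertical hlim hM hQ 1).comp hk.tendsto_atTop)
  have hP : ∀ j : Fin 2, H1Trace Ω (arcLength Ω) (fun x => !₂[f₀ x, f₁ x] j)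
      (fun i x => !₂[q₀ i x, q₁ i x] j) (fun x => G x j) := by
    intro j
    fin_cases j
    · simpa using hq₀
    · simpa using hq₁
  refine ⟨k ∘ l, hk.comp hl, fun x => !₂[f₀ x, f₁ x], fun i x => !₂[q₀ i x, q₁ i x], hP, ?_⟩
  refine tendsto_eLpNorm_of_apply (fun n j => ((H _).trace j).memLp.1)
    (fun j => (h1Trace_extend hP hG 1 j).memLp.1) fun j => ?_
  fin_cases j
  · simpa [point, proj, Function.comp_def] using hf₀.comp hl.tendsto_atTop
  · simpa [point, proj] using hf₁
  -- The third component vanishes on the faces, so it is bounded by its vertical derivative, which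
  -- tends to 0 along the whole sequence.
  · have h1 : Tendsto (fun n => eLpNorm (fun x => W n x 2) 2 (volume.restrict (film Ω 1)))
        atTop (𝓝 0) :=
      tendsto_of_tendsto_of_tendsto_of_le_of_le tendsto_const_nhds
        (tendsto_eLpNorm_vertical hlim hM hQ 2) (fun _ => zero_le) fun n => (H n).vertical
    simpa [point, Function.comp_def] using h1.comp (hk.comp hl).tendsto_atTop

/-- The horizontal derivatives of W are the entries of Q themselves; the vertical one is h times a
bounded quantity and tends to 0, the vertical derivative of a planar map. -/
theorem tendstoH1_of_rescaled [IsFiniteMeasure (arcLength Ω)] (hΩ : IsOpen Ω) (hG : Continuous G)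
    (hlim : Tendsto h atTop (𝓝 0)) (H : ∀ n, Rescaled Ω g G ε (h n) (W n) (Q n)) (hM : M ≠ ⊤)
    (hQ : ∀ n i, eLpNorm (Q n i) 2 (volume.restrict (film Ω 1)) ≤ M) {u : R 2 → R 2}
    {P : Fin 2 → R 2 → R 2}
    (hP : ∀ j, H1Trace Ω (arcLength Ω) (fun x => u x j) (fun i x => P i x j) (fun x => G x j))
    (hL : Tendsto (fun n => eLpNorm (fun x => W n x - point (u (proj x)) 0) 2
      (volume.restrict (film Ω 1))) atTop (𝓝 0))
    (hD : ∀ i, Tendsto (fun n => eLpNorm (fun x => Q n i x - extGrad P i x) 2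
      (volume.restrict (film Ω 1))) atTop (𝓝 0)) (j : Fin 3) :
    TendstoH1 (film Ω 1) (fun n x => W n x j) (fun x => point (u (proj x)) 0 j) := by
  have hext := h1Trace_extend hP hG 1 j
  refine ⟨fun n => ((H n).trace j).memH1, hext.memH1, ?_, fun i => ?_⟩
  · exact tendsto_of_tendsto_of_tendsto_of_le_of_le tendsto_const_nhds hL (fun _ => zero_le)
      fun n => eLpNorm_apply_le (fun x => W n x - point (u (proj x)) 0) j
  · have h1 : Tendsto (fun n => eLpNorm (fun x => (![1, 1, h n] : Fin 3 → ℝ) i * Q n i x j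
        - extGrad P i x j) 2 (volume.restrict (film Ω 1))) atTop (𝓝 0) := by
      have h2 := tendsto_of_tendsto_of_tendsto_of_le_of_le tendsto_const_nhds (hD i)
        (fun _ => zero_le) fun n => eLpNorm_apply_le (fun x => Q n i x - extGrad P i x) j
      fin_cases i
      · simpa using h2
      · simpa using h2
      · simpa [extGrad] using tendsto_eLpNorm_vertical hlim hM hQ j
    refine h1.congr fun n => eLpNorm_congr_ae ?_
    filter_upwards [((H n).trace j).weakPartial_ae_eq (isOpen_film hΩ 1) i,
      hext.weakPartial_ae_eq (isOpen_film hΩ 1) i] with x hx hx'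
    rw [hx, hx']

end Limit

end

end ThinFilm

end

/-! ### Assembly of the main theorem. -/

theorem mainTheorem8 (Ω : Set (R 2)) (hΩ : IsSmoothOpen Ω) (hΩb : Bornology.IsBounded Ω)
    (hΩs : SimplyConnectedSpace Ω) (g : R 2 → R 2) (hg : IsSmoothBoundaryMap Ω g)
    (ε : ℝ) (hε : 0 < ε)
    (h : ℕ → ℝ) (hpos : ∀ n, 0 < h n) (hlim : Tendsto h atTop (𝓝 0))
    (w : ℕ → R 3 → R 3)
    (hw : ∀ n, IsMinimizer (energy ε (film Ω (h n))) (filmClass Ω g (h n)) (w n)) :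
    ∃ k : ℕ → ℕ, StrictMono k ∧
      ∃ u : R 2 → R 2, IsMinimizer (energy ε Ω) (H1g Ω g) u ∧
        ∀ j, TendstoH1 (film Ω 1) (fun n p => rescale (h (k n)) (w (k n)) p j)
          (fun p => point (u (proj p)) 0 j) := by
  have hopen := hΩ.isOpen
  have : IsFiniteMeasure (volume.restrict Ω) := ⟨by simpa using hΩb.measure_lt_top⟩
  have := isFiniteMeasure_arcLength hΩ hΩb
  obtain ⟨G, hGs, hG⟩ := hg.smooth
  have hGc := hGs.continuous
  -- G itself is a planar competitor, and its energy bounds all rescaled gradients uniformly.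
  have hGmem : G ∈ H1g Ω g := (mem_H1g_iff hopen hG).2 fun j =>
    ⟨_, h1Trace_of_contDiff hΩb (arcLength Ω) (contDiff_euclidean.1 hGs j)⟩
  choose Q hQ using fun n => exists_rescaled hopen hG hGc (hpos n) (hw n)
  have hM := ENNReal.rpow_ne_top_of_nonneg (y := 1 / 2) (by norm_num)
    (ENNReal.ofReal_ne_top (r := energy ε Ω G / min 1 (1 + (1 / ε ^ 2 - 1))))
  have hQM := fun n i => (hQ n).eLpNorm_le hε hGmem i
  obtain ⟨k, hk, u, P, hP, hL⟩ := exists_limit hopen hΩb hGc hlim hQ hM hQM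
  have hu : u ∈ H1g Ω g := (mem_H1g_iff hopen hG).2 fun j => ⟨_, hP j⟩
  have hUL := memLp_of_apply fun j => (h1Trace_extend hP hGc 1 j).memLp
  -- A further subsequence converges a.e., as the discontinuous coefficient u/|u| requires.
  obtain ⟨l, hl, hae⟩ := exists_subseq_ae (fun n => (hQ (k n)).memLp_fun.1) hUL.1 hL
  have hkl := (hk.comp hl).tendsto_atTop
  have hL' := hL.comp hl.tendsto_atTop
  obtain ⟨hmin, hD⟩ := minimizes_and_tendsto hopen hGc hε (fun n => hQ (k (l n))) hu hP hL' hae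
  exact ⟨k ∘ l, hk.comp hl, u, ⟨hu, hmin⟩, fun j => tendstoH1_of_rescaled hopen hGc
    (hlim.comp hkl) (fun n => hQ (k (l n))) hM (fun n => hQM (k (l n))) hP hL' hD j⟩
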